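/- Let $H$ be a separable complex Hilbert space and let $A$ be a self-adjoint positive operator in $H$ with compact inverse. For $\beta\ge 0$ let $A^\beta$ be the power of $A$ given by its spectral decomposition and $H_\beta=\operatorname{dom}(A^\beta)$. For $\gamma\ge 0$ let $L_{2,\gamma}(\mathbb R_+,H)$ be the space of measurable $g:\mathbb R_+=(0,\infty)\to H$ with $\|g\|_{L_{2,\gamma}}^2=\int_0^\infty e^{-2\gamma t}\|g(t)\|^2\,dt<\infty$, and let $W^2_{2,\gamma}(\mathbb R_+,A^2)$ be the space of $u:\mathbb R_+\to H$ with weak derivatives $u',u''$ such that $u''$ and $A^2u$ belong to $L_{2,\gamma}(\mathbb R_+,H)$, with norm $$\|u\|_{W^2_{2,\gamma}(\mathbb R_+,A^2)}=\Big(\int_0^\infty e^{-2\gamma t}\big(\|u''(t)\|^2+\|A^2u(t)\|^2\big)\,dt\Big)^{1/2}.$$ Let $K(t)=\sum_{j=1}^\infty c_je^{-\gamma_jt}$ with $c_j>0$, $0<\gamma_j<\gamma_{j+1}$, $\gamma_j\to+\infty$ and $\sum_j c_j/\gamma_j<1$. Let $\xi\in[0,1]$, and suppose that $\sum_j c_j/\gamma_j<a^{2(1-\xi)}$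 for every eigenvalue $a$ of $A$ (this follows from $\sum_j c_j/\gamma_j<1$ if $\xi=1$ or if all eigenvalues of $A$ are at least $1$). Let $\gamma_0\ge 0$, and consider the problem $$u''(t)+A^2u(t)-\int_0^tK(t-s)A^{2\xi}u(s)\,ds=f(t)\ \text{ for almost every } t>0,\qquad u(+0)=\varphi_0,\quad u'(+0)=\varphi_1 .$$ 1) If $\sum_j c_j<\infty$, then for every $\gamma>\gamma_0$ there is a constant $d>0$ such that for all $f$ with $A^{2-\xi}f\in L_{2,\gamma_0}(\mathbb R_+,H)$, all $\varphi_0\in H_2$ and all $\varphi_1\in H_1$ the problem has a unique solution $u$ in $W^2_{2,\gamma}(\mathbb R_+,A^2)$, and $$\|u\|_{W^2_{2,\gamma}(\mathbb R_+,A^2)}\le d\big(\|A^{2-\xi}f\|_{L_{2,\gamma}(\mathbb R_+,H)}+\|A^2\varphi_0\|+\|A\varphi_1\|\big).$$ 2) If $\sum_j c_j=\infty$ and $\xi\in(0,1]$, then for every $\gamma>\gamma_0$ there is a constant $d>0$ such that for all $f$ with $A^{2-\xi}f\in L_{2,\gamma_0}(\mathbb R_+,H)$, all $\varphi_0\in H_{2+\xi}$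 and all $\varphi_1\in H_{1+\xi}$ the problem has a unique solution $u$ in $W^2_{2,\gamma}(\mathbb R_+,A^2)$, and $$\|u\|_{W^2_{2,\gamma}(\mathbb R_+,A^2)}\le d\big(\|A^{2-\xi}f\|_{L_{2,\gamma}(\mathbb R_+,H)}+\|A^{2+\xi}\varphi_0\|+\|A^{1+\xi}\varphi_1\|\big).$$ -/

import Mathlib

open MeasureTheory Set Filter Topology
open scoped InnerProductSpace ContDiff

noncomputable section

namespace HypVolterra

variable {H : Type*} [NormedAddCommGroup H] [InnerProductSpace ℂ H] [CompleteSpace H]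

/-- An unbounded operator is positive: `⟪A x, x⟫ > 0` for all nonzero `x` in its domain
(for a self-adjoint `A` this number is real). -/
def IsPositive (A : H →ₗ.[ℂ] H) : Prop :=
  ∀ x : A.domain, x ≠ 0 → 0 < (⟪A x, (x : H)⟫_ℂ).re

/-- `A` is a bijection of its domain onto `H`, and its inverse is a compact operator. -/
def HasCompactInverse (A : H →ₗ.[ℂ] H) : Prop :=
  ∃ T : H →L[ℂ] H, IsCompactOperator T ∧ (∀ x : A.domain, T (A x) = x) ∧
    ∀ y : H, ∃ h : T y ∈ A.domain, A ⟨T y, h⟩ = y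

/-- The eigenspace `{x ∈ dom A | A x = a x}`. -/
def eigenspace (A : H →ₗ.[ℂ] H) (a : ℝ) : Submodule ℂ H :=
  (LinearMap.ker (A.toFun - (a : ℂ) • A.domain.subtype)).map A.domain.subtype

/-- The orthogonal projection of `H` onto the eigenspace of `A` at `a`. The eigenspace of a
self-adjoint (hence closed) operator is closed, so that taking its closure changes nothing. -/
def eigenProj (A : H →ₗ.[ℂ] H) (a : ℝ) : H →L[ℂ] H :=
  (eigenspace A a).topologicalClosure.starProjection

/-- The domain of `A ^ β`, that is, the space `H_β`: all `x` for which the orthogonal series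
`∑ₐ a ^ β • Pₐ x` over the eigenvalues `a` of `A` converges, equivalently
`∑ₐ a ^ (2 β) ‖Pₐ x‖ ^ 2 < ∞`. The index runs through all real `a`; the terms for which `a` is
not an eigenvalue vanish. -/
def powDomain (A : H →ₗ.[ℂ] H) (β : ℝ) : Submodule ℂ H where
  carrier := {x | Summable fun a : ℝ => a ^ β • eigenProj A a x}
  add_mem' := by
    intro x y hx hy
    simpa only [mem_ofPred_eq, map_add, smul_add] using hx.add hy
  zero_mem' := by
    simpa only [mem_ofPred_eq, map_zero, smul_zero] using summable_zero
  smul_mem' := by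
    intro z x hx
    simpa only [mem_ofPred_eq, map_smul, smul_comm _ z] using hx.const_smul z

/-- The value `A ^ β x = ∑ₐ a ^ β • Pₐ x`; it is used only for `x ∈ powDomain A β`. -/
def powApply (A : H →ₗ.[ℂ] H) (β : ℝ) (x : H) : H :=
  ∑' a : ℝ, a ^ β • eigenProj A a x

/-- `g` belongs to `L_{2,γ}(ℝ₊, H)`. -/
def MemL2w (γ : ℝ) (g : ℝ → H) : Prop :=
  MemLp (fun t : ℝ => Real.exp (-γ * t) • g t) 2 (volume.restrict (Ioi 0))

/-- The norm of `L_{2,γ}(ℝ₊, H)`. -/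
def normL2w (γ : ℝ) (g : ℝ → H) : ℝ :=
  Real.sqrt (∫ t in Ioi (0 : ℝ), Real.exp (-2 * γ * t) * ‖g t‖ ^ 2)

/-- `A ^ β g` belongs to `L_{2,γ}(ℝ₊, H)`: the values of `g` lie in the domain of `A ^ β` almost
everywhere, and `t ↦ A ^ β g(t)` is of class `L_{2,γ}`. -/
def MemL2wPow (A : H →ₗ.[ℂ] H) (β γ : ℝ) (g : ℝ → H) : Prop :=
  (∀ᵐ t ∂(volume.restrict (Ioi (0 : ℝ))), g t ∈ powDomain A β) ∧
    MemL2w γ (fun t => powApply A β (g t))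

/-- `v` is the weak derivative of `u` on `ℝ₊ = (0, ∞)`. -/
def IsWeakDeriv (u v : ℝ → H) : Prop :=
  LocallyIntegrableOn u (Ioi 0) ∧ LocallyIntegrableOn v (Ioi 0) ∧
    ∀ φ : ℝ → ℝ, ContDiff ℝ ∞ φ → HasCompactSupport φ → tsupport φ ⊆ Ioi 0 →
      ∫ t in Ioi (0 : ℝ), deriv φ t • u t = - ∫ t in Ioi (0 : ℝ), φ t • v t

/-- `u` belongs to the Sobolev space `W²_{2,γ}(ℝ₊, A²)`, and `u₁`, `u₂` are its first and second
weak derivatives. -/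
structure MemW2 (A : H →ₗ.[ℂ] H) (γ : ℝ) (u u₁ u₂ : ℝ → H) : Prop where
  weakDeriv_one : IsWeakDeriv u u₁
  weakDeriv_two : IsWeakDeriv u₁ u₂
  memL2_deriv_two : MemL2w γ u₂
  memL2_pow_two : MemL2wPow A 2 γ u

/-- The norm of `W²_{2,γ}(ℝ₊, A²)`, for a function `u` with second weak derivative `u₂`. -/
def normW2 (A : H →ₗ.[ℂ] H) (γ : ℝ) (u u₂ : ℝ → H) : ℝ :=
  Real.sqrt (∫ t in Ioi (0 : ℝ),
    Real.exp (-2 * γ * t) * (‖u₂ t‖ ^ 2 + ‖powApply A 2 (u t)‖ ^ 2))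

/-- `u(+0) = x`: the continuous representative of `u` on `(0, ∞)` tends to `x` at `0`. -/
def HasInitialValue (u : ℝ → H) (x : H) : Prop :=
  ∃ v : ℝ → H, ContinuousOn v (Ioi 0) ∧ v =ᵐ[volume.restrict (Ioi 0)] u ∧
    Tendsto v (𝓝[>] 0) (𝓝 x)

/-- The kernel `K(t) = ∑ⱼ cⱼ exp(-κⱼ t)`. -/
def kernel (c κ : ℕ → ℝ) (t : ℝ) : ℝ := ∑' j, c j * Real.exp (-κ j * t)

/-- `u`, with weak derivatives `u₁ = u'` and `u₂ = u''`, is a strong solution in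
`W²_{2,γ}(ℝ₊, A²)` of
`u'' + A² u - ∫₀ᵗ K(t - s) A^{2ξ} u(s) ds = f`, `u(+0) = φ₀`, `u'(+0) = φ₁`;
the equation holds almost everywhere, which includes the existence of the integral. -/
structure IsStrongSolution (A : H →ₗ.[ℂ] H) (K : ℝ → ℝ) (ξ γ : ℝ) (f : ℝ → H) (φ₀ φ₁ : H)
    (u u₁ u₂ : ℝ → H) : Prop where
  memW2 : MemW2 A γ u u₁ u₂
  equation : ∀ᵐ t ∂(volume.restrict (Ioi (0 : ℝ))),
    IntervalIntegrable (fun s => K (t - s) • powApply A (2 * ξ) (u s)) volume 0 t ∧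
      u₂ t + powApply A 2 (u t) - (∫ s in (0 : ℝ)..t, K (t - s) • powApply A (2 * ξ) (u s)) = f t
  initial_zero : HasInitialValue u φ₀
  initial_one : HasInitialValue u₁ φ₁

end HypVolterra

end

open HypVolterra

/-! The operator `A` has a compact symmetric inverse, so its eigenspaces span `H`. On the eigenspace
at `a` the problem becomes the Volterra equation x'' + αx - b K∗x = g with α = a², b = a^(2ξ). Let
`S` solve the homogeneous scalar equation with S(0) = 0, S'(0) = 1, and let C = S'. Variation of
constants gives x = Cp + Sq + S∗g, where p and q are the initial data. Everything then rests on
bounds for `S` and `C` that are uniform in a and in time.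

These come from an energy estimate. Let k = ∑ cⱼ/κⱼ = ∫K. Multiplying the homogeneous equation by 2C
gives (C² + αS²)' = 2b C(K∗S). For a single exponential, v = e^(-κ·)∗S satisfies v' = S - κv, and
therefore Cv + (S - κv)² is the derivative of (S² - (S - κv)²)/(2κ). Thus ∫Cv ≤ S²/(2κ), and summing
over the exponentials yields C² + (α - bk)S² ≤ 1 (`IsResolvent.energy`). The spectral hypothesis at
the least eigenvalue a₀ gives α - bk ≥ δa² with one δ > 0 for all eigenvalues, so |C| ≤ 1 and |S| ≤
1/(a√δ).

Consequently a²x is controlled by a²p, aq and ag, and ag by a^(2-ξ)g because ξ ≤ 1. Summing squares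
over the eigenvalues bounds ‖A²u(t)‖² by `energyBound`, which is integrable against e^(-2γt) since γ
> 0. The second derivative is read off from the equation, with Young's inequality for the memory
term. Uniqueness is also modal: the difference of two solutions satisfies a homogeneous Volterra
equation in each eigenspace, and an exponentially weighted maximum shows that it vanishes.

The kernel enters these bounds only through k, so a single estimate serves both assertions. In the
second one the data are measured in stronger norms, at the cost of a factor a₀^(-ξ). -/

namespace HypVolterra

/-! ### Spectral resolution of an operator with compact inverse -/

section Spectral

variable {H : Type*} [NormedAddCommGroup H] [InnerProductSpace ℂ H] {A : H →ₗ.[ℂ] H}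

theorem mem_eigenspace {a : ℝ} {x : H} :
    x ∈ eigenspace A a ↔ ∃ h : x ∈ A.domain, A ⟨x, h⟩ = (a : ℂ) • x := by
  simp only [eigenspace, Submodule.mem_map, LinearMap.mem_ker, LinearMap.sub_apply,
    LinearMap.smul_apply, Submodule.subtype_apply, sub_eq_zero]
  constructor
  · rintro ⟨⟨y, hy⟩, h, rfl⟩
    exact ⟨hy, h⟩
  · rintro ⟨h, hx⟩
    exact ⟨⟨x, h⟩, hx, rfl⟩

theorem eigenvalue_pos (hApos : IsPositive A) {a : ℝ} (ha : eigenspace A a ≠ ⊥) : 0 < a := by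
  obtain ⟨x, hx, hx0⟩ := Submodule.exists_mem_ne_zero_of_ne_bot ha
  obtain ⟨h, hAx⟩ := mem_eigenspace.1 hx
  have h1 := hApos ⟨x, h⟩ (fun h0 => hx0 (congrArg Subtype.val h0))
  rw [hAx, inner_smul_left] at h1
  have h2 : 0 < ‖x‖ ^ 2 := by positivity
  have h3 : ((starRingEnd ℂ) (a : ℂ) * ⟪x, x⟫_ℂ).re = a * ‖x‖ ^ 2 := by
    rw [inner_self_eq_norm_sq_to_K, Complex.conj_ofReal]
    simp [← Complex.ofReal_pow]
  simp only [h3] at h1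
  exact pos_of_mul_pos_left h1 h2.le

/-- Transfers eigenspaces to the bounded inverse, where closedness is immediate and the spectral
theorem for compact operators applies. -/
theorem inverse_mem_eigenspace {T : H →L[ℂ] H} (hT₁ : ∀ x : A.domain, T (A x) = x)
    (hT₂ : ∀ y : H, ∃ h : T y ∈ A.domain, A ⟨T y, h⟩ = y) {a : ℝ} {x : H} :
    x ∈ eigenspace A a ↔ (a : ℂ) • T x = x := by
  rw [mem_eigenspace]
  constructor
  · rintro ⟨h, hx⟩
    rw [← map_smul, ← hx, hT₁]
  · intro hx
    obtain ⟨h, hy⟩ := hT₂ x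
    have hd : x ∈ A.domain := by
      rw [← hx]
      exact A.domain.smul_mem _ h
    refine ⟨hd, ?_⟩
    have h1 : (⟨x, hd⟩ : A.domain) = (a : ℂ) • ⟨T x, h⟩ := by
      apply Subtype.ext
      simp [hx]
    rw [h1, LinearPMap.map_smul, hy]

variable [CompleteSpace H]

theorem inverse_isSymmetric (hA : IsSelfAdjoint A) {T : H →L[ℂ] H}
    (hT₂ : ∀ y : H, ∃ h : T y ∈ A.domain, A ⟨T y, h⟩ = y) : T.IsSymmetric := by
  intro x y
  obtain ⟨hx, hx'⟩ := hT₂ x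
  obtain ⟨hy, hy'⟩ := hT₂ y
  have h1 := LinearPMap.adjoint_isFormalAdjoint hA.dense_domain
  rw [LinearPMap.isSelfAdjoint_def.1 hA] at h1
  have h2 := h1 ⟨T x, hx⟩ ⟨T y, hy⟩
  rw [hx', hy'] at h2
  exact h2.symm

omit [CompleteSpace H] in
theorem isClosed_eigenspace (hAinv : HasCompactInverse A) (a : ℝ) :
    IsClosed (eigenspace A a : Set H) := by
  obtain ⟨T, -, hT₁, hT₂⟩ := hAinv
  have h : (eigenspace A a : Set H) = {x | (a : ℂ) • T x = x} := by
    ext x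
    exact inverse_mem_eigenspace hT₁ hT₂
  rw [h]
  exact isClosed_eq (by fun_prop) continuous_id

theorem eigenProj_mem (hAinv : HasCompactInverse A) (a : ℝ) (x : H) :
    eigenProj A a x ∈ eigenspace A a := by
  have h : eigenProj A a x ∈ (eigenspace A a).topologicalClosure :=
    Submodule.starProjection_apply_mem _ x
  rwa [(isClosed_eigenspace hAinv a).submodule_topologicalClosure_eq] at h

theorem eigenProj_of_mem {a : ℝ} {x : H} (hx : x ∈ eigenspace A a) : eigenProj A a x = x :=
  Submodule.starProjection_eq_self_iff.2 (Submodule.le_topologicalClosure _ hx)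

theorem inner_eigenspace_eq_zero (hA : IsSelfAdjoint A) {a b : ℝ} (hab : a ≠ b)
    {x y : H} (hx : x ∈ eigenspace A a) (hy : y ∈ eigenspace A b) : ⟪x, y⟫_ℂ = 0 := by
  obtain ⟨hx, hx'⟩ := mem_eigenspace.1 hx
  obtain ⟨hy, hy'⟩ := mem_eigenspace.1 hy
  have h1 := LinearPMap.adjoint_isFormalAdjoint hA.dense_domain
  rw [LinearPMap.isSelfAdjoint_def.1 hA] at h1
  have h2 := h1 ⟨x, hx⟩ ⟨y, hy⟩
  rw [hx', hy'] at h2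
  simp only [inner_smul_left, inner_smul_right, Complex.conj_ofReal] at h2
  by_contra h
  exact hab (by exact_mod_cast mul_right_cancel₀ h h2)

theorem eigenProj_of_mem_ne (hA : IsSelfAdjoint A) (hAinv : HasCompactInverse A) {a b : ℝ}
    (hab : a ≠ b) {x : H} (hx : x ∈ eigenspace A b) : eigenProj A a x = 0 := by
  refine (Submodule.starProjection_apply_eq_zero_iff _).2 ?_
  rw [(isClosed_eigenspace hAinv a).submodule_topologicalClosure_eq]
  exact (Submodule.mem_orthogonal _ _).2 fun u hu => inner_eigenspace_eq_zero hA hab hu hx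

theorem orthogonalFamily_eigenspace (hA : IsSelfAdjoint A) :
    OrthogonalFamily ℂ (fun a : ℝ => eigenspace A a) fun a => (eigenspace A a).subtypeₗᵢ :=
  fun _ _ hab x y => inner_eigenspace_eq_zero hA hab x.2 y.2

/-- The spectral theorem for the compact symmetric inverse `T`. Its eigenvalues μ are real by
symmetry and nonzero by injectivity, so each of its eigenspaces lies in the eigenspace of `A` at
1/μ. -/
theorem isHilbertSum_eigenspace (hA : IsSelfAdjoint A) (hAinv : HasCompactInverse A) :
    IsHilbertSum ℂ (fun a : ℝ => eigenspace A a) fun a => (eigenspace A a).subtypeₗᵢ := by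
  have (a : ℝ) : CompleteSpace (eigenspace A a) := (isClosed_eigenspace hAinv a).completeSpace_coe
  refine IsHilbertSum.mkInternal _ (orthogonalFamily_eigenspace hA) ?_
  obtain ⟨T, hTc, hT₁, hT₂⟩ := hAinv
  have hsymm := inverse_isSymmetric hA hT₂
  have h1 := ContinuousLinearMap.orthogonalComplement_iSup_eigenspaces_eq_bot hTc hsymm
  have h2 : (⨆ μ, Module.End.eigenspace (T : Module.End ℂ H) μ) ≤ ⨆ a : ℝ, eigenspace A a := by
    refine iSup_le fun μ => ?_
    by_cases hμ : Module.End.HasEigenvalue (T : Module.End ℂ H) μ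
    · have hμre : ((μ.re : ℝ) : ℂ) = μ :=
        Complex.conj_eq_iff_re.1 (LinearMap.IsSymmetric.conj_eigenvalue_eq_self hsymm hμ)
      have hμ0 : μ ≠ 0 := by
        rintro rfl
        obtain ⟨v, hv⟩ := hμ.exists_hasEigenvector
        have h3 : T v = 0 := by simpa using hv.apply_eq_smul
        obtain ⟨h, h4⟩ := hT₂ v
        have h5 : (⟨T v, h⟩ : A.domain) = 0 := Subtype.ext h3
        rw [h5, LinearPMap.map_zero] at h4
        exact hv.2 h4.symm
      refine le_trans ?_ (le_iSup _ (μ.re⁻¹))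
      intro x hx
      rw [inverse_mem_eigenspace hT₁ hT₂]
      have h3 : T x = μ • x := Module.End.mem_eigenspace_iff.1 hx
      rw [h3, Complex.ofReal_inv, hμre, smul_smul, inv_mul_cancel₀ hμ0, one_smul]
    · have : Module.End.eigenspace (T : Module.End ℂ H) μ = ⊥ := by
        by_contra h
        exact hμ h
      rw [this]
      exact bot_le
  rw [top_le_iff, Submodule.topologicalClosure_eq_top_iff, eq_bot_iff, ← h1]
  exact Submodule.orthogonal_le h2

theorem hasSum_eigenProj_and_sq (hA : IsSelfAdjoint A) (hAinv : HasCompactInverse A) (x : H) :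
    HasSum (fun a : ℝ => eigenProj A a x) x ∧
      HasSum (fun a : ℝ => ‖eigenProj A a x‖ ^ 2) (‖x‖ ^ 2) := by
  have hS := isHilbertSum_eigenspace hA hAinv
  set w := hS.linearIsometryEquiv x with hw
  have h1 : HasSum (fun a : ℝ => (w a : H)) x := by
    have := hS.hasSum_linearIsometryEquiv_symm w
    simpa [hw] using this
  have h2 (b : ℝ) : eigenProj A b x = w b := by
    have h3 := h1.mapL (eigenProj A b)
    refine h3.unique ?_
    have h4 : eigenProj A b (w b : H) = w b := eigenProj_of_mem (w b).2
    rw [← h4]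
    exact hasSum_single b fun a hab => eigenProj_of_mem_ne hA hAinv hab.symm (w a).2
  refine ⟨by simpa only [h2] using h1, ?_⟩
  have h5 : ‖x‖ = ‖w‖ := (hS.linearIsometryEquiv.norm_map x).symm
  have h6 := lp.hasSum_norm (p := 2) (by norm_num) w
  rw [h5]
  simp only [h2]
  simpa using h6

theorem eigenProj_eq_zero {a : ℝ} (ha : eigenspace A a = ⊥) (hAinv : HasCompactInverse A)
    (x : H) : eigenProj A a x = 0 := by
  have := eigenProj_mem hAinv a x
  rwa [ha, Submodule.mem_bot] at this

/-- For the self-adjoint `T` the spectral radius equals ‖T‖ and is attained in the spectrum, at a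
point that compactness makes an eigenvalue. Its reciprocal is least, since `T x = x / a` forces a‖T‖
≥ 1. -/
theorem exists_least_eigenvalue [Nontrivial H] (hA : IsSelfAdjoint A) (hApos : IsPositive A)
    (hAinv : HasCompactInverse A) :
    ∃ a₀ : ℝ, eigenspace A a₀ ≠ ⊥ ∧ ∀ a, eigenspace A a ≠ ⊥ → a₀ ≤ a := by
  obtain ⟨T, hTc, hT₁, hT₂⟩ := id hAinv
  have hsymm := inverse_isSymmetric hA hT₂
  obtain ⟨μ, hμ, hμT⟩ := spectrum.exists_nnnorm_eq_spectralRadius T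
  rw [T.spectralRadius_eq_nnnorm hsymm.isSelfAdjoint] at hμT
  have hμT' : ‖μ‖ = ‖T‖ := by
    have := ENNReal.coe_inj.1 hμT
    exact congrArg NNReal.toReal this
  have hT0 : T ≠ 0 := by
    rintro rfl
    obtain ⟨v, hv⟩ := exists_ne (0 : H)
    obtain ⟨h, h4⟩ := hT₂ v
    have h5 : (⟨(0 : H →L[ℂ] H) v, h⟩ : A.domain) = 0 := Subtype.ext rfl
    rw [h5, LinearPMap.map_zero] at h4
    exact hv h4.symm
  have hμ0 : μ ≠ 0 := by
    rw [← norm_ne_zero_iff, hμT']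
    exact norm_ne_zero_iff.2 hT0
  have hev := (hTc.hasEigenvalue_iff_mem_spectrum hμ0).2 hμ
  have hμre : ((μ.re : ℝ) : ℂ) = μ :=
    Complex.conj_eq_iff_re.1 (LinearMap.IsSymmetric.conj_eigenvalue_eq_self hsymm hev)
  have hne : eigenspace A μ.re⁻¹ ≠ ⊥ := by
    obtain ⟨v, hv⟩ := hev.exists_hasEigenvector
    refine (Submodule.ne_bot_iff _).2 ⟨v, ?_, hv.2⟩
    rw [inverse_mem_eigenspace hT₁ hT₂]
    have h3 : T v = μ • v := hv.apply_eq_smul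
    rw [h3, Complex.ofReal_inv, hμre, smul_smul, inv_mul_cancel₀ hμ0, one_smul]
  refine ⟨μ.re⁻¹, hne, fun a ha => ?_⟩
  have hpos : 0 < μ.re := inv_pos.1 (eigenvalue_pos hApos hne)
  have ha0 := eigenvalue_pos hApos ha
  obtain ⟨x, hx, hx0⟩ := Submodule.exists_mem_ne_zero_of_ne_bot ha
  rw [inverse_mem_eigenspace hT₁ hT₂] at hx
  have h1 : ‖x‖ ≤ a * (‖T‖ * ‖x‖) := by
    calc ‖x‖ = ‖(a : ℂ) • T x‖ := by rw [hx]
      _ = a * ‖T x‖ := by rw [norm_smul, Complex.norm_real, Real.norm_of_nonneg ha0.le]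
      _ ≤ _ := by gcongr; exact T.le_opNorm x
  have h2 : ‖T‖ = μ.re := by
    rw [← hμT', ← hμre, Complex.norm_real, Real.norm_of_nonneg hpos.le, Complex.ofReal_re]
  rw [h2] at h1
  have h3 : 0 < ‖x‖ := norm_pos_iff.2 hx0
  rw [inv_le_iff_one_le_mul₀ hpos]
  have : 1 * ‖x‖ ≤ (a * μ.re) * ‖x‖ := by linarith
  exact le_of_mul_le_mul_right this h3


/-- The eigenprojections of `A` form a resolution of the identity, and the eigenvalues of `A`
are at least `a₀ > 0`. -/
structure HasSpectralResolution (A : H →ₗ.[ℂ] H) (a₀ : ℝ) : Prop where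
  pos : 0 < a₀
  hasSum : ∀ x, HasSum (fun a : ℝ => eigenProj A a x) x
  hasSum_sq : ∀ x, HasSum (fun a : ℝ => ‖eigenProj A a x‖ ^ 2) (‖x‖ ^ 2)
  idem : ∀ a x, eigenProj A a (eigenProj A a x) = eigenProj A a x
  ortho : ∀ a b x, a ≠ b → eigenProj A a (eigenProj A b x) = 0
  le_of_ne_zero : ∀ a, eigenProj A a ≠ 0 → a₀ ≤ a
  countable : {a | eigenProj A a ≠ 0}.Countable
  summable : ∀ y : ℝ → H, (∀ a, eigenProj A a (y a) = y a) →
    (Summable y ↔ Summable fun a => ‖y a‖ ^ 2)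

theorem hasSpectralResolution [TopologicalSpace.SeparableSpace H] (hA : IsSelfAdjoint A)
    (hAinv : HasCompactInverse A) {a₀ : ℝ} (h₀ : 0 < a₀)
    (hle : ∀ a, eigenspace A a ≠ ⊥ → a₀ ≤ a) : HasSpectralResolution A a₀ where
  pos := h₀
  hasSum x := (hasSum_eigenProj_and_sq hA hAinv x).1
  hasSum_sq x := (hasSum_eigenProj_and_sq hA hAinv x).2
  idem a x := eigenProj_of_mem (eigenProj_mem hAinv a x)
  ortho a b x hab := eigenProj_of_mem_ne hA hAinv hab (eigenProj_mem hAinv b x)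
  le_of_ne_zero a ha := hle a fun h => ha (by
    ext x
    exact eigenProj_eq_zero h hAinv x)
  countable := by
    -- A projection that kills a dense sequence is zero, and each vector has only countably many
    -- nonzero components.
    have h : {a | eigenProj A a ≠ 0} ⊆
        ⋃ n, Function.support fun a => eigenProj A a (TopologicalSpace.denseSeq H n) := by
      intro a ha
      by_contra h
      simp only [mem_iUnion, Function.mem_support, not_exists, not_not] at h
      apply ha
      have := (TopologicalSpace.denseRange_denseSeq H).equalizer (eigenProj A a).continuous
        (continuous_const (y := (0 : H))) (by ext n; simpa using h n)
      ext x
      simpa using congrFun this x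
    exact (countable_iUnion fun n =>
      (hasSum_eigenProj_and_sq hA hAinv _).1.summable.countable_support).mono h
  summable y hy := by
    have hmem (a : ℝ) : y a ∈ eigenspace A a := by
      rw [← hy a]
      exact eigenProj_mem hAinv a _
    exact (orthogonalFamily_eigenspace hA).summable_iff_norm_sq_summable
      fun a => (⟨y a, hmem a⟩ : eigenspace A a)

/-! ### Powers of the operator through their spectral coefficients -/

namespace HasSpectralResolution

variable {a₀ : ℝ} (R : HasSpectralResolution A a₀)
include R

omit R in
theorem norm_eigenProj_le (a : ℝ) (x : H) : ‖eigenProj A a x‖ ≤ ‖x‖ :=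
  Submodule.norm_starProjection_apply_le _ _

theorem ext {x y : H} (h : ∀ a, eigenProj A a x = eigenProj A a y) : x = y :=
  (R.hasSum x).unique (by simpa only [h] using R.hasSum y)

theorem sum_sq_le (s : Finset ℝ) (x : H) : ∑ a ∈ s, ‖eigenProj A a x‖ ^ 2 ≤ ‖x‖ ^ 2 :=
  sum_le_hasSum s (fun _ _ => by positivity) (R.hasSum_sq x)

theorem eigenProj_tsum {y : ℝ → H} (hy : ∀ a, eigenProj A a (y a) = y a) (hs : Summable y)
    (b : ℝ) : eigenProj A b (∑' a, y a) = y b := by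
  refine (hs.hasSum.mapL (eigenProj A b)).unique ?_
  have h := hasSum_single (f := fun a => eigenProj A b (y a)) b fun a hab => ?_
  · rwa [hy b] at h
  · rw [← hy a]
    exact R.ortho b a _ hab.symm

theorem eigenProj_smul_eigenProj (r : ℝ) (a : ℝ) (x : H) :
    eigenProj A a (r • eigenProj A a x) = r • eigenProj A a x := by
  rw [map_real_smul (eigenProj A a) (eigenProj A a).continuous, R.idem]

theorem eigenProj_powApply {β : ℝ} {x : H} (hx : x ∈ powDomain A β) (a : ℝ) :
    eigenProj A a (powApply A β x) = a ^ β • eigenProj A a x :=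
  R.eigenProj_tsum (fun _ => R.eigenProj_smul_eigenProj _ _ _) hx a

theorem mem_powDomain_iff {β : ℝ} {x : H} :
    x ∈ powDomain A β ↔ Summable fun a : ℝ => ‖a ^ β • eigenProj A a x‖ ^ 2 :=
  R.summable _ fun _ => R.eigenProj_smul_eigenProj _ _ _

theorem hasSum_powApply_sq {β : ℝ} {x : H} (hx : x ∈ powDomain A β) :
    HasSum (fun a : ℝ => ‖a ^ β • eigenProj A a x‖ ^ 2) (‖powApply A β x‖ ^ 2) := by
  simpa only [R.eigenProj_powApply hx] using R.hasSum_sq (powApply A β x)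

/-- Every eigenvalue is at least `a₀`, so lowering the exponent costs a power of `a₀`. For other
indices `a`, negative ones included, both sides vanish. The embedding constants between the spaces
`H_β` all come from here. -/
theorem norm_rpow_smul_le {α β : ℝ} (h : α ≤ β) (a : ℝ) (x : H) :
    ‖a ^ α • eigenProj A a x‖ ≤ a₀ ^ (α - β) * ‖a ^ β • eigenProj A a x‖ := by
  by_cases ha : eigenProj A a = 0
  · simp [ha]
  have h1 := R.le_of_ne_zero a ha
  have h0 : 0 < a := R.pos.trans_le h1
  rw [norm_smul, norm_smul, ← mul_assoc, Real.norm_of_nonneg (by positivity),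
    Real.norm_of_nonneg (by positivity)]
  gcongr
  calc a ^ α = a ^ (α - β) * a ^ β := by rw [← Real.rpow_add h0]; ring_nf
    _ ≤ a₀ ^ (α - β) * a ^ β := by
      exact mul_le_mul_of_nonneg_right
        (Real.rpow_le_rpow_of_nonpos R.pos h1 (sub_nonpos.2 h)) (by positivity)

theorem powDomain_mono {α β : ℝ} (h : α ≤ β) {x : H} (hx : x ∈ powDomain A β) :
    x ∈ powDomain A α := by
  rw [R.mem_powDomain_iff] at hx ⊢
  refine Summable.of_nonneg_of_le (fun _ => by positivity) (fun a => ?_)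
    (hx.mul_left ((a₀ ^ (α - β)) ^ 2))
  rw [← mul_pow]
  gcongr
  exact R.norm_rpow_smul_le h a x

theorem norm_powApply_le {α β : ℝ} (h : α ≤ β) {x : H} (hx : x ∈ powDomain A β) :
    ‖powApply A α x‖ ≤ a₀ ^ (α - β) * ‖powApply A β x‖ := by
  have h0 := R.pos
  refine le_of_sq_le_sq ?_ (by positivity)
  rw [mul_pow]
  refine hasSum_le (fun a => ?_) (R.hasSum_powApply_sq (R.powDomain_mono h hx))
    ((R.hasSum_powApply_sq hx).mul_left ((a₀ ^ (α - β)) ^ 2))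
  rw [← mul_pow]
  gcongr
  exact R.norm_rpow_smul_le h a x

theorem powApply_zero (x : H) : powApply A 0 x = x := by
  simpa [powApply] using (R.hasSum x).tsum_eq

theorem norm_le {β : ℝ} (h : 0 ≤ β) {x : H} (hx : x ∈ powDomain A β) :
    ‖x‖ ≤ a₀ ^ (-β) * ‖powApply A β x‖ := by
  simpa [R.powApply_zero] using R.norm_powApply_le h hx

/-- Countability of the spectrum makes `atTop` on the finite index sets countably generated, so the
limit of the measurable partial sums is measurable. Measurability can thus be checked mode by mode.
-/
theorem aestronglyMeasurable {α : Type*} [MeasurableSpace α] {μ : Measure α} {g : α → H}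
    (h : ∀ a, AEStronglyMeasurable (fun t => eigenProj A a (g t)) μ) :
    AEStronglyMeasurable g μ := by
  have := R.countable.to_subtype
  refine aestronglyMeasurable_of_tendsto_ae (atTop : Filter (Finset {a | eigenProj A a ≠ 0}))
    (f := fun s t => ∑ a ∈ s, eigenProj A a (g t)) (fun s => ?_) (ae_of_all _ fun t => ?_)
  · exact Finset.aestronglyMeasurable_fun_sum _ fun a _ => h a
  · refine (hasSum_subtype_iff_of_support_subset (s := {a | eigenProj A a ≠ 0}) ?_).2
      (R.hasSum (g t))
    intro a ha h0
    simp [h0] at ha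

end HasSpectralResolution

end Spectral

/-! ### Convolution on the half-line -/

section HalfLine

variable {E : Type*} [NormedAddCommGroup E]

/-- Integrability on all intervals `(0, T)`. -/
def HalfLineIntegrable (g : ℝ → E) : Prop := ∀ T, 0 ≤ T → IntervalIntegrable g volume 0 T

theorem HalfLineIntegrable.of_continuousOn {g : ℝ → E} (hg : ContinuousOn g (Ici 0)) :
    HalfLineIntegrable g := fun T hT =>
  (hg.mono (by rw [uIcc_of_le hT]; exact Icc_subset_Ici_self)).intervalIntegrable

theorem HalfLineIntegrable.integrableOn_Ioc {g : ℝ → E} (hg : HalfLineIntegrable g) {T : ℝ}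
    (hT : 0 ≤ T) : IntegrableOn g (Ioc 0 T) :=
  (intervalIntegrable_iff_integrableOn_Ioc_of_le hT).1 (hg T hT)

theorem HalfLineIntegrable.add {g h : ℝ → E} (hg : HalfLineIntegrable g)
    (hh : HalfLineIntegrable h) : HalfLineIntegrable fun t => g t + h t := fun T hT =>
  (hg T hT).add (hh T hT)

theorem HalfLineIntegrable.sub {g h : ℝ → E} (hg : HalfLineIntegrable g)
    (hh : HalfLineIntegrable h) : HalfLineIntegrable fun t => g t - h t := fun T hT =>
  (hg T hT).sub (hh T hT)

theorem HalfLineIntegrable.locallyIntegrableOn {g : ℝ → E} (hg : HalfLineIntegrable g) :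
    LocallyIntegrableOn g (Ioi 0) := by
  refine (locallyIntegrableOn_iff isOpen_Ioi.isLocallyClosed).2 fun k hk hkc => ?_
  obtain ⟨T, hT⟩ := hkc.bddAbove
  refine (hg.integrableOn_Ioc (le_max_right T 0)).mono_set fun x hx => ⟨hk hx, ?_⟩
  exact (hT hx).trans (le_max_left _ _)

theorem HalfLineIntegrable.comp_sub_left {p : ℝ → E} (hp : HalfLineIntegrable p) {t : ℝ}
    (ht : 0 ≤ t) : IntervalIntegrable (fun s => p (t - s)) volume 0 t := by
  simpa using ((hp t ht).comp_sub_left t).symm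

theorem exists_bound_Icc {x : ℝ → E}
    (hx : ContinuousOn x (Ici 0)) (T : ℝ) : ∃ M, 0 ≤ M ∧ ∀ t ∈ Icc 0 T, ‖x t‖ ≤ M := by
  obtain ⟨M, hM⟩ := isCompact_Icc.exists_bound_of_continuousOn
    (hx.mono fun _ h => (mem_Icc.1 h).1 : ContinuousOn x (Icc 0 T))
  exact ⟨max M 0, le_max_right _ _, fun t ht => (hM t ht).trans (le_max_left _ _)⟩

variable [NormedSpace ℝ E]

theorem HalfLineIntegrable.const_smul {g : ℝ → E} (hg : HalfLineIntegrable g) (r : ℝ) :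
    HalfLineIntegrable fun t => r • g t := fun T hT =>
  (hg T hT).smul r

/-- The convolution `∫₀ᵗ p(t - s) g(s) ds` on the half-line. -/
noncomputable def vconv (p : ℝ → ℝ) (g : ℝ → E) (t : ℝ) : E := ∫ s in (0 : ℝ)..t, p (t - s) • g s

theorem vconv_swap (p : ℝ → ℝ) (g : ℝ → E) (t : ℝ) :
    vconv p g t = ∫ s in (0 : ℝ)..t, p s • g (t - s) := by
  have := intervalIntegral.integral_comp_sub_left (a := 0) (b := t)
    (fun s => p (t - s) • g s) t
  simp only [sub_sub_cancel, sub_self, sub_zero] at this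
  exact this.symm

theorem vconv_comm (p q : ℝ → ℝ) (t : ℝ) : vconv p q t = vconv q p t := by
  rw [vconv_swap, vconv]
  simp only [smul_eq_mul, mul_comm]

theorem vconv_one (g : ℝ → E) (t : ℝ) : vconv (fun _ => 1) g t = ∫ s in (0 : ℝ)..t, g s := by
  simp [vconv]

theorem vconv_congr_right {p : ℝ → ℝ} {g h : ℝ → E} {t : ℝ} (ht : 0 ≤ t)
    (hgh : ∀ s, 0 < s → s ≤ t → g s = h s) : vconv p g t = vconv p h t := by
  refine intervalIntegral.integral_congr_ae (ae_of_all _ fun s hs => ?_)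
  rw [uIoc_of_le ht] at hs
  simp only [hgh s hs.1 hs.2]

theorem vconv_congr_left {p q : ℝ → ℝ} {g : ℝ → E} {t : ℝ} (ht : 0 ≤ t)
    (hpq : ∀ s, 0 ≤ s → s < t → p s = q s) : vconv p g t = vconv q g t := by
  refine intervalIntegral.integral_congr_ae (ae_of_all _ fun s hs => ?_)
  rw [uIoc_of_le ht] at hs
  simp only [hpq (t - s) (by linarith [hs.2]) (by linarith [hs.1])]

theorem vconv_congr_ae {p : ℝ → ℝ} {g h : ℝ → E} {t : ℝ} (ht : 0 ≤ t)
    (hgh : ∀ᵐ s ∂(volume.restrict (Ioi (0 : ℝ))), g s = h s) : vconv p g t = vconv p h t := by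
  refine intervalIntegral.integral_congr_ae ?_
  filter_upwards [(ae_restrict_iff' measurableSet_Ioi).1 hgh] with s hs hst
  rw [uIoc_of_le ht] at hst
  rw [hs hst.1]

theorem continuousOn_parametric_primitive {F : ℝ → ℝ → E}
    (hmeas : ∀ t T, 0 ≤ t → 0 ≤ T → AEStronglyMeasurable (F t) (volume.restrict (Ioc 0 T)))
    (hbd : ∀ T, 0 ≤ T → ∃ b : ℝ → ℝ, IntegrableOn b (Ioc 0 T) ∧
      ∀ t ∈ Icc 0 T, ∀ s ∈ Ioc 0 T, ‖F t s‖ ≤ b s)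
    (hcont : ∀ s, ContinuousOn (fun t => F t s) (Ici 0)) :
    ContinuousOn (fun t => ∫ s in (0 : ℝ)..t, F t s) (Ici 0) := by
  intro t₀ ht₀
  have ht₀' : (0 : ℝ) ≤ t₀ := ht₀
  obtain ⟨b, hb, hFb⟩ := hbd (t₀ + 1) (by linarith)
  have hsub : uIoc (-1 : ℝ) (t₀ + 1) = Ioc (-1) (t₀ + 1) := uIoc_of_le (by linarith : (-1 : ℝ) ≤ t₀ + 1)
  have hcap : Ioi (0 : ℝ) ∩ Ioc (-1) (t₀ + 1) = Ioc 0 (t₀ + 1) := by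
    ext x
    simp only [mem_inter_iff, mem_Ioi, mem_Ioc]
    exact ⟨fun h => ⟨h.1, h.2.2⟩, fun h => ⟨h.1, by linarith [h.1], h.2⟩⟩
  -- Clamping the parameter to `max t 0` and cutting the integrand off for s ≤ 0 extends the
  -- integral to a two-sided neighbourhood, so the endpoint t₀ = 0 needs no separate argument.
  have key := intervalIntegral.continuousAt_parametric_primitive_of_dominated
    (μ := volume) (F := fun t => (Ioi (0 : ℝ)).indicator (F (max t 0)))
    ((Ioi (0 : ℝ)).indicator b) (-1) (t₀ + 1) (a₀ := 0) (b₀ := t₀) (x₀ := t₀)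
    (fun t => ?_) ?_ ?_ ?_ ⟨by norm_num, by linarith⟩ ⟨by linarith, by linarith⟩ (by simp)
  · have h2 : ContinuousAt (fun t : ℝ =>
        ∫ s in (0 : ℝ)..t, (Ioi (0 : ℝ)).indicator (F (max t 0)) s) t₀ :=
      ContinuousAt.comp (f := fun t : ℝ => (t, t)) key (by fun_prop)
    refine h2.continuousWithinAt.congr (fun t ht => ?_) ?_
    · have ht' : (0 : ℝ) ≤ t := ht
      refine intervalIntegral.integral_congr_ae (ae_of_all _ fun s hs => ?_)
      rw [uIoc_of_le ht'] at hs
      rw [indicator_of_mem (show s ∈ Ioi (0 : ℝ) from hs.1), max_eq_left ht']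
    · refine intervalIntegral.integral_congr_ae (ae_of_all _ fun s hs => ?_)
      rw [uIoc_of_le ht₀'] at hs
      rw [indicator_of_mem (show s ∈ Ioi (0 : ℝ) from hs.1), max_eq_left ht₀']
  · rw [aestronglyMeasurable_indicator_iff measurableSet_Ioi, Measure.restrict_restrict
      measurableSet_Ioi, hsub, hcap]
    exact hmeas _ _ (le_max_right _ _) (by linarith)
  · filter_upwards [Iio_mem_nhds (show t₀ < t₀ + 1 by linarith)] with t ht
    refine (ae_restrict_iff' measurableSet_uIoc).2 (ae_of_all _ fun s hs => ?_)
    rw [hsub] at hs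
    by_cases h0 : s ∈ Ioi (0 : ℝ)
    · rw [indicator_of_mem h0, indicator_of_mem h0]
      exact hFb _ ⟨le_max_right _ _, max_le (le_of_lt ht) (by linarith)⟩ _ ⟨h0, hs.2⟩
    · rw [indicator_of_notMem h0, indicator_of_notMem h0, norm_zero]
  · rw [intervalIntegrable_iff, hsub]
    rw [IntegrableOn, integrable_indicator_iff measurableSet_Ioi, IntegrableOn,
      Measure.restrict_restrict measurableSet_Ioi, hcap]
    exact hb
  · refine ae_of_all _ fun s => ?_
    by_cases h0 : s ∈ Ioi (0 : ℝ)
    · simp only [indicator_of_mem h0]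
      have h3 : Continuous fun t : ℝ => F (max t 0) s :=
        (hcont s).comp_continuous (by fun_prop) fun t => mem_Ici.2 (le_max_right _ _)
      exact h3.continuousAt
    · simp only [indicator_of_notMem h0]
      exact continuousAt_const

theorem continuousOn_vconv_left {m : ℝ → ℝ} (hm : Continuous m) {g : ℝ → E}
    (hg : HalfLineIntegrable g) : ContinuousOn (vconv m g) (Ici 0) := by
  refine continuousOn_parametric_primitive (F := fun t s => m (t - s) • g s)
    (fun t T _ hT => ?_) (fun T hT => ?_) (fun s => ?_)
  · exact (by fun_prop : Continuous fun s => m (t - s)).aestronglyMeasurable.smul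
      (hg.integrableOn_Ioc hT).1
  · obtain ⟨M, hM⟩ := (isCompact_Icc (a := -T) (b := T)).exists_bound_of_continuousOn
      hm.continuousOn
    refine ⟨fun s => M * ‖g s‖, ((hg.integrableOn_Ioc hT).norm).const_mul M, fun t ht s hs => ?_⟩
    rw [norm_smul]
    exact mul_le_mul_of_nonneg_right
      (hM _ ⟨by linarith [ht.1, hs.2], by linarith [ht.2, hs.1]⟩) (norm_nonneg _)
  · exact (by fun_prop : Continuous fun t => m (t - s) • g s).continuousOn

theorem continuousOn_vconv_right {p : ℝ → ℝ} (hp : HalfLineIntegrable p) {x : ℝ → E}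
    (hx : ContinuousOn x (Ici 0)) : ContinuousOn (vconv p x) (Ici 0) := by
  have hy : Continuous fun t : ℝ => x (max t 0) :=
    hx.comp_continuous (by fun_prop) fun t => mem_Ici.2 (le_max_right _ _)
  have h1 := continuousOn_parametric_primitive (F := fun t s => p s • x (max (t - s) 0))
    (fun t T _ hT => ?_) (fun T hT => ?_) (fun s => ?_)
  · refine h1.congr fun t ht => ?_
    have ht' : (0 : ℝ) ≤ t := ht
    rw [vconv_swap]
    refine intervalIntegral.integral_congr_ae (ae_of_all _ fun s hs => ?_)
    rw [uIoc_of_le ht'] at hs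
    simp only [max_eq_left (show (0 : ℝ) ≤ t - s by linarith [hs.2])]
  · exact (hp.integrableOn_Ioc hT).1.smul
      (hy.comp (by fun_prop : Continuous fun s => t - s)).aestronglyMeasurable
  · obtain ⟨M, hM0, hM⟩ := exists_bound_Icc hx T
    refine ⟨fun s => ‖p s‖ * M, ((hp.integrableOn_Ioc hT).norm).mul_const M, fun t ht s hs => ?_⟩
    rw [norm_smul]
    exact mul_le_mul_of_nonneg_left
      (hM _ ⟨le_max_right _ _, max_le (by linarith [ht.2, hs.1]) hT⟩) (norm_nonneg _)
  · exact ((hy.comp (by fun_prop : Continuous fun t => t - s)).const_smul (p s)).continuousOn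

theorem intervalIntegrable_vconv_left {m : ℝ → ℝ} (hm : Continuous m) {g : ℝ → E}
    (hg : HalfLineIntegrable g) {t : ℝ} (ht : 0 ≤ t) :
    IntervalIntegrable (fun s => m (t - s) • g s) volume 0 t :=
  (hg t ht).continuousOn_smul (by fun_prop : Continuous fun s => m (t - s)).continuousOn

theorem intervalIntegrable_vconv_right {p : ℝ → ℝ} (hp : HalfLineIntegrable p) {x : ℝ → E}
    (hx : ContinuousOn x (Ici 0)) {t : ℝ} (ht : 0 ≤ t) :
    IntervalIntegrable (fun s => p (t - s) • x s) volume 0 t :=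
  (hp.comp_sub_left ht).smul_continuousOn
    (hx.mono (by rw [uIcc_of_le ht]; exact Icc_subset_Ici_self))

/-- Fubini on the triangle 0 < r ≤ s ≤ t. The continuous factor `m`, cut off outside the triangle,
is bounded, so integrability of `p` and `g` suffices. With one factor equal to 1 the lemma also
serves as integration by parts. -/
theorem vconv_assoc [CompleteSpace E] {p m : ℝ → ℝ} {g : ℝ → E} (hp : HalfLineIntegrable p)
    (hm : Continuous m) (hg : HalfLineIntegrable g) {t : ℝ} (ht : 0 ≤ t) :
    vconv p (vconv m g) t = vconv (vconv p m) g t := by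
  set ν := volume.restrict (Ioc 0 t) with hν
  set f : ℝ → ℝ → E := fun s r => (if r ≤ s then m (s - r) else 0) • (p (t - s) • g r) with hf
  have hpi : Integrable (fun s => p (t - s)) ν :=
    (intervalIntegrable_iff_integrableOn_Ioc_of_le ht).1 (hp.comp_sub_left ht)
  have hgi : Integrable g ν := hg.integrableOn_Ioc ht
  have hint : Integrable (Function.uncurry f) (ν.prod ν) := by
    obtain ⟨M, hM⟩ := (isCompact_Icc (a := 0) (b := t)).exists_bound_of_continuousOn
      hm.continuousOn
    refine (hpi.smul_prod hgi).bdd_smul (C := max M 0) ?_ ?_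
    · refine Measurable.aestronglyMeasurable ?_
      exact Measurable.ite (measurableSet_le measurable_snd measurable_fst)
        (hm.measurable.comp (measurable_fst.sub measurable_snd)) measurable_const
    · rw [hν, Measure.prod_restrict]
      refine (ae_restrict_iff' (measurableSet_Ioc.prod measurableSet_Ioc)).2 (ae_of_all _ ?_)
      rintro ⟨s, r⟩ ⟨hs, hr⟩
      simp only at hs hr ⊢
      split_ifs with h
      · exact (hM _ ⟨by linarith, by linarith [hs.2, hr.1]⟩).trans (le_max_left _ _)
      · simp
  have hswap := integral_integral_swap hint
  have hL : vconv p (vconv m g) t = ∫ s, ∫ r, f s r ∂ν ∂ν := by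
    rw [vconv, intervalIntegral.integral_of_le ht]
    refine setIntegral_congr_fun measurableSet_Ioc fun s hs => ?_
    simp only [vconv]
    rw [intervalIntegral.integral_of_le hs.1.le, ← integral_smul]
    have h1 : Ioc 0 s = Ioc 0 t ∩ Iic s := by
      ext x
      simp only [mem_inter_iff, mem_Ioc, mem_Iic]
      exact ⟨fun h => ⟨⟨h.1, h.2.trans hs.2⟩, h.2⟩, fun h => ⟨h.1.1, h.2⟩⟩
    rw [h1, ← setIntegral_indicator measurableSet_Iic]
    refine setIntegral_congr_fun measurableSet_Ioc fun r _ => ?_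
    by_cases h : r ≤ s
    · rw [indicator_of_mem (show r ∈ Iic s from h)]
      simp only [hf, if_pos h, smul_comm (m (s - r))]
    · rw [indicator_of_notMem (show r ∉ Iic s from h)]
      simp only [hf, if_neg h, zero_smul]
  have hR : vconv (vconv p m) g t = ∫ r, ∫ s, f s r ∂ν ∂ν := by
    rw [vconv, intervalIntegral.integral_of_le ht]
    refine setIntegral_congr_fun measurableSet_Ioc fun r hr => ?_
    simp only [vconv]
    have h2 := intervalIntegral.integral_comp_sub_right (a := r) (b := t)
      (fun s => p (t - r - s) • m s) r
    rw [sub_self] at h2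
    rw [← h2, intervalIntegral.integral_of_le hr.2, ← integral_smul_const,
      ← integral_Icc_eq_integral_Ioc]
    have h1 : Icc r t = Ioc 0 t ∩ Ici r := by
      ext x
      simp only [mem_inter_iff, mem_Icc, mem_Ioc, mem_Ici]
      exact ⟨fun h => ⟨⟨hr.1.trans_le h.1, h.2⟩, h.1⟩, fun h => ⟨h.2, h.1.2⟩⟩
    rw [h1, ← setIntegral_indicator measurableSet_Ici]
    refine setIntegral_congr_fun measurableSet_Ioc fun s _ => ?_
    by_cases h : r ≤ s
    · rw [indicator_of_mem (show s ∈ Ici r from h)]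
      simp only [hf, if_pos h, smul_smul, smul_eq_mul]
      rw [mul_comm, show t - r - (s - r) = t - s by ring]
    · rw [indicator_of_notMem (show s ∉ Ici r from h)]
      simp only [hf, if_neg h, zero_smul]
  rw [hL, hR, hswap]

/-- Cauchy–Schwarz for the weight `w`: the quadratic x ↦ ∫ w (x - h)² is nonnegative, so its
discriminant is not positive. -/
theorem sq_integral_mul_le {α : Type*} [MeasurableSpace α] {μ : Measure α} {w h : α → ℝ}
    (hw : 0 ≤ᵐ[μ] w) (h₀ : Integrable w μ) (h₁ : Integrable (fun s => w s * h s) μ)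
    (h₂ : Integrable (fun s => w s * h s ^ 2) μ) :
    (∫ s, w s * h s ∂μ) ^ 2 ≤ (∫ s, w s ∂μ) * ∫ s, w s * h s ^ 2 ∂μ := by
  set a := ∫ s, w s ∂μ
  set b := ∫ s, w s * h s ∂μ
  set c := ∫ s, w s * h s ^ 2 ∂μ
  have key (x : ℝ) : 0 ≤ a * (x * x) + (-2 * b) * x + c := by
    have h3 : 0 ≤ ∫ s, ((x * x) * w s + (-2 * x) * (w s * h s) + w s * h s ^ 2) ∂μ := by
      refine integral_nonneg_of_ae ?_
      filter_upwards [hw] with s hs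
      have : 0 ≤ w s * (x - h s) ^ 2 := mul_nonneg hs (sq_nonneg _)
      simp only [Pi.zero_apply]
      nlinarith
    rw [integral_add (f := fun s => (x * x) * w s + (-2 * x) * (w s * h s))
      ((h₀.const_mul _).add (h₁.const_mul _)) h₂, integral_add (h₀.const_mul _) (h₁.const_mul _), integral_const_mul, integral_const_mul] at h3
    linarith
  have := discrim_le_zero key
  rw [discrim] at this
  nlinarith

end HalfLine

/-! ### Weak derivatives and primitives -/

section WeakDerivative

theorem HalfLineIntegrable.continuousOn_primitive {E : Type*} [NormedAddCommGroup E]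
    [NormedSpace ℝ E] {v : ℝ → E} (hv : HalfLineIntegrable v) :
    ContinuousOn (fun t => ∫ s in (0 : ℝ)..t, v s) (Ici 0) := by
  simpa only [← vconv_one] using continuousOn_vconv_left (m := fun _ => 1) continuous_const hv

theorem integrableOn_smul_of_tsupport_subset {E : Type*} [NormedAddCommGroup E]
    [NormedSpace ℝ E] {φ : ℝ → ℝ} {u : ℝ → E} (hφ : Continuous φ)
    (hc : HasCompactSupport φ) (hs : tsupport φ ⊆ Ioi 0) (hu : LocallyIntegrableOn u (Ioi 0)) :
    IntegrableOn (fun t => φ t • u t) (Ioi 0) := by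
  have h1 : IntegrableOn u (tsupport φ) := hu.integrableOn_compact_subset hs hc
  have h2 : IntegrableOn (fun t => φ t • u t) (tsupport φ) :=
    h1.continuousOn_smul hφ.continuousOn hc
  refine Integrable.integrableOn ((integrableOn_iff_integrable_of_support_subset ?_).1 h2)
  intro t ht
  refine subset_tsupport φ fun h => ht ?_
  simp [h]

theorem tsupport_deriv_subset_tsupport (φ : ℝ → ℝ) : tsupport (deriv φ) ⊆ tsupport φ :=
  closure_minimal (support_deriv_subset) (isClosed_tsupport φ)

variable {H : Type*} [NormedAddCommGroup H] [InnerProductSpace ℂ H] [CompleteSpace H]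

theorem isWeakDeriv_of_primitive {u v : ℝ → H} {x : H} (hv : HalfLineIntegrable v)
    (hu : ∀ t, 0 < t → u t = x + ∫ s in (0 : ℝ)..t, v s) : IsWeakDeriv u v := by
  have hc : ContinuousOn u (Ioi 0) :=
    (continuousOn_const.add (hv.continuousOn_primitive.mono Ioi_subset_Ici_self)).congr hu
  refine ⟨hc.locallyIntegrableOn measurableSet_Ioi, hv.locallyIntegrableOn,
    fun φ hφ hφc hφs => ?_⟩
  obtain ⟨T₀, hT₀⟩ := hφc.bddAbove
  set T := max T₀ 0 + 1 with hT
  have hT0 : 0 < T := by positivity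
  have hφT : ∀ t, T ≤ t → t ∉ tsupport φ := fun t ht h => by
    have := hT₀ h
    linarith [le_max_left T₀ 0]
  have hφ0 : ∀ t, t ∉ tsupport φ → φ t = 0 := fun t => image_eq_zero_of_notMem_tsupport
  have hφ' : ∀ t, t ∉ tsupport φ → deriv φ t = 0 := fun t ht =>
    image_eq_zero_of_notMem_tsupport fun h => ht (tsupport_deriv_subset_tsupport φ h)
  have hdc : Continuous (deriv φ) := (contDiff_infty_iff_deriv.1 hφ).2.continuous
  have hcut (F : ℝ → H) (hF : ∀ t, T < t → F t = 0) :
      ∫ t in Ioi (0 : ℝ), F t = ∫ t in (0 : ℝ)..T, F t := by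
    rw [intervalIntegral.integral_of_le hT0.le]
    refine setIntegral_eq_of_subset_of_forall_sdiff_eq_zero measurableSet_Ioi
      Ioc_subset_Ioi_self fun t ht => hF t ?_
    by_contra h
    exact ht.2 ⟨ht.1, not_lt.1 h⟩
  rw [hcut _ fun t ht => by rw [hφ' t (hφT t ht.le), zero_smul],
    hcut _ fun t ht => by rw [hφ0 t (hφT t ht.le), zero_smul]]
  have hFTC (a b : ℝ) : ∫ t in a..b, deriv φ t = φ b - φ a :=
    intervalIntegral.integral_deriv_eq_sub
      (fun t _ => (contDiff_infty_iff_deriv.1 hφ).1.differentiableAt) (hdc.intervalIntegrable _ _)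
  -- With T beyond the support of φ, associativity at time T is integration by parts: one side is ∫
  -- φ' u, the constant x dropping out, and the other is -∫ φ v because the integral of φ' over (r,
  -- T) is -φ(r).
  have hassoc := vconv_assoc (p := fun r => deriv φ (T - r)) (m := fun _ => 1) (g := v)
    (HalfLineIntegrable.of_continuousOn (by fun_prop)) continuous_const hv hT0.le
  have hL : vconv (fun r => deriv φ (T - r)) (vconv (fun _ => 1) v) T =
      ∫ t in (0 : ℝ)..T, deriv φ t • u t := by
    have h1 : ∫ t in (0 : ℝ)..T, deriv φ t • u t =
        (∫ t in (0 : ℝ)..T, deriv φ t • x) +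
          ∫ t in (0 : ℝ)..T, deriv φ t • ∫ s in (0 : ℝ)..t, v s := by
      rw [← intervalIntegral.integral_add]
      · refine intervalIntegral.integral_congr_ae (ae_of_all _ fun t ht => ?_)
        rw [uIoc_of_le hT0.le] at ht
        rw [hu t ht.1, smul_add]
      · exact (by fun_prop : Continuous fun t => deriv φ t • x).intervalIntegrable _ _
      · refine ContinuousOn.intervalIntegrable ?_
        refine hdc.continuousOn.smul (hv.continuousOn_primitive.mono ?_)
        rw [uIcc_of_le hT0.le]
        exact Icc_subset_Ici_self
    rw [h1, intervalIntegral.integral_smul_const, hFTC, hφ0 T (hφT T le_rfl),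
      hφ0 0 fun h => lt_irrefl (0 : ℝ) (hφs h), sub_zero, zero_smul, zero_add]
    simp only [vconv, sub_sub_cancel, one_smul]
  have hR : vconv (vconv (fun r => deriv φ (T - r)) fun _ => 1) v T =
      - ∫ t in (0 : ℝ)..T, φ t • v t := by
    rw [← intervalIntegral.integral_neg]
    refine intervalIntegral.integral_congr fun r _ => ?_
    simp only [vconv, smul_eq_mul, mul_one]
    rw [← neg_smul]
    congr 1
    have : ∀ s : ℝ, T - (T - r - s) = s + r := fun s => by ring
    simp only [this]
    rw [intervalIntegral.integral_comp_add_right, hFTC, sub_add_cancel, zero_add,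
      hφ0 T (hφT T le_rfl), zero_sub]
  rw [← hL, hassoc, hR]

/-- The du Bois-Reymond lemma. For a fixed bump ρ of integral one, ψ - (∫ψ)ρ is the derivative of a
test function, so every test function ψ satisfies ∫ ψ(h - c) = 0 with c = ∫ ρh. -/
theorem ae_const_of_integral_deriv_smul_eq_zero {h : ℝ → H}
    (hloc : LocallyIntegrableOn h (Ioi 0))
    (hφ : ∀ φ : ℝ → ℝ, ContDiff ℝ ∞ φ → HasCompactSupport φ → tsupport φ ⊆ Ioi 0 →
      ∫ t in Ioi (0 : ℝ), deriv φ t • h t = 0) :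
    ∃ c : H, ∀ᵐ t ∂(volume.restrict (Ioi (0 : ℝ))), h t = c := by
  -- Centre 2 and outer radius 1 put the support in [1, 3], inside the open half-line.
  let b : ContDiffBump (2 : ℝ) := ⟨1 / 2, 1, by norm_num, by norm_num⟩
  set ρ := b.normed volume with hρ
  have hρc : ContDiff ℝ ∞ ρ := b.contDiff_normed
  have hρs : HasCompactSupport ρ := b.hasCompactSupport_normed
  have hρt : tsupport ρ = Icc 1 3 := by
    rw [hρ, b.tsupport_normed_eq, Real.closedBall_eq_Icc]
    norm_num [b]
  have hρU : tsupport ρ ⊆ Ioi 0 := by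
    rw [hρt]
    exact fun t ht => lt_of_lt_of_le one_pos ht.1
  set c := ∫ t in Ioi (0 : ℝ), ρ t • h t with hc
  refine ⟨c, ?_⟩
  rw [ae_restrict_iff' measurableSet_Ioi]
  have key := isOpen_Ioi.ae_eq_zero_of_integral_contDiff_smul_eq_zero (μ := volume)
    (f := fun t => h t - c) (U := Ioi (0 : ℝ))
    (hloc.sub (locallyIntegrableOn_const c)) ?_
  · filter_upwards [key] with t ht h0
    exact sub_eq_zero.1 (ht h0)
  intro ψ hψ hψc hψU
  set I := ∫ t, ψ t with hI
  set χ : ℝ → ℝ := fun t => ψ t - I * ρ t with hχ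
  have hχc : ContDiff ℝ ∞ χ := hψ.sub (contDiff_const.mul hρc)
  have hK : IsCompact (tsupport ψ ∪ Icc 1 3) := hψc.isCompact.union isCompact_Icc
  have hKne : (tsupport ψ ∪ Icc (1 : ℝ) 3).Nonempty := ⟨1, Or.inr (by norm_num)⟩
  obtain ⟨m, hm, hmle⟩ := hK.exists_isLeast hKne
  obtain ⟨M, hM, hMle⟩ := hK.exists_isGreatest hKne
  have hm0 : 0 < m := by
    rcases hm with hm | hm
    · exact hψU hm
    · exact lt_of_lt_of_le one_pos hm.1
  have hχ0 : ∀ t, t ∉ Icc m M → χ t = 0 := by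
    intro t ht
    have h1 : t ∉ tsupport ψ ∪ Icc 1 3 := fun h => ht ⟨hmle h, hMle h⟩
    have h2 : ψ t = 0 := image_eq_zero_of_notMem_tsupport fun h => h1 (Or.inl h)
    have h3 : ρ t = 0 := image_eq_zero_of_notMem_tsupport fun h => h1 (Or.inr (hρt ▸ h))
    simp [hχ, h2, h3]
  have hψi : Integrable ψ := hψ.continuous.integrable_of_hasCompactSupport hψc
  have hρi : Integrable ρ := hρc.continuous.integrable_of_hasCompactSupport hρs
  have hχint : ∫ t, χ t = 0 := by
    rw [hχ, integral_sub hψi (hρi.const_mul _), integral_const_mul, b.integral_normed]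
    simp [hI]
  set Φ : ℝ → ℝ := fun t => ∫ s in (0 : ℝ)..t, χ s with hΦ
  have hΦd : ∀ t, HasDerivAt Φ (χ t) t := fun t =>
    intervalIntegral.integral_hasDerivAt_right (hχc.continuous.intervalIntegrable _ _)
      (hχc.continuous.stronglyMeasurableAtFilter _ _) hχc.continuous.continuousAt
  have hΦ' : deriv Φ = χ := funext fun t => (hΦd t).deriv
  have hΦc : ContDiff ℝ ∞ Φ := by
    rw [contDiff_infty_iff_deriv, hΦ']
    exact ⟨fun t => (hΦd t).differentiableAt, hχc⟩
  -- To the left of `m` the primitive has met no mass; to the right of `M` it equals the total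
  -- integral of χ, which is zero.
  have hΦ0 : ∀ t, t ∉ Icc m M → Φ t = 0 := by
    intro t ht
    by_cases htm : t < m
    · rw [hΦ]
      refine intervalIntegral.integral_zero_ae (ae_of_all _ fun s hs => hχ0 s fun h => ?_)
      rcases le_total 0 t with h0 | h0
      · rw [uIoc_of_le h0] at hs
        linarith [hs.2, h.1]
      · rw [uIoc_of_ge h0] at hs
        linarith [hs.2, h.1]
    · have htM : M < t := by
        by_contra h
        exact ht ⟨not_lt.1 htm, not_lt.1 h⟩
      rw [← hχint, hΦ]
      refine intervalIntegral.integral_eq_integral_of_support_subset fun s hs => ?_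
      have hs' : s ∈ Icc m M := by
        by_contra h
        exact hs (hχ0 s h)
      exact ⟨by linarith [hs'.1], by linarith [hs'.2]⟩
  have hΦs : tsupport Φ ⊆ Icc m M :=
    closure_minimal (fun t ht => by
      by_contra h
      exact ht (hΦ0 t h)) isClosed_Icc
  have h0 := hφ Φ hΦc (HasCompactSupport.intro isCompact_Icc hΦ0)
    (hΦs.trans fun t ht => lt_of_lt_of_le hm0 ht.1)
  rw [hΦ'] at h0
  have hψh := integrableOn_smul_of_tsupport_subset hψ.continuous hψc hψU hloc
  have hρh := integrableOn_smul_of_tsupport_subset hρc.continuous hρs hρU hloc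
  have h1 : ∫ t in Ioi (0 : ℝ), χ t • h t = (∫ t in Ioi (0 : ℝ), ψ t • h t) - I • c := by
    rw [hc, ← integral_smul, ← integral_sub hψh (g := fun t => I • ρ t • h t) (hρh.smul I)]
    simp only [hχ, sub_smul, mul_smul]
  have hψ0 : ∀ t, t ∉ Ioi (0 : ℝ) → ψ t = 0 := fun t ht =>
    image_eq_zero_of_notMem_tsupport fun h => ht (hψU h)
  rw [← setIntegral_eq_integral_of_forall_compl_eq_zero (s := Ioi 0)
    fun t ht => by rw [hψ0 t ht, zero_smul]]
  simp only [smul_sub]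
  rw [integral_sub hψh (hψi.integrableOn.smul_const c), integral_smul_const,
    setIntegral_eq_integral_of_forall_compl_eq_zero (f := ψ) hψ0, ← hI, ← h1, h0]

omit [CompleteSpace H] in
theorem HalfLineIntegrable.tendsto_primitive {v : ℝ → H} (hv : HalfLineIntegrable v) :
    Tendsto (fun t => ∫ s in (0 : ℝ)..t, v s) (𝓝[>] 0) (𝓝 0) := by
  have h := (hv.continuousOn_primitive 0 self_mem_Ici).tendsto.mono_left
    (nhdsWithin_mono _ Ioi_subset_Ici_self)
  simpa using h

omit [CompleteSpace H] in
theorem hasInitialValue_of_primitive {u v : ℝ → H} {x : H} (hv : HalfLineIntegrable v)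
    (hu : ∀ t, 0 < t → u t = x + ∫ s in (0 : ℝ)..t, v s) : HasInitialValue u x := by
  refine ⟨u, ?_, ae_eq_refl _, ?_⟩
  · exact (continuousOn_const.add (hv.continuousOn_primitive.mono Ioi_subset_Ici_self)).congr hu
  · have h := (tendsto_const_nhds (x := x)).add hv.tendsto_primitive
    rw [add_zero] at h
    refine h.congr' ?_
    filter_upwards [self_mem_nhdsWithin] with t ht
    exact (hu t ht).symm

/-- The difference from the primitive has zero weak derivative and is therefore constant. The
continuous representative then equals constant plus primitive everywhere on (0, ∞), and its limit at
0 identifies the constant. -/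
theorem IsWeakDeriv.ae_eq_primitive {u v : ℝ → H} {x : H} (huv : IsWeakDeriv u v)
    (hv : HalfLineIntegrable v) (hx : HasInitialValue u x) :
    ∀ᵐ t ∂(volume.restrict (Ioi (0 : ℝ))), u t = x + ∫ s in (0 : ℝ)..t, v s := by
  have hw := isWeakDeriv_of_primitive (u := fun t => ∫ s in (0 : ℝ)..t, v s) (x := 0) hv
    (fun t _ => (zero_add _).symm)
  obtain ⟨c, hc⟩ := ae_const_of_integral_deriv_smul_eq_zero (huv.1.sub hw.1)
    fun φ hφ hφc hφs => by
      have hd : Continuous (deriv φ) := (contDiff_infty_iff_deriv.1 hφ).2.continuous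
      have hds := (tsupport_deriv_subset_tsupport φ).trans hφs
      simp only [Pi.sub_apply, smul_sub]
      rw [integral_sub (integrableOn_smul_of_tsupport_subset hd hφc.deriv hds huv.1)
        (integrableOn_smul_of_tsupport_subset hd hφc.deriv hds hw.1), huv.2.2 φ hφ hφc hφs,
        hw.2.2 φ hφ hφc hφs, sub_self]
  obtain ⟨w, hwc, hwu, hwx⟩ := hx
  have hae : w =ᵐ[volume.restrict (Ioi 0)] fun t => c + ∫ s in (0 : ℝ)..t, v s := by
    filter_upwards [hc, hwu] with t h1 h2
    rw [h2, ← h1]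
    simp
  have heq := Measure.eqOn_open_of_ae_eq hae isOpen_Ioi hwc
    (continuousOn_const.add (hv.continuousOn_primitive.mono Ioi_subset_Ici_self))
  have hlim : Tendsto w (𝓝[>] 0) (𝓝 (c + 0)) := by
    refine ((tendsto_const_nhds (x := c)).add hv.tendsto_primitive).congr' ?_
    filter_upwards [self_mem_nhdsWithin] with t ht
    exact (heq ht).symm
  have hxc : x = c := by simpa using tendsto_nhds_unique hwx hlim
  filter_upwards [hc] with t ht
  rw [hxc, ← ht]
  simp

end WeakDerivative

/-! ### Exponentially weighted spaces -/

section WeightedL2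

variable {H : Type*} [NormedAddCommGroup H] [InnerProductSpace ℂ H]

theorem exp_neg_mul_smul_norm_sq (γ t : ℝ) (x : H) :
    ‖Real.exp (-γ * t) • x‖ ^ 2 = Real.exp (-2 * γ * t) * ‖x‖ ^ 2 := by
  rw [norm_smul, mul_pow, Real.norm_eq_abs, sq_abs, ← Real.exp_nat_mul]
  push_cast
  ring_nf

theorem memL2w_iff {γ : ℝ} {g : ℝ → H} : MemL2w γ g ↔
    AEStronglyMeasurable g (volume.restrict (Ioi 0)) ∧
      IntegrableOn (fun t => Real.exp (-2 * γ * t) * ‖g t‖ ^ 2) (Ioi 0) := by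
  have hm : AEStronglyMeasurable (fun t => Real.exp (-γ * t) • g t) (volume.restrict (Ioi 0)) ↔
      AEStronglyMeasurable g (volume.restrict (Ioi 0)) := by
    constructor
    · intro h
      have h1 : Continuous fun t => Real.exp (γ * t) := by fun_prop
      refine (h1.aestronglyMeasurable.smul h).congr (ae_of_all _ fun t => ?_)
      simp only [Pi.smul_apply', smul_smul, ← Real.exp_add]
      simp
    · intro h
      have h1 : Continuous fun t => Real.exp (-γ * t) := by fun_prop
      exact h1.aestronglyMeasurable.smul h
  rw [MemL2w]
  constructor
  · intro h
    refine ⟨hm.1 h.1, ?_⟩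
    simpa only [exp_neg_mul_smul_norm_sq, IntegrableOn] using (memLp_two_iff_integrable_sq_norm h.1).1 h
  · rintro ⟨h1, h2⟩
    rw [memLp_two_iff_integrable_sq_norm (hm.2 h1)]
    simpa only [exp_neg_mul_smul_norm_sq, IntegrableOn] using h2

theorem MemL2w.halfLineIntegrable {γ : ℝ} {g : ℝ → H} (hg : MemL2w γ g) :
    HalfLineIntegrable g := by
  intro T hT
  rw [intervalIntegrable_iff_integrableOn_Ioc_of_le hT]
  have h1 : MemLp (fun t => Real.exp (-γ * t) • g t) 2 (volume.restrict (Ioc 0 T)) :=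
    hg.mono_measure (Measure.restrict_mono Ioc_subset_Ioi_self le_rfl)
  have h2 := (h1.integrable one_le_two)
  have h3 : Continuous fun t => Real.exp (γ * t) := by fun_prop
  have h4 : IntegrableOn (fun t => Real.exp (γ * t) • Real.exp (-γ * t) • g t) (Ioc 0 T) :=
    IntegrableOn.mono_set (IntegrableOn.continuousOn_smul (K := Icc 0 T)
      ((integrableOn_Icc_iff_integrableOn_Ioc).2 h2) h3.continuousOn isCompact_Icc)
      Ioc_subset_Icc_self
  refine h4.congr (ae_of_all _ fun t => ?_)
  simp only [smul_smul, ← Real.exp_add]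
  simp

theorem MemL2w.mono {γ γ' : ℝ} (h : γ ≤ γ') {g : ℝ → H} (hg : MemL2w γ g) : MemL2w γ' g := by
  rw [memL2w_iff] at hg ⊢
  refine ⟨hg.1, hg.2.mono' ?_ ?_⟩
  · exact (by fun_prop : Continuous fun t => Real.exp (-2 * γ' * t)).aestronglyMeasurable.mul
      (hg.1.norm.pow 2)
  · refine (ae_restrict_iff' measurableSet_Ioi).2 (ae_of_all _ fun t (ht : 0 < t) => ?_)
    rw [Real.norm_of_nonneg (by positivity)]
    have h1 : -2 * γ' * t ≤ -2 * γ * t := by nlinarith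
    exact mul_le_mul_of_nonneg_right (Real.exp_le_exp.2 h1) (by positivity)

omit [InnerProductSpace ℂ H] in
theorem normL2w_sq (γ : ℝ) (g : ℝ → H) :
    normL2w γ g ^ 2 = ∫ t in Ioi (0 : ℝ), Real.exp (-2 * γ * t) * ‖g t‖ ^ 2 :=
  Real.sq_sqrt (integral_nonneg fun _ => by positivity)

end WeightedL2

/-! ### The kernel as a sum of exponentials -/

section Kernel

variable {c κ : ℕ → ℝ}

theorem kernel_nonneg (hc : ∀ j, 0 < c j) (t : ℝ) : 0 ≤ kernel c κ t :=
  tsum_nonneg fun j => mul_nonneg (hc j).le (Real.exp_nonneg _)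

theorem integral_exp_neg_Ioi {a : ℝ} (ha : 0 < a) :
    ∫ t in Ioi (0 : ℝ), Real.exp (-a * t) = a⁻¹ := by
  rw [integral_exp_mul_Ioi (neg_lt_zero.2 ha)]
  rw [mul_zero, Real.exp_zero, neg_div_neg_eq, one_div]

theorem integrableOn_kernel (hc : ∀ j, 0 < c j) (hκ : ∀ j, 0 < κ j)
    (hsum : Summable fun j => c j / κ j) :
    IntegrableOn (kernel c κ) (Ioi 0) ∧ ∫ t in Ioi (0 : ℝ), kernel c κ t = ∑' j, c j / κ j := by
  set G : ℝ → ENNReal := fun t => ∑' j, ENNReal.ofReal (c j * Real.exp (-κ j * t)) with hG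
  -- Where the series diverges both sides are 0: the default value of the real sum agrees with that
  -- of `ENNReal.toReal` at ⊤. Sum and integral can therefore be exchanged in the extended reals
  -- without any bound.
  have hKG : kernel c κ = fun t => (G t).toReal := by
    funext t
    rw [hG, ENNReal.tsum_toReal_eq fun _ => ENNReal.ofReal_ne_top, kernel]
    exact tsum_congr fun j => (ENNReal.toReal_ofReal (mul_nonneg (hc j).le (Real.exp_nonneg _))).symm
  have hmj (j : ℕ) : Measurable fun t => ENNReal.ofReal (c j * Real.exp (-κ j * t)) := by fun_prop
  have hGm : Measurable G := Measurable.tsum hmj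
  have hint : ∫⁻ t in Ioi (0 : ℝ), G t = ENNReal.ofReal (∑' j, c j / κ j) := by
    rw [hG, lintegral_tsum fun j => (hmj j).aemeasurable,
      ENNReal.ofReal_tsum_of_nonneg (fun j => (div_pos (hc j) (hκ j)).le) hsum]
    refine tsum_congr fun j => ?_
    rw [← ofReal_integral_eq_lintegral_ofReal
      ((integrableOn_exp_mul_Ioi (neg_lt_zero.2 (hκ j)) 0).const_mul _)
      (ae_of_all _ fun t => mul_nonneg (hc j).le (Real.exp_nonneg _)), integral_const_mul,
      integral_exp_neg_Ioi (hκ j), div_eq_mul_inv]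
  have hne : ∫⁻ t in Ioi (0 : ℝ), G t ≠ ⊤ := by
    rw [hint]
    exact ENNReal.ofReal_ne_top
  rw [hKG]
  refine ⟨integrable_toReal_of_lintegral_ne_top hGm.aemeasurable hne, ?_⟩
  rw [integral_toReal hGm.aemeasurable (ae_lt_top hGm hne), hint,
    ENNReal.toReal_ofReal (tsum_nonneg fun j => (div_pos (hc j) (hκ j)).le)]

theorem halfLineIntegrable_kernel (hc : ∀ j, 0 < c j) (hκ : ∀ j, 0 < κ j)
    (hsum : Summable fun j => c j / κ j) : HalfLineIntegrable (kernel c κ) := fun _ hT =>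
  (intervalIntegrable_iff_integrableOn_Ioc_of_le hT).2
    ((integrableOn_kernel hc hκ hsum).1.mono_set Ioc_subset_Ioi_self)

theorem abs_vconv_exp_le {κ : ℝ} (hκ : 0 < κ) {x : ℝ → ℝ} {t M : ℝ} (ht : 0 ≤ t)
    (hM : ∀ s ∈ Icc 0 t, |x s| ≤ M) :
    (∫ s in (0 : ℝ)..t, |Real.exp (-κ * (t - s)) * x s|) ≤ M / κ := by
  have hM0 : 0 ≤ M := (abs_nonneg _).trans (hM 0 ⟨le_rfl, ht⟩)
  have h1 : ∫ s in (0 : ℝ)..t, Real.exp (-κ * s) ≤ κ⁻¹ := by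
    rw [← integral_exp_neg_Ioi hκ, intervalIntegral.integral_of_le ht]
    exact setIntegral_mono_set (integrableOn_exp_mul_Ioi (neg_lt_zero.2 hκ) 0)
      (ae_of_all _ fun _ => Real.exp_nonneg _) Ioc_subset_Ioi_self.eventuallyLE
  have h2 := intervalIntegral.integral_comp_sub_left (a := 0) (b := t)
    (fun s => Real.exp (-κ * s)) t
  rw [sub_self, sub_zero] at h2
  calc (∫ s in (0 : ℝ)..t, |Real.exp (-κ * (t - s)) * x s|)
      ≤ ∫ s in (0 : ℝ)..t, Real.exp (-κ * (t - s)) * M := by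
        rw [intervalIntegral.integral_of_le ht, intervalIntegral.integral_of_le ht]
        refine integral_mono_of_nonneg (ae_of_all _ fun _ => abs_nonneg _) ?_ ?_
        · exact ((by fun_prop : Continuous fun s => Real.exp (-κ * (t - s)) * M).intervalIntegrable
            0 t).1
        · refine (ae_restrict_iff' measurableSet_Ioc).2 (ae_of_all _ fun s hs => ?_)
          simp only [abs_mul, Real.abs_exp]
          gcongr
          exact hM s ⟨hs.1.le, hs.2⟩
    _ = (∫ s in (0 : ℝ)..t, Real.exp (-κ * s)) * M := by
        rw [intervalIntegral.integral_mul_const, h2]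
    _ ≤ κ⁻¹ * M := by gcongr
    _ = M / κ := by ring

/-- Each exponential contributes at most M cⱼ/κⱼ, where M bounds |x| on [0, t]; this summable
majorant justifies integrating term by term. -/
theorem hasSum_vconv_kernel (hc : ∀ j, 0 < c j) (hκ : ∀ j, 0 < κ j)
    (hsum : Summable fun j => c j / κ j) {x : ℝ → ℝ} (hx : ContinuousOn x (Ici 0)) {t : ℝ}
    (ht : 0 ≤ t) :
    HasSum (fun j => c j * vconv (fun r => Real.exp (-κ j * r)) x t) (vconv (kernel c κ) x t) := by
  obtain ⟨M, hM0, hM⟩ := exists_bound_Icc hx t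
  have hint (j : ℕ) : IntervalIntegrable (fun s => Real.exp (-κ j * (t - s)) * x s) volume 0 t :=
    intervalIntegrable_vconv_right (p := fun r => Real.exp (-κ j * r))
      (HalfLineIntegrable.of_continuousOn (by fun_prop)) hx ht
  have h1 := hasSum_integral_of_summable_integral_norm (μ := volume.restrict (Ioc 0 t))
    (F := fun (j : ℕ) s => c j * (Real.exp (-κ j * (t - s)) * x s))
    (fun j => ((hint j).const_mul (c j)).1) ?_
  · convert! h1 using 1
    · funext j
      rw [vconv, intervalIntegral.integral_of_le ht, integral_const_mul]
      rfl
    · rw [vconv, intervalIntegral.integral_of_le ht]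
      refine integral_congr_ae (ae_of_all _ fun s => ?_)
      simp only [kernel, smul_eq_mul, ← mul_assoc, tsum_mul_right]
  · refine Summable.of_nonneg_of_le (fun j => integral_nonneg fun _ => norm_nonneg _)
      (fun j => ?_) (hsum.mul_right M)
    have h2 := abs_vconv_exp_le (hκ j) ht (x := x) hM
    rw [intervalIntegral.integral_of_le ht] at h2
    simp only [norm_mul (c j), integral_const_mul, Real.norm_of_nonneg (hc j).le]
    calc _ ≤ c j * (M / κ j) := mul_le_mul_of_nonneg_left h2 (hc j).le
      _ = _ := by ring

end Kernel

/-- `S` solves `S'' + α S - b K * S = 0`, `S(0) = 0`, `S'(0) = 1` on the half-line, and `C`, `Z`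
are its first and second derivatives. -/
structure IsResolvent (K : ℝ → ℝ) (α b : ℝ) (S C Z : ℝ → ℝ) : Prop where
  continuous_S : Continuous S
  continuous_C : Continuous C
  continuous_Z : Continuous Z
  S_eq : ∀ t, 0 ≤ t → S t = ∫ s in (0 : ℝ)..t, C s
  C_eq : ∀ t, 0 ≤ t → C t = 1 + ∫ s in (0 : ℝ)..t, Z s
  Z_eq : ∀ t, 0 ≤ t → Z t = -α * S t + b * vconv K S t

/-! ### Energy estimate for the scalar resolvent -/

namespace IsResolvent

variable {K : ℝ → ℝ} {α b : ℝ} {S C Z : ℝ → ℝ} (h : IsResolvent K α b S C Z)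
include h

theorem S_zero : S 0 = 0 := by simp [h.S_eq 0 le_rfl]

theorem C_zero : C 0 = 1 := by simp [h.C_eq 0 le_rfl]

theorem hasDerivAt_S {t : ℝ} (ht : 0 < t) : HasDerivAt S (C t) t := by
  have h1 : HasDerivAt (fun t => ∫ s in (0 : ℝ)..t, C s) (C t) t :=
    intervalIntegral.integral_hasDerivAt_right (h.continuous_C.intervalIntegrable _ _)
      (h.continuous_C.stronglyMeasurableAtFilter _ _) h.continuous_C.continuousAt
  refine h1.congr_of_eventuallyEq ?_
  filter_upwards [Ioi_mem_nhds ht] with s hs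
  exact h.S_eq s (le_of_lt hs)

theorem hasDerivAt_C {t : ℝ} (ht : 0 < t) : HasDerivAt C (Z t) t := by
  have h1 : HasDerivAt (fun t => 1 + ∫ s in (0 : ℝ)..t, Z s) (Z t) t :=
    (intervalIntegral.integral_hasDerivAt_right (h.continuous_Z.intervalIntegrable _ _)
      (h.continuous_Z.stronglyMeasurableAtFilter _ _) h.continuous_Z.continuousAt).const_add 1
  refine h1.congr_of_eventuallyEq ?_
  filter_upwards [Ioi_mem_nhds ht] with s hs
  exact h.C_eq s (le_of_lt hs)

/-- The source of the energy estimate. The convolution v solves v' = S - κv, v(0) = 0, whence Cv +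
(S - κv)² is the derivative of S²/(2κ) - (S - κv)²/(2κ). Integrating, with S(0) = 0, and dropping
two squares leaves the bound. -/
theorem integral_mul_vconv_exp_le {κ : ℝ} (hκ : 0 < κ) {t : ℝ} (ht : 0 ≤ t) :
    ∫ s in (0 : ℝ)..t, C s * vconv (fun r => Real.exp (-κ * r)) S s ≤ S t ^ 2 / (2 * κ) := by
  set v : ℝ → ℝ := vconv (fun r => Real.exp (-κ * r)) S with hv
  have hveq : v = fun t => Real.exp (-κ * t) * ∫ s in (0 : ℝ)..t, Real.exp (κ * s) * S s := by
    funext t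
    rw [hv, vconv, ← intervalIntegral.integral_const_mul]
    refine intervalIntegral.integral_congr fun s _ => ?_
    simp only [smul_eq_mul, ← mul_assoc, ← Real.exp_add]
    ring_nf
  have hcS := h.continuous_S
  have hcC := h.continuous_C
  have hce : Continuous fun s => Real.exp (κ * s) * S s := by fun_prop
  have hvd (t : ℝ) : HasDerivAt v (S t - κ * v t) t := by
    have h1 : HasDerivAt (fun t => ∫ s in (0 : ℝ)..t, Real.exp (κ * s) * S s)
        (Real.exp (κ * t) * S t) t :=
      intervalIntegral.integral_hasDerivAt_right (hce.intervalIntegrable _ _)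
        (hce.stronglyMeasurableAtFilter _ _) hce.continuousAt
    have h2 : HasDerivAt (fun t => Real.exp (-κ * t)) (Real.exp (-κ * t) * (-κ * 1)) t :=
      ((hasDerivAt_id t).const_mul (-κ)).exp
    have h3 := h2.mul h1
    rw [hveq]
    convert! h3 using 1
    have : Real.exp (-κ * t) * Real.exp (κ * t) = 1 := by
      rw [← Real.exp_add]
      simp
    linear_combination (-S t) * this
  have hcv : Continuous v := continuous_iff_continuousAt.2 fun t => (hvd t).continuousAt
  have hv0 : v 0 = 0 := by simp [hveq]
  have hFTC := intervalIntegral.integral_eq_sub_of_hasDerivAt_of_le ht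
    (f := fun t => S t ^ 2 / (2 * κ) - (S t - κ * v t) ^ 2 / (2 * κ))
    (f' := fun t => C t * v t + (S t - κ * v t) ^ 2) (by fun_prop)
    (fun s hs => by
      have hS := h.hasDerivAt_S hs.1
      have h4 := ((hS.pow 2).div_const (2 * κ)).sub
        (((hS.sub ((hvd s).const_mul κ)).pow 2).div_const (2 * κ))
      convert! h4 using 1
      change _ = ((2 : ℕ) : ℝ) * S s ^ (2 - 1) * C s / (2 * κ) - ((2 : ℕ) : ℝ) *
        (S s - κ * v s) ^ (2 - 1) * (C s - κ * (S s - κ * v s)) / (2 * κ)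
      field_simp
      push_cast
      ring)
    ((by fun_prop : Continuous fun t => C t * v t + (S t - κ * v t) ^ 2).intervalIntegrable _ _)
  rw [intervalIntegral.integral_add
    ((by fun_prop : Continuous fun t => C t * v t).intervalIntegrable _ _)
    ((by fun_prop : Continuous fun t => (S t - κ * v t) ^ 2).intervalIntegrable _ _),
    h.S_zero, hv0] at hFTC
  have hpos : 0 ≤ ∫ s in (0 : ℝ)..t, (S s - κ * v s) ^ 2 :=
    intervalIntegral.integral_nonneg ht fun _ _ => sq_nonneg _
  have hpos' : 0 ≤ (S t - κ * v t) ^ 2 / (2 * κ) := by positivity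
  simp only [mul_zero, sub_zero] at hFTC
  have hz : (0 : ℝ) ^ 2 / (2 * κ) = 0 := by simp
  rw [hz] at hFTC
  linarith

end IsResolvent

/-- The derivative of C² + αS² is 2bC(K∗S). Expanding the kernel and applying the single-exponential
bound to each term, the memory contributes at most bkS(t)², with k = ∑ cⱼ/κⱼ, which is absorbed on
the left. -/
theorem IsResolvent.energy {c κ : ℕ → ℝ} (hc : ∀ j, 0 < c j) (hκ : ∀ j, 0 < κ j)
    (hsum : Summable fun j => c j / κ j) {α b : ℝ} (hb : 0 ≤ b) {S C Z : ℝ → ℝ}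
    (h : IsResolvent (kernel c κ) α b S C Z) {t : ℝ} (ht : 0 ≤ t) :
    C t ^ 2 + (α - b * ∑' j, c j / κ j) * S t ^ 2 ≤ 1 := by
  have hcS := h.continuous_S
  have hcC := h.continuous_C
  have hK := halfLineIntegrable_kernel hc hκ hsum
  have hKS : ContinuousOn (vconv (kernel c κ) S) (Ici 0) :=
    continuousOn_vconv_right hK hcS.continuousOn
  have hsub : uIcc 0 t ⊆ Ici 0 := by
    rw [uIcc_of_le ht]
    exact Icc_subset_Ici_self
  have hFTC := intervalIntegral.integral_eq_sub_of_hasDerivAt_of_le ht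
    (f := fun t => C t ^ 2 + α * S t ^ 2)
    (f' := fun t => 2 * b * (C t * vconv (kernel c κ) S t)) (by fun_prop)
    (fun s hs => by
      have h4 := ((h.hasDerivAt_C hs.1).pow 2).add (((h.hasDerivAt_S hs.1).pow 2).const_mul α)
      convert! h4 using 1
      rw [h.Z_eq s hs.1.le]
      push_cast
      ring)
    ((continuousOn_const.mul (hcC.continuousOn.mul hKS)).mono hsub).intervalIntegrable
  rw [intervalIntegral.integral_const_mul, h.S_zero, h.C_zero] at hFTC
  obtain ⟨M, hM0, hM⟩ := exists_bound_Icc hcS.continuousOn t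
  obtain ⟨N, hN0, hN⟩ := exists_bound_Icc hcC.continuousOn t
  have hv (j : ℕ) : ContinuousOn (vconv (fun r => Real.exp (-κ j * r)) S) (Ici 0) :=
    continuousOn_vconv_right (HalfLineIntegrable.of_continuousOn (by fun_prop)) hcS.continuousOn
  have hsumI := hasSum_integral_of_summable_integral_norm (μ := volume.restrict (Ioc 0 t))
    (F := fun (j : ℕ) s => C s * (c j * vconv (fun r => Real.exp (-κ j * r)) S s))
    (fun j => ((hcC.continuousOn.mul (continuousOn_const.mul (hv j))).mono
      hsub).intervalIntegrable.1) ?_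
  · have hIeq : ∫ s in Ioc 0 t, ∑' j, C s * (c j * vconv (fun r => Real.exp (-κ j * r)) S s) =
        ∫ s in (0 : ℝ)..t, C s * vconv (kernel c κ) S s := by
      rw [intervalIntegral.integral_of_le ht]
      refine setIntegral_congr_fun measurableSet_Ioc fun s hs => ?_
      rw [tsum_mul_left, (hasSum_vconv_kernel hc hκ hsum hcS.continuousOn hs.1.le).tsum_eq]
    rw [hIeq] at hsumI
    have hle : ∫ s in (0 : ℝ)..t, C s * vconv (kernel c κ) S s ≤
        (∑' j, c j / κ j) * (S t ^ 2 / 2) := by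
      refine hasSum_le (fun j => ?_) hsumI (hsum.hasSum.mul_right _)
      have h5 := h.integral_mul_vconv_exp_le (hκ j) ht
      rw [intervalIntegral.integral_of_le ht] at h5
      simp only [mul_left_comm (C _), integral_const_mul] at h5 ⊢
      calc _ ≤ c j * (S t ^ 2 / (2 * κ j)) := mul_le_mul_of_nonneg_left h5 (hc j).le
        _ = _ := by
          have := (hκ j).ne'
          field_simp
    have h6 := mul_le_mul_of_nonneg_left hle (show 0 ≤ 2 * b by positivity)
    nlinarith
  · refine Summable.of_nonneg_of_le (fun j => integral_nonneg fun _ => norm_nonneg _)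
      (fun j => ?_) (hsum.mul_right (N * M * t))
    have h7 : ∀ s ∈ Ioc 0 t, ‖C s * (c j * vconv (fun r => Real.exp (-κ j * r)) S s)‖ ≤
        N * (c j * (M / κ j)) := by
      intro s hs
      rw [norm_mul, norm_mul, Real.norm_of_nonneg (hc j).le]
      have h8 := hN s ⟨hs.1.le, hs.2⟩
      have h9 : ‖vconv (fun r => Real.exp (-κ j * r)) S s‖ ≤ M / κ j :=
        (intervalIntegral.norm_integral_le_integral_norm hs.1.le).trans
          (abs_vconv_exp_le (hκ j) hs.1.le fun r hr => hM r ⟨hr.1, hr.2.trans hs.2⟩)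
      have := (hc j).le
      gcongr
    have h10 := setIntegral_mono_on (((hcC.continuousOn.mul (continuousOn_const.mul (hv j))).mono
      hsub).intervalIntegrable.1.norm) (integrableOn_const (μ := volume) (by simp)) measurableSet_Ioc h7
    refine h10.trans (le_of_eq ?_)
    rw [setIntegral_const, Real.volume_real_Ioc_of_le ht, smul_eq_mul]
    ring

/-! ### Existence of the scalar resolvent -/

section Existence

open BoundedContinuousFunction

theorem integrable_mul_comp_sub {q : ℝ → ℝ} (hq : Integrable q) (y : ℝ →ᵇ ℝ) (t : ℝ) :
    Integrable fun r => q r * y (t - r) :=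
  hq.mul_bdd (c := ‖y‖) (by fun_prop : Continuous fun r => y (t - r)).aestronglyMeasurable
    (ae_of_all _ fun _ => y.norm_coe_le_norm _)

theorem norm_integral_mul_comp_sub_le {q : ℝ → ℝ} (hq : Integrable q) (y : ℝ →ᵇ ℝ) (t : ℝ) :
    ‖∫ r, q r * y (t - r)‖ ≤ (∫ r, ‖q r‖) * ‖y‖ := by
  rw [← integral_mul_const]
  refine norm_integral_le_of_norm_le (hq.norm.mul_const _) (ae_of_all _ fun r => ?_)
  rw [norm_mul]
  exact mul_le_mul_of_nonneg_left (y.norm_coe_le_norm _) (norm_nonneg _)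

/-- Convolution with an integrable kernel as an operator on bounded continuous functions. -/
noncomputable def convBCF (q : ℝ → ℝ) (hq : Integrable q) : (ℝ →ᵇ ℝ) →L[ℝ] (ℝ →ᵇ ℝ) :=
  LinearMap.mkContinuous
    { toFun := fun y => BoundedContinuousFunction.ofNormedAddCommGroup
        (fun t => ∫ r, q r * y (t - r))
        (continuous_of_dominated (bound := fun r => ‖q r‖ * ‖y‖)
          (fun t => (integrable_mul_comp_sub hq y t).1)
          (fun t => ae_of_all _ fun r => by
            rw [norm_mul]
            exact mul_le_mul_of_nonneg_left (y.norm_coe_le_norm _) (norm_nonneg _))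
          (hq.norm.mul_const _) (ae_of_all _ fun r => by fun_prop))
        ((∫ r, ‖q r‖) * ‖y‖) (norm_integral_mul_comp_sub_le hq y)
      map_add' := fun y z => by
        ext t
        simp only [coe_ofNormedAddCommGroup, BoundedContinuousFunction.add_apply, mul_add]
        exact integral_add (integrable_mul_comp_sub hq y t) (integrable_mul_comp_sub hq z t)
      map_smul' := fun a y => by
        ext t
        simp only [coe_ofNormedAddCommGroup, BoundedContinuousFunction.coe_smul, smul_eq_mul,
          RingHom.id_apply, mul_left_comm _ a]
        exact integral_const_mul _ _ }
    (∫ r, ‖q r‖) fun y => norm_ofNormedAddCommGroup_le _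
      (mul_nonneg (integral_nonneg fun _ => norm_nonneg _) (norm_nonneg _))
      (norm_integral_mul_comp_sub_le hq y)

theorem convBCF_apply (q : ℝ → ℝ) (hq : Integrable q) (y : ℝ →ᵇ ℝ) (t : ℝ) :
    convBCF q hq y t = ∫ r, q r * y (t - r) := rfl

theorem norm_convBCF_le (q : ℝ → ℝ) (hq : Integrable q) : ‖convBCF q hq‖ ≤ ∫ r, ‖q r‖ :=
  LinearMap.mkContinuous_norm_le _ (integral_nonneg fun _ => norm_nonneg _) _

theorem convBCF_indicator_of_nonpos {q : ℝ → ℝ} (hq : Integrable ((Ioi 0).indicator q))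
    {y : ℝ →ᵇ ℝ} (hy : ∀ t ≤ 0, y t = 0) {t : ℝ} (ht : t ≤ 0) :
    convBCF ((Ioi 0).indicator q) hq y t = 0 := by
  rw [convBCF_apply]
  refine integral_eq_zero_of_ae (ae_of_all _ fun r => ?_)
  by_cases hr : r ∈ Ioi (0 : ℝ)
  · have hr' : 0 < r := hr
    simp only [hy (t - r) (by linarith), mul_zero, Pi.zero_apply]
  · simp only [indicator_of_notMem hr, zero_mul, Pi.zero_apply]

theorem convBCF_indicator_eq_vconv {q : ℝ → ℝ} (hq : Integrable ((Ioi 0).indicator q))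
    {y : ℝ →ᵇ ℝ} (hy : ∀ t ≤ 0, y t = 0) {t : ℝ} (ht : 0 ≤ t) :
    convBCF ((Ioi 0).indicator q) hq y t = vconv q y t := by
  rw [convBCF_apply, vconv_swap, intervalIntegral.integral_of_le ht,
    ← integral_indicator measurableSet_Ioc]
  refine integral_congr_ae (ae_of_all _ fun r => ?_)
  by_cases hr : 0 < r
  · by_cases hrt : r ≤ t
    · simp [Set.indicator, hr, hrt]
    · simp [Set.indicator, hr, hrt, hy (t - r) (by linarith)]
  · simp [Set.indicator, hr]

theorem exp_mul_vconv {p : ℝ → ℝ} (μ : ℝ) (x : ℝ → ℝ) (t : ℝ) :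
    Real.exp (μ * t) * vconv (fun r => Real.exp (-μ * r) * p r) x t =
      vconv p (fun s => Real.exp (μ * s) * x s) t := by
  rw [vconv, vconv, ← intervalIntegral.integral_const_mul]
  refine intervalIntegral.integral_congr fun s _ => ?_
  have h : Real.exp (μ * t) * Real.exp (-μ * (t - s)) = Real.exp (μ * s) := by
    rw [← Real.exp_add]
    ring_nf
  simp only [smul_eq_mul]
  linear_combination (p (t - s) * x s) * h

/-- Substituting S(t) = e^(μt) y(t) turns the twice integrated equation into y = g + V V W y, where
`V` is convolution with e^(-μr) and `W` is -α plus b times convolution with the damped kernel. For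
large μ this is a contraction on bounded continuous functions. -/
theorem exists_isResolvent {K : ℝ → ℝ} (hK : IntegrableOn K (Ioi 0)) {α b : ℝ} (hα : 0 ≤ α)
    (hb : 0 ≤ b) : ∃ S C Z, IsResolvent K α b S C Z := by
  set k := ∫ t in Ioi (0 : ℝ), ‖K t‖ with hk
  have hk0 : 0 ≤ k := integral_nonneg fun _ => norm_nonneg _
  -- Then ‖V‖ ≤ 1/μ ≤ 1 and ‖W‖ ≤ α + bk < μ, so ‖V V W‖ < 1.
  set μ := α + b * k + 1 with hμ
  have hμ1 : 1 ≤ μ := by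
    have : 0 ≤ b * k := by positivity
    linarith
  have hμ0 : 0 < μ := by linarith
  have hV : Integrable ((Ioi 0).indicator fun r : ℝ => Real.exp (-μ * r)) :=
    (integrable_indicator_iff measurableSet_Ioi).2
      (integrableOn_exp_mul_Ioi (neg_lt_zero.2 hμ0) 0)
  have hbd : ∀ r ∈ Ioi (0 : ℝ), ‖Real.exp (-μ * r) * K r‖ ≤ ‖K r‖ := by
    intro r (hr : 0 < r)
    rw [norm_mul, Real.norm_eq_abs, Real.abs_exp]
    refine mul_le_of_le_one_left (norm_nonneg _) (Real.exp_le_one_iff.2 ?_)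
    nlinarith
  have hKi : IntegrableOn (fun r => Real.exp (-μ * r) * K r) (Ioi 0) :=
    hK.norm.mono' ((by fun_prop : Continuous fun r => Real.exp (-μ * r)).aestronglyMeasurable.mul
      hK.1) ((ae_restrict_iff' measurableSet_Ioi).2 (ae_of_all _ hbd))
  have hKμ : Integrable ((Ioi 0).indicator fun r : ℝ => Real.exp (-μ * r) * K r) :=
    (integrable_indicator_iff measurableSet_Ioi).2 hKi
  set V := convBCF _ hV
  set 𝒦 := convBCF _ hKμ
  have hVn : ‖V‖ ≤ μ⁻¹ := by
    refine (norm_convBCF_le _ hV).trans (le_of_eq ?_)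
    simp only [norm_indicator_eq_indicator_norm, Real.norm_eq_abs, Real.abs_exp]
    rw [integral_indicator measurableSet_Ioi, integral_exp_neg_Ioi hμ0]
  have hKn : ‖𝒦‖ ≤ k := by
    refine (norm_convBCF_le _ hKμ).trans ?_
    simp only [norm_indicator_eq_indicator_norm]
    rw [integral_indicator measurableSet_Ioi]
    exact setIntegral_mono_on hKi.norm hK.norm measurableSet_Ioi hbd
  set W : (ℝ →ᵇ ℝ) →L[ℝ] (ℝ →ᵇ ℝ) := -α • ContinuousLinearMap.id ℝ (ℝ →ᵇ ℝ) + b • 𝒦 with hW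
  have hWn : ‖W‖ ≤ α + b * k := by
    refine (norm_add_le (-α • ContinuousLinearMap.id ℝ (ℝ →ᵇ ℝ)) (b • 𝒦)).trans
      (add_le_add ?_ ?_)
    · refine (ContinuousLinearMap.opNorm_smul_le (-α) (ContinuousLinearMap.id ℝ (ℝ →ᵇ ℝ))).trans ?_
      rw [norm_neg, Real.norm_of_nonneg hα]
      exact mul_le_of_le_one_right hα ContinuousLinearMap.norm_id_le
    · refine (ContinuousLinearMap.opNorm_smul_le b 𝒦).trans ?_
      rw [Real.norm_of_nonneg hb]
      gcongr
  set X := V ∘L V ∘L W with hX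
  have hXn : ‖X‖ < 1 := by
    have h1 : ‖X‖ ≤ μ⁻¹ * (μ⁻¹ * (α + b * k)) := by
      refine (ContinuousLinearMap.opNorm_comp_le _ _).trans ?_
      gcongr
      refine (ContinuousLinearMap.opNorm_comp_le _ _).trans ?_
      gcongr
    refine h1.trans_lt ?_
    have h2 : μ⁻¹ ≤ 1 := inv_le_one_of_one_le₀ hμ1
    have h3 : μ⁻¹ * (α + b * k) < 1 := by
      rw [inv_mul_lt_iff₀ hμ0]
      linarith
    have h4 : 0 ≤ μ⁻¹ * (α + b * k) := by positivity
    nlinarith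
  -- The damped form of t, which is the contribution of S'(0) = 1, extended by zero to t < 0.
  set g : ℝ →ᵇ ℝ := BoundedContinuousFunction.ofNormedAddCommGroup
    (fun t => max t 0 * Real.exp (-μ * max t 0)) (by fun_prop) μ⁻¹ (fun t => by
      have h0 : 0 ≤ max t 0 := le_max_right _ _
      rw [Real.norm_of_nonneg (by positivity), neg_mul, Real.exp_neg, ← div_eq_mul_inv,
        div_le_iff₀ (Real.exp_pos _), inv_mul_eq_div, le_div_iff₀ hμ0]
      have := Real.add_one_le_exp (μ * max t 0)
      linarith) with hg
  set Φ : (ℝ →ᵇ ℝ) → (ℝ →ᵇ ℝ) := fun y => g + X y with hΦ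
  have hcontr : ContractingWith ‖X‖₊ Φ := by
    refine ⟨by exact_mod_cast hXn, LipschitzWith.of_dist_le_mul fun y z => ?_⟩
    rw [hΦ, dist_add_left, dist_eq_norm, dist_eq_norm, ← map_sub]
    exact X.le_opNorm _
  set y := hcontr.fixedPoint Φ with hy
  have hyfix : y = g + X y := (hcontr.fixedPoint_isFixedPt).symm
  have hV0 : ∀ z : ℝ →ᵇ ℝ, (∀ t ≤ 0, z t = 0) → ∀ t ≤ 0, V z t = 0 := fun z hz t ht =>
    convBCF_indicator_of_nonpos hV hz ht
  have hW0 : ∀ z : ℝ →ᵇ ℝ, (∀ t ≤ 0, z t = 0) → ∀ t ≤ 0, W z t = 0 := fun z hz t ht => by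
    have h1 : W z t = -α * z t + b * 𝒦 z t := rfl
    have h2 : 𝒦 z t = 0 := convBCF_indicator_of_nonpos hKμ hz ht
    rw [h1, h2, hz t ht]
    ring
  -- Vanishing for t ≤ 0 is preserved by each iterate started from 0 and passes to the limit. It
  -- makes convolution over the whole line agree with `vconv`.
  have hy0 : ∀ t ≤ 0, y t = 0 := by
    intro t ht
    have hit : ∀ n : ℕ, ∀ t ≤ 0, (Φ^[n] 0) t = 0 := by
      intro n
      induction n with
      | zero => simp
      | succ n ih =>
        intro t ht
        rw [Function.iterate_succ_apply']
        have h1 : Φ (Φ^[n] 0) t = max t 0 * Real.exp (-μ * max t 0) + V (V (W (Φ^[n] 0))) t := rfl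
        rw [h1, hV0 _ (hV0 _ (hW0 _ ih)) t ht, max_eq_right ht]
        simp
    have hlim := hcontr.tendsto_iterate_fixedPoint (0 : ℝ →ᵇ ℝ)
    have hlim' : Tendsto (fun n => (Φ^[n] 0) t) atTop (𝓝 (y t)) :=
      ((continuous_eval_const t).tendsto y).comp hlim
    simp only [hit _ t ht] at hlim'
    exact (tendsto_nhds_unique hlim' tendsto_const_nhds)
  set S : ℝ → ℝ := fun t => Real.exp (μ * t) * y t with hS
  set Z : ℝ → ℝ := fun t => Real.exp (μ * t) * W y t with hZ
  have hVconv : ∀ z : ℝ →ᵇ ℝ, (∀ t ≤ 0, z t = 0) → ∀ t, 0 ≤ t →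
      Real.exp (μ * t) * V z t = ∫ s in (0 : ℝ)..t, Real.exp (μ * s) * z s := by
    intro z hz t ht
    have h1 := exp_mul_vconv (p := fun _ => 1) μ z t
    simp only [mul_one, vconv_one] at h1
    rw [← h1, convBCF_indicator_eq_vconv hV hz ht]
  have hZc : Continuous Z := by fun_prop
  have hCc : Continuous fun t => 1 + ∫ s in (0 : ℝ)..t, Z s :=
    continuous_const.add (intervalIntegral.continuous_primitive
      (fun _ _ => hZc.intervalIntegrable _ _) 0)
  refine ⟨S, fun t => 1 + ∫ s in (0 : ℝ)..t, Z s, Z, by fun_prop, hCc, hZc, fun t ht => ?_,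
    fun _ _ => rfl, fun t ht => ?_⟩
  · have h1 : y t = max t 0 * Real.exp (-μ * max t 0) + V (V (W y)) t := by
      conv_lhs => rw [hyfix]
      rfl
    have h2 : Real.exp (μ * t) * Real.exp (-μ * t) = 1 := by
      rw [← Real.exp_add]
      simp
    have h3 : S t = t + Real.exp (μ * t) * V (V (W y)) t := by
      rw [hS]
      simp only
      rw [h1, max_eq_left ht]
      linear_combination t * h2
    rw [h3, hVconv _ (hV0 _ (hW0 _ hy0)) t ht]
    rw [intervalIntegral.integral_add (by simp) ((intervalIntegral.continuous_primitive
      (fun _ _ => hZc.intervalIntegrable _ _) 0).intervalIntegrable _ _)]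
    simp only [intervalIntegral.integral_const, sub_zero, smul_eq_mul, mul_one, add_right_inj]
    refine intervalIntegral.integral_congr fun s hs => ?_
    rw [uIcc_of_le ht] at hs
    exact hVconv _ (hW0 _ hy0) s hs.1
  · have h1 : W y t = -α * y t + b * 𝒦 y t := rfl
    have h2 : 𝒦 y t = vconv (fun r => Real.exp (-μ * r) * K r) y t :=
      convBCF_indicator_eq_vconv hKμ hy0 ht
    have h3 := exp_mul_vconv (p := K) μ y t
    rw [← h2] at h3
    simp only [hZ, hS]
    rw [← h3, h1]
    ring

end Existence

/-! ### Weighted convolution inequalities -/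

section Convolution

theorem vconv_integrableOn_and_integral {q h : ℝ → ℝ} (hq : IntegrableOn q (Ioi 0))
    (hh : IntegrableOn h (Ioi 0)) : IntegrableOn (vconv q h) (Ioi 0) ∧
      ∫ t in Ioi (0 : ℝ), vconv q h t = (∫ t in Ioi (0 : ℝ), q t) * ∫ t in Ioi (0 : ℝ), h t := by
  have hv : vconv q h = fun t => ∫ s in (0 : ℝ)..t, ContinuousLinearMap.mul ℝ ℝ (h s) (q (t - s)) := by
    funext t
    simp only [vconv, ContinuousLinearMap.mul_apply', smul_eq_mul, mul_comm (h _)]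
  rw [hv]
  refine ⟨(integrable_indicator_iff measurableSet_Ioi).1 (integrable_posConvolution hh hq _), ?_⟩
  rw [integral_posConvolution hh hq, ContinuousLinearMap.mul_apply', mul_comm]

theorem exp_mul_vconv_exp (γ : ℝ) (q h : ℝ → ℝ) (t : ℝ) :
    vconv (fun r => Real.exp (-γ * r) * q r) (fun s => Real.exp (-γ * s) * h s) t =
      Real.exp (-γ * t) * vconv q h t := by
  rw [vconv, vconv, ← intervalIntegral.integral_const_mul]
  refine intervalIntegral.integral_congr fun s _ => ?_
  have e : Real.exp (-γ * (t - s)) * Real.exp (-γ * s) = Real.exp (-γ * t) := by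
    rw [← Real.exp_add]
    ring_nf
  simp only [smul_eq_mul]
  linear_combination (q (t - s) * h s) * e

variable {H : Type*} [NormedAddCommGroup H] [InnerProductSpace ℂ H]

/-- Cauchy–Schwarz for the measure K(t - s) ds, whose mass on (0, t] is at most ∫K. -/
theorem norm_vconv_sq_le {K : ℝ → ℝ} (hK0 : ∀ t, 0 ≤ K t) (hK : IntegrableOn K (Ioi 0))
    {W : ℝ → H} {t M : ℝ} (ht : 0 ≤ t)
    (hm : AEStronglyMeasurable W (volume.restrict (Ioc 0 t))) (hM : ∀ s ∈ Ioc 0 t, ‖W s‖ ≤ M) :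
    ‖vconv K W t‖ ^ 2 ≤ (∫ t in Ioi (0 : ℝ), K t) * vconv K (fun s => ‖W s‖ ^ 2) t := by
  have hKt : IntegrableOn (fun s => K (t - s)) (Ioc 0 t) := by
    have h1 : HalfLineIntegrable K := fun T hT =>
      (intervalIntegrable_iff_integrableOn_Ioc_of_le hT).2 (hK.mono_set Ioc_subset_Ioi_self)
    exact (intervalIntegrable_iff_integrableOn_Ioc_of_le ht).1 (h1.comp_sub_left ht)
  have hb (n : ℕ) : IntegrableOn (fun s => K (t - s) * ‖W s‖ ^ n) (Ioc 0 t) := by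
    refine hKt.mul_bdd (c := M ^ n) (hm.norm.pow n) ?_
    refine (ae_restrict_iff' measurableSet_Ioc).2 (ae_of_all _ fun s hs => ?_)
    rw [norm_pow, norm_norm]
    exact pow_le_pow_left₀ (norm_nonneg _) (hM s hs) n
  have h1 : ‖vconv K W t‖ ≤ ∫ s in Ioc 0 t, K (t - s) * ‖W s‖ := by
    rw [vconv, intervalIntegral.integral_of_le ht]
    refine (norm_integral_le_integral_norm _).trans (le_of_eq ?_)
    refine integral_congr_ae (ae_of_all _ fun s => ?_)
    simp only [norm_smul, Real.norm_of_nonneg (hK0 _)]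
  have h2 := sq_integral_mul_le (μ := volume.restrict (Ioc 0 t)) (w := fun s => K (t - s))
    (h := fun s => ‖W s‖) (ae_of_all _ fun s => hK0 _) hKt (by simpa [IntegrableOn] using hb 1) (hb 2)
  have h3 : ∫ s in Ioc 0 t, K (t - s) ≤ ∫ s in Ioi (0 : ℝ), K s := by
    rw [← intervalIntegral.integral_of_le ht, intervalIntegral.integral_comp_sub_left, sub_self,
      sub_zero, intervalIntegral.integral_of_le ht]
    exact setIntegral_mono_set hK (ae_of_all _ hK0) Ioc_subset_Ioi_self.eventuallyLE
  have h4 : 0 ≤ ∫ s in Ioc 0 t, K (t - s) * ‖W s‖ ^ 2 :=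
    integral_nonneg fun s => mul_nonneg (hK0 _) (sq_nonneg _)
  have h5 : vconv K (fun s => ‖W s‖ ^ 2) t = ∫ s in Ioc 0 t, K (t - s) * ‖W s‖ ^ 2 := by
    rw [vconv, intervalIntegral.integral_of_le ht]
    rfl
  rw [h5]
  calc ‖vconv K W t‖ ^ 2 ≤ (∫ s in Ioc 0 t, K (t - s) * ‖W s‖) ^ 2 := by gcongr
    _ ≤ _ := h2
    _ ≤ _ := mul_le_mul_of_nonneg_right h3 h4

/-- Young's inequality: the weight splits as e^(-2γ(t-s)) e^(-2γs), and for γ ≥ 0 the damped kernel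
still has mass at most k = ∫K. One factor k comes from the pointwise Cauchy–Schwarz bound, the other
from integrating the convolution. -/
theorem memL2w_vconv {K : ℝ → ℝ} (hK0 : ∀ t, 0 ≤ K t) (hK : IntegrableOn K (Ioi 0)) {γ : ℝ}
    (hγ : 0 ≤ γ) {W : ℝ → H} (hW : MemL2w γ W)
    (hM : ∀ t, 0 ≤ t → ∃ M, ∀ s ∈ Ioc 0 t, ‖W s‖ ≤ M)
    (hm : AEStronglyMeasurable (vconv K W) (volume.restrict (Ioi 0))) :
    MemL2w γ (vconv K W) ∧
      normL2w γ (vconv K W) ^ 2 ≤ (∫ t in Ioi (0 : ℝ), K t) ^ 2 * normL2w γ W ^ 2 := by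
  set k := ∫ t in Ioi (0 : ℝ), K t with hk
  have hk0 : 0 ≤ k := integral_nonneg fun t => hK0 t
  have hW' := memL2w_iff.1 hW
  have hle : ∀ r ∈ Ioi (0 : ℝ), Real.exp (-(2 * γ) * r) * K r ≤ K r := by
    intro r (hr : 0 < r)
    refine mul_le_of_le_one_left (hK0 r) (Real.exp_le_one_iff.2 ?_)
    have : 0 ≤ γ * r := by positivity
    linarith
  have hq : IntegrableOn (fun r => Real.exp (-(2 * γ) * r) * K r) (Ioi 0) := by
    refine hK.mono' ((by fun_prop : Continuous fun r =>
      Real.exp (-(2 * γ) * r)).aestronglyMeasurable.mul hK.1) ?_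
    refine (ae_restrict_iff' measurableSet_Ioi).2 (ae_of_all _ fun r hr => ?_)
    rw [Real.norm_of_nonneg (mul_nonneg (Real.exp_nonneg _) (hK0 r))]
    exact hle r hr
  have hh : IntegrableOn (fun t => Real.exp (-(2 * γ) * t) * ‖W t‖ ^ 2) (Ioi 0) := by
    simpa only [neg_mul] using hW'.2
  obtain ⟨hi, he⟩ := vconv_integrableOn_and_integral hq hh
  have hpt : ∀ t ∈ Ioi (0 : ℝ), Real.exp (-2 * γ * t) * ‖vconv K W t‖ ^ 2 ≤
      k * vconv (fun r => Real.exp (-(2 * γ) * r) * K r)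
        (fun t => Real.exp (-(2 * γ) * t) * ‖W t‖ ^ 2) t := by
    intro t (ht : 0 < t)
    obtain ⟨M, hM'⟩ := hM t ht.le
    have h1 := norm_vconv_sq_le hK0 hK ht.le (hW'.1.mono_measure
      (Measure.restrict_mono Ioc_subset_Ioi_self le_rfl)) hM'
    rw [exp_mul_vconv_exp]
    have h2 : Real.exp (-2 * γ * t) = Real.exp (-(2 * γ) * t) := by ring_nf
    rw [h2]
    calc _ ≤ Real.exp (-(2 * γ) * t) * (k * vconv K (fun s => ‖W s‖ ^ 2) t) := by gcongr
      _ = _ := by ring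
  have hint : IntegrableOn (fun t => Real.exp (-2 * γ * t) * ‖vconv K W t‖ ^ 2) (Ioi 0) := by
    refine (hi.const_mul k).mono' ((by fun_prop : Continuous fun t =>
      Real.exp (-2 * γ * t)).aestronglyMeasurable.mul (hm.norm.pow 2)) ?_
    refine (ae_restrict_iff' measurableSet_Ioi).2 (ae_of_all _ fun t ht => ?_)
    rw [Real.norm_of_nonneg (by positivity)]
    exact hpt t ht
  refine ⟨memL2w_iff.2 ⟨hm, hint⟩, ?_⟩
  rw [normL2w_sq, normL2w_sq]
  have h3 := setIntegral_mono_on hint (hi.const_mul k) measurableSet_Ioi hpt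
  refine h3.trans ?_
  rw [integral_const_mul, he, sq, mul_assoc]
  have h4 : ∫ t in Ioi (0 : ℝ), Real.exp (-(2 * γ) * t) * K t ≤ k :=
    setIntegral_mono_on hq hK measurableSet_Ioi hle
  have h5 : ∫ t in Ioi (0 : ℝ), Real.exp (-(2 * γ) * t) * ‖W t‖ ^ 2 =
      ∫ t in Ioi (0 : ℝ), Real.exp (-2 * γ * t) * ‖W t‖ ^ 2 := by
    simp only [neg_mul]
  rw [h5]
  have h6 : 0 ≤ ∫ t in Ioi (0 : ℝ), Real.exp (-2 * γ * t) * ‖W t‖ ^ 2 :=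
    integral_nonneg fun _ => by positivity
  gcongr

omit [InnerProductSpace ℂ H] in
-- Cauchy–Schwarz with weight e^(γs). Only half of the decay rate 2γ is spent, so multiplying by
-- e^(-2γt) later leaves a convolution with the integrable kernel e^(-γr).
theorem sq_integral_norm_le {γ : ℝ} (hγ : 0 < γ) {g : ℝ → H} (hg : HalfLineIntegrable g) {t : ℝ}
    (ht : 0 ≤ t) (hg2 : IntegrableOn (fun s => Real.exp (-γ * s) * ‖g s‖ ^ 2) (Ioc 0 t)) :
    (∫ s in (0 : ℝ)..t, ‖g s‖) ^ 2 ≤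
      Real.exp (γ * t) / γ * ∫ s in (0 : ℝ)..t, Real.exp (-γ * s) * ‖g s‖ ^ 2 := by
  have e (s : ℝ) : Real.exp (γ * s) * Real.exp (-γ * s) = 1 := by
    rw [← Real.exp_add]
    simp
  have h1 (s : ℝ) : Real.exp (γ * s) * (Real.exp (-γ * s) * ‖g s‖) = ‖g s‖ := by
    linear_combination ‖g s‖ * e s
  have h2 (s : ℝ) : Real.exp (γ * s) * (Real.exp (-γ * s) * ‖g s‖) ^ 2 =
      Real.exp (-γ * s) * ‖g s‖ ^ 2 := by
    linear_combination (Real.exp (-γ * s) * ‖g s‖ ^ 2) * e s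
  have hc : Continuous fun s => Real.exp (γ * s) := by fun_prop
  have h3 := sq_integral_mul_le (μ := volume.restrict (Ioc 0 t)) (w := fun s => Real.exp (γ * s))
    (h := fun s => Real.exp (-γ * s) * ‖g s‖) (ae_of_all _ fun s => Real.exp_nonneg _)
    (hc.intervalIntegrable 0 t).1 (by simpa only [h1, IntegrableOn] using (hg.integrableOn_Ioc ht).norm)
    (by simpa only [h2, IntegrableOn] using hg2)
  simp only [h1, h2] at h3
  rw [intervalIntegral.integral_of_le ht, intervalIntegral.integral_of_le ht]
  have h4 : ∫ s in Ioc 0 t, Real.exp (γ * s) ≤ Real.exp (γ * t) / γ := by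
    rw [← intervalIntegral.integral_of_le ht, intervalIntegral.integral_comp_mul_left _ hγ.ne',
      integral_exp, mul_zero, Real.exp_zero, smul_eq_mul, inv_mul_eq_div]
    gcongr
    linarith
  have h5 : 0 ≤ ∫ s in Ioc 0 t, Real.exp (-γ * s) * ‖g s‖ ^ 2 :=
    integral_nonneg fun _ => by positivity
  exact h3.trans (mul_le_mul_of_nonneg_right h4 h5)

end Convolution

/-! ### Variation of constants -/

namespace IsResolvent

variable {K : ℝ → ℝ} {α b : ℝ} {S C Z : ℝ → ℝ} (h : IsResolvent K α b S C Z)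
include h

/-- Since S = 1∗C, associativity and commutativity make K∗S the primitive of K∗C. -/
theorem Z_eq_integral (hK : HalfLineIntegrable K) {t : ℝ} (ht : 0 ≤ t) :
    Z t = ∫ s in (0 : ℝ)..t, (-α * C s + b * vconv K C s) := by
  have h1 : vconv K S t = ∫ s in (0 : ℝ)..t, vconv K C s := by
    rw [vconv_comm, ← vconv_one]
    rw [vconv_congr_left (q := vconv (fun _ => 1) C) ht fun s hs _ => by
      rw [vconv_one, h.S_eq s hs]]
    rw [← vconv_assoc (HalfLineIntegrable.of_continuousOn continuousOn_const) h.continuous_C hK ht]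
    exact vconv_congr_right ht fun s _ _ => vconv_comm _ _ _
  have h2 : IntervalIntegrable (vconv K C) volume 0 t :=
    HalfLineIntegrable.of_continuousOn
      (continuousOn_vconv_right hK h.continuous_C.continuousOn) t ht
  rw [intervalIntegral.integral_add ((h.continuous_C.intervalIntegrable _ _).const_mul _)
    (h2.const_mul _), intervalIntegral.integral_const_mul, intervalIntegral.integral_const_mul,
    ← h1, ← h.S_eq t ht, h.Z_eq t ht]

variable {E : Type*} [NormedAddCommGroup E] [NormedSpace ℝ E] [CompleteSpace E]

theorem vconv_S_eq {g : ℝ → E} (hg : HalfLineIntegrable g) {t : ℝ} (ht : 0 ≤ t) :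
    vconv S g t = ∫ s in (0 : ℝ)..t, vconv C g s := by
  rw [← vconv_one, vconv_assoc (HalfLineIntegrable.of_continuousOn continuousOn_const)
    h.continuous_C hg ht]
  exact vconv_congr_left ht fun s hs _ => by rw [vconv_one, h.S_eq s hs]

/-- In differentiating C∗g, the value C(0) = 1 contributes `g` itself and C' = Z contributes the
remaining convolution. -/
theorem vconv_C_eq {g : ℝ → E} (hg : HalfLineIntegrable g) {t : ℝ} (ht : 0 ≤ t) :
    vconv C g t = ∫ s in (0 : ℝ)..t, (g s + vconv Z g s) := by
  rw [intervalIntegral.integral_add (hg t ht) (HalfLineIntegrable.of_continuousOn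
    (continuousOn_vconv_left h.continuous_Z hg) t ht), ← vconv_one, ← vconv_one,
    vconv_assoc (HalfLineIntegrable.of_continuousOn continuousOn_const) h.continuous_Z hg ht]
  rw [vconv_congr_left (p := vconv (fun _ => 1) Z)
    (q := fun t => ∫ s in (0 : ℝ)..t, Z s) ht fun s hs _ => vconv_one _ _]
  rw [vconv_congr_left (p := C) (q := fun t => 1 + ∫ s in (0 : ℝ)..t, Z s) ht
    fun s hs _ => h.C_eq s hs]
  have hc : Continuous fun t => ∫ s in (0 : ℝ)..t, Z s :=
    intervalIntegral.continuous_primitive (fun _ _ => h.continuous_Z.intervalIntegrable _ _) 0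
  simp only [vconv, add_smul]
  exact intervalIntegral.integral_add
    (intervalIntegrable_vconv_left (m := fun _ => 1) continuous_const hg ht)
    (intervalIntegrable_vconv_left hc hg ht)

theorem vconv_Z_eq (hK : HalfLineIntegrable K) {g : ℝ → E} (hg : HalfLineIntegrable g) {t : ℝ}
    (ht : 0 ≤ t) :
    vconv Z g t = -α • vconv S g t + b • vconv K (vconv S g) t := by
  rw [vconv_assoc hK h.continuous_S hg ht]
  have h1 : vconv (fun t => Z t + α * S t) g t = b • vconv (vconv K S) g t := by
    rw [vconv_congr_left (q := fun t => b * vconv K S t) ht fun s hs _ => by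
      rw [h.Z_eq s hs]
      ring]
    simp only [vconv, ← intervalIntegral.integral_smul, smul_smul]
  rw [← h1]
  simp only [vconv, add_smul]
  rw [intervalIntegral.integral_add (intervalIntegrable_vconv_left h.continuous_Z hg ht)
    (intervalIntegrable_vconv_left (m := fun t => α * S t)
      (continuous_const.mul h.continuous_S) hg ht)]
  simp only [mul_smul, intervalIntegral.integral_smul, neg_smul]
  abel

/-- The solution of `x'' + α x - b K * x = g`, `x(0) = p`, `x'(0) = q`. -/
theorem solution_eq (hK : HalfLineIntegrable K) {g : ℝ → E} (hg : HalfLineIntegrable g) {p q : E}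
    {x y : ℝ → E} (hx : ∀ t, 0 ≤ t → x t = C t • p + S t • q + vconv S g t)
    (hy : ∀ t, 0 ≤ t → y t = Z t • p + C t • q + vconv C g t) :
    ContinuousOn x (Ici 0) ∧ ContinuousOn y (Ici 0) ∧
    (∀ t, 0 ≤ t → x t = p + ∫ s in (0 : ℝ)..t, y s) ∧
    ∀ t, 0 ≤ t → y t = q + ∫ s in (0 : ℝ)..t, (g s - α • x s + b • vconv K x s) := by
  have hS := h.continuous_S
  have hC := h.continuous_C
  have hZ := h.continuous_Z
  have hSg := continuousOn_vconv_left hS hg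
  have hCg := continuousOn_vconv_left hC hg
  have hZg := continuousOn_vconv_left hZ hg
  refine ⟨?_, ?_, fun t ht => ?_, fun t ht => ?_⟩
  · exact ContinuousOn.congr (by fun_prop) hx
  · exact ContinuousOn.congr (by fun_prop) hy
  · have h1 : ∫ s in (0 : ℝ)..t, y s =
        ∫ s in (0 : ℝ)..t, (Z s • p + C s • q + vconv C g s) := by
      refine intervalIntegral.integral_congr fun s hs => ?_
      rw [uIcc_of_le ht] at hs
      exact hy s hs.1
    rw [h1, intervalIntegral.integral_add
      ((by fun_prop : Continuous fun s => Z s • p + C s • q).intervalIntegrable _ _)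
      (HalfLineIntegrable.of_continuousOn hCg t ht), intervalIntegral.integral_add
      ((by fun_prop : Continuous fun s => Z s • p).intervalIntegrable _ _)
      ((by fun_prop : Continuous fun s => C s • q).intervalIntegrable _ _),
      intervalIntegral.integral_smul_const, intervalIntegral.integral_smul_const,
      ← h.vconv_S_eq hg ht, ← h.S_eq t ht, hx t ht, h.C_eq t ht, add_smul, one_smul]
    abel
  · have hKC : ContinuousOn (vconv K C) (Ici 0) := continuousOn_vconv_right hK hC.continuousOn
    have hKx : ∀ s, 0 ≤ s → vconv K x s =
        vconv K C s • p + vconv K S s • q + vconv K (vconv S g) s := by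
      intro s hs
      rw [vconv_congr_right (h := fun t => C t • p + S t • q + vconv S g t) hs
        fun r hr _ => hx r hr.le]
      have i1 : IntervalIntegrable (fun r => K (s - r) • C r • p) volume 0 s :=
        intervalIntegrable_vconv_right (x := fun r => C r • p) hK (by fun_prop) hs
      have i2 : IntervalIntegrable (fun r => K (s - r) • S r • q) volume 0 s :=
        intervalIntegrable_vconv_right (x := fun r => S r • q) hK (by fun_prop) hs
      have e1 : vconv K C s • p = ∫ r in (0 : ℝ)..s, K (s - r) • C r • p := by
        simp only [vconv, smul_smul, ← intervalIntegral.integral_smul_const, smul_eq_mul]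
      have e2 : vconv K S s • q = ∫ r in (0 : ℝ)..s, K (s - r) • S r • q := by
        simp only [vconv, smul_smul, ← intervalIntegral.integral_smul_const, smul_eq_mul]
      rw [e1, e2, ← intervalIntegral.integral_add i1 i2, vconv, vconv,
        ← intervalIntegral.integral_add (i1.add i2) (intervalIntegrable_vconv_right hK hSg hs)]
      simp only [smul_add]
    have h1 : ∫ s in (0 : ℝ)..t, (g s - α • x s + b • vconv K x s) =
        ∫ s in (0 : ℝ)..t, ((-α * C s + b * vconv K C s) • p + Z s • q +
          (g s + vconv Z g s)) := by
      refine intervalIntegral.integral_congr fun s hs => ?_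
      rw [uIcc_of_le ht] at hs
      rw [hKx s hs.1, hx s hs.1, h.vconv_Z_eq hK hg hs.1, h.Z_eq s hs.1]
      module
    have i1 : IntervalIntegrable (fun s => (-α * C s + b * vconv K C s) • p) volume 0 t :=
      HalfLineIntegrable.of_continuousOn
        (g := fun s => (-α * C s + b * vconv K C s) • p) (by fun_prop) t ht
    have i2 : IntervalIntegrable (fun s => Z s • q) volume 0 t :=
      (by fun_prop : Continuous fun s => Z s • q).intervalIntegrable _ _
    rw [h1, intervalIntegral.integral_add (i1.add i2)
      ((hg t ht).add (HalfLineIntegrable.of_continuousOn hZg t ht)),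
      intervalIntegral.integral_add i1 i2, intervalIntegral.integral_smul_const,
      intervalIntegral.integral_smul_const, ← h.vconv_C_eq hg ht, ← h.Z_eq_integral hK ht,
      hy t ht, h.C_eq t ht, add_smul, one_smul]
    abel

end IsResolvent

/-! ### Uniform bounds for the modes -/

section Bounds

variable {H : Type*} [NormedAddCommGroup H] [InnerProductSpace ℂ H]

theorem MemL2w.of_norm_le {γ M : ℝ} {g h : ℝ → H} (hh : MemL2w γ h)
    (hg : AEStronglyMeasurable g (volume.restrict (Ioi 0)))
    (hle : ∀ᵐ t ∂(volume.restrict (Ioi (0 : ℝ))), ‖g t‖ ≤ M * ‖h t‖) :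
    MemL2w γ g ∧ normL2w γ g ^ 2 ≤ M ^ 2 * normL2w γ h ^ 2 := by
  have hh2 := (memL2w_iff.1 hh).2.const_mul (M ^ 2)
  have hpt : ∀ᵐ t ∂(volume.restrict (Ioi (0 : ℝ))), Real.exp (-2 * γ * t) * ‖g t‖ ^ 2 ≤
      M ^ 2 * (Real.exp (-2 * γ * t) * ‖h t‖ ^ 2) := by
    filter_upwards [hle] with t ht
    have h1 : ‖g t‖ ^ 2 ≤ (M * ‖h t‖) ^ 2 := by gcongr
    calc _ ≤ Real.exp (-2 * γ * t) * (M * ‖h t‖) ^ 2 := by gcongr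
      _ = _ := by ring
  have hi : IntegrableOn (fun t => Real.exp (-2 * γ * t) * ‖g t‖ ^ 2) (Ioi 0) := by
    refine hh2.mono' ((by fun_prop : Continuous fun t =>
      Real.exp (-2 * γ * t)).aestronglyMeasurable.mul (hg.norm.pow 2)) ?_
    filter_upwards [hpt] with t ht
    rwa [Real.norm_of_nonneg (by positivity)]
  refine ⟨memL2w_iff.2 ⟨hg, hi⟩, ?_⟩
  rw [normL2w_sq, normL2w_sq, ← integral_const_mul]
  exact integral_mono_ae hi hh2 hpt

theorem MemL2w.integrableOn_exp_mul_norm_sq {γ : ℝ} (hγ : 0 ≤ γ) {g : ℝ → H} (hg : MemL2w γ g)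
    (t : ℝ) : IntegrableOn (fun s => Real.exp (-γ * s) * ‖g s‖ ^ 2) (Ioc 0 t) := by
  have hg' := memL2w_iff.1 hg
  refine ((hg'.2.mono_set Ioc_subset_Ioi_self).const_mul (Real.exp (γ * t))).mono'
    ((by fun_prop : Continuous fun t => Real.exp (-γ * t)).aestronglyMeasurable.mul
      ((hg'.1.mono_measure (Measure.restrict_mono Ioc_subset_Ioi_self le_rfl)).norm.pow 2)) ?_
  refine (ae_restrict_iff' measurableSet_Ioc).2 (ae_of_all _ fun s hs => ?_)
  rw [Real.norm_of_nonneg (by positivity), ← mul_assoc, ← Real.exp_add]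
  have : -γ * s ≤ γ * t + -2 * γ * s := by nlinarith [hs.2]
  gcongr

end Bounds

theorem norm_add_three_sq_le {E : Type*} [SeminormedAddCommGroup E] (x y z : E) :
    ‖x + y + z‖ ^ 2 ≤ 3 * (‖x‖ ^ 2 + ‖y‖ ^ 2 + ‖z‖ ^ 2) := by
  have h := norm_add₃_le (a := x) (b := y) (c := z)
  have h1 : ‖x + y + z‖ ^ 2 ≤ (‖x‖ + ‖y‖ + ‖z‖) ^ 2 := by gcongr
  nlinarith [sq_nonneg (‖x‖ - ‖y‖), sq_nonneg (‖x‖ - ‖z‖), sq_nonneg (‖y‖ - ‖z‖)]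

/-- When α - bk is positive, with k = ∑ cⱼ/κⱼ, the energy estimate bounds both coefficients: C² ≤ 1
and S² ≤ 1/(α - bk). The forcing term is then at most sup |S| times the L¹ norm of `g` on (0, t). -/
theorem IsResolvent.norm_solution_sq_le {H : Type*} [NormedAddCommGroup H]
    [InnerProductSpace ℂ H] {c κ : ℕ → ℝ} (hc : ∀ j, 0 < c j) (hκ : ∀ j, 0 < κ j)
    (hsum : Summable fun j => c j / κ j) {α b : ℝ} (hb : 0 ≤ b) {S C Z : ℝ → ℝ}
    (h : IsResolvent (kernel c κ) α b S C Z) (hα : 0 < α - b * ∑' j, c j / κ j) {γ : ℝ}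
    (hγ : 0 < γ) {g : ℝ → H} (hg : MemL2w γ g) (p q : H) {t : ℝ} (ht : 0 ≤ t) :
    ‖C t • p + S t • q + vconv S g t‖ ^ 2 ≤ 3 * (‖p‖ ^ 2 +
      (α - b * ∑' j, c j / κ j)⁻¹ * ‖q‖ ^ 2 + (α - b * ∑' j, c j / κ j)⁻¹ *
        (Real.exp (γ * t) / γ * ∫ s in (0 : ℝ)..t, Real.exp (-γ * s) * ‖g s‖ ^ 2)) := by
  set β := α - b * ∑' j, c j / κ j
  have hC (s : ℝ) (hs : 0 ≤ s) : C s ^ 2 ≤ 1 := by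
    have := h.energy hc hκ hsum hb hs
    have := mul_nonneg hα.le (sq_nonneg (S s))
    linarith
  have hS (s : ℝ) (hs : 0 ≤ s) : S s ^ 2 ≤ β⁻¹ := by
    have := h.energy hc hκ hsum hb hs
    have := sq_nonneg (C s)
    rw [← one_div, le_div_iff₀ hα]
    linarith
  have hSabs (s : ℝ) (hs : 0 ≤ s) : |S s| ≤ √β⁻¹ := Real.abs_le_sqrt (hS s hs)
  have hv : ‖vconv S g t‖ ≤ √β⁻¹ * ∫ s in (0 : ℝ)..t, ‖g s‖ := by
    rw [← intervalIntegral.integral_const_mul]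
    refine intervalIntegral.norm_integral_le_of_norm_le ht (ae_of_all _ fun s hs => ?_)
      ((hg.halfLineIntegrable t ht).norm.const_mul _)
    rw [norm_smul, Real.norm_eq_abs]
    exact mul_le_mul_of_nonneg_right (hSabs _ (by linarith [hs.2])) (norm_nonneg _)
  have hv2 : ‖vconv S g t‖ ^ 2 ≤ β⁻¹ *
      (Real.exp (γ * t) / γ * ∫ s in (0 : ℝ)..t, Real.exp (-γ * s) * ‖g s‖ ^ 2) := by
    calc _ ≤ (√β⁻¹ * ∫ s in (0 : ℝ)..t, ‖g s‖) ^ 2 := by gcongr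
      _ = β⁻¹ * (∫ s in (0 : ℝ)..t, ‖g s‖) ^ 2 := by
        rw [mul_pow, Real.sq_sqrt (inv_nonneg.2 hα.le)]
      _ ≤ _ := by
        have := inv_nonneg.2 hα.le
        gcongr
        exact sq_integral_norm_le hγ hg.halfLineIntegrable ht
          (hg.integrableOn_exp_mul_norm_sq hγ.le t)
  refine (norm_add_three_sq_le _ _ _).trans ?_
  rw [norm_smul, norm_smul, mul_pow, mul_pow, Real.norm_eq_abs, Real.norm_eq_abs, sq_abs, sq_abs]
  have h1 := mul_le_mul_of_nonneg_right (hC t ht) (sq_nonneg ‖p‖)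
  have h2 := mul_le_mul_of_nonneg_right (hS t ht) (sq_nonneg ‖q‖)
  linarith

variable {H : Type*} [NormedAddCommGroup H] [InnerProductSpace ℂ H] [CompleteSpace H]
  {A : H →ₗ.[ℂ] H} {c κ : ℕ → ℝ} {ξ a₀ δ : ℝ}

/-- The standing assumptions on the operator and the kernel: a spectral resolution, a completely
monotone exponential sum as the kernel, and a uniform spectral gap. -/
structure Admissible (A : H →ₗ.[ℂ] H) (c κ : ℕ → ℝ) (ξ a₀ δ : ℝ) : Prop where
  res : HasSpectralResolution A a₀
  c_pos : ∀ j, 0 < c j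
  κ_pos : ∀ j, 0 < κ j
  summable : Summable fun j => c j / κ j
  ξ_le_one : ξ ≤ 1
  δ_pos : 0 < δ
  gap : ∀ a, eigenProj A a ≠ 0 → δ * a ^ (2 : ℝ) ≤ a ^ (2 : ℝ) - a ^ (2 * ξ) * ∑' j, c j / κ j

theorem HasSpectralResolution.memL2w_eigenProj {γ : ℝ} {g : ℝ → H} (hg : MemL2w γ g) (a : ℝ) :
    MemL2w γ fun t => eigenProj A a (g t) :=
  (hg.of_norm_le (M := 1) ((eigenProj A a).continuous.comp_aestronglyMeasurable (memL2w_iff.1 hg).1)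
    (ae_of_all _ fun t => by
      rw [one_mul]
      exact norm_eigenProj_le a _)).1

theorem HasSpectralResolution.memL2w_of_pow (R : HasSpectralResolution A a₀) {β γ : ℝ}
    (hβ : 0 ≤ β) {f : ℝ → H} (hf : MemL2wPow A β γ f) :
    MemL2w γ f ∧ normL2w γ f ^ 2 ≤
      (a₀ ^ (-β)) ^ 2 * normL2w γ (fun t => powApply A β (f t)) ^ 2 := by
  refine hf.2.of_norm_le (R.aestronglyMeasurable fun a => ?_) ?_
  · by_cases ha : eigenProj A a = 0
    · simpa [ha] using aestronglyMeasurable_const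
    have ha0 : 0 < a := R.pos.trans_le (R.le_of_ne_zero a ha)
    have h1 := ((eigenProj A a).continuous.comp_aestronglyMeasurable
      (memL2w_iff.1 hf.2).1).const_smul (a ^ β)⁻¹
    refine h1.congr ?_
    filter_upwards [hf.1] with t ht
    simp only [Pi.smul_apply, R.eigenProj_powApply ht, smul_smul]
    rw [inv_mul_cancel₀ (Real.rpow_pos_of_pos ha0 β).ne', one_smul]
  · filter_upwards [hf.1] with t ht
    exact R.norm_le hβ ht

/-- The pointwise majorant of `‖A² u(t)‖²` for the solution `u`. -/
noncomputable def energyBound (A : H →ₗ.[ℂ] H) (ξ a₀ δ γ : ℝ) (f : ℝ → H) (φ₀ φ₁ : H)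
    (t : ℝ) : ℝ :=
  3 * (‖powApply A 2 φ₀‖ ^ 2 + δ⁻¹ * ‖powApply A 1 φ₁‖ ^ 2 + δ⁻¹ * (a₀ ^ (1 - (2 - ξ))) ^ 2 *
    (Real.exp (γ * t) / γ *
      ∫ s in (0 : ℝ)..t, Real.exp (-γ * s) * ‖powApply A (2 - ξ) (f s)‖ ^ 2))

/-- Multiplication by a² puts a⁴/β, with β = α - bk ≥ δa², in front of the terms in φ₁ and f; this
is at most a²/δ. Each of them thus carries one power of `A`, and for f this is dominated by `A ^ (2
- ξ)` because ξ ≤ 1. -/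
theorem Admissible.mode_bound (D : Admissible A c κ ξ a₀ δ) {γ : ℝ} (hγ : 0 < γ) {f : ℝ → H}
    (hf : MemL2wPow A (2 - ξ) γ f) (φ₀ φ₁ : H) {a : ℝ} (ha : eigenProj A a ≠ 0) {S C Z : ℝ → ℝ}
    (h : IsResolvent (kernel c κ) (a ^ (2 : ℝ)) (a ^ (2 * ξ)) S C Z) {t : ℝ} (ht : 0 ≤ t) :
    ‖a ^ (2 : ℝ) • (C t • eigenProj A a φ₀ + S t • eigenProj A a φ₁ +
        vconv S (fun s => eigenProj A a (f s)) t)‖ ^ 2 ≤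
      3 * (‖a ^ (2 : ℝ) • eigenProj A a φ₀‖ ^ 2 + δ⁻¹ * ‖a ^ (1 : ℝ) • eigenProj A a φ₁‖ ^ 2 +
        δ⁻¹ * (a₀ ^ (1 - (2 - ξ))) ^ 2 * (Real.exp (γ * t) / γ * ∫ s in (0 : ℝ)..t,
          Real.exp (-γ * s) * ‖eigenProj A a (powApply A (2 - ξ) (f s))‖ ^ 2)) := by
  have R := D.res
  have ha0 : 0 < a := R.pos.trans_le (R.le_of_ne_zero a ha)
  have hgap := D.gap a ha
  have hδ := D.δ_pos
  have h2 : a ^ (2 : ℝ) = a ^ 2 := Real.rpow_two a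
  have hβ : 0 < a ^ (2 : ℝ) - a ^ (2 * ξ) * ∑' j, c j / κ j := by
    refine lt_of_lt_of_le ?_ hgap
    positivity
  have hf0 := (R.memL2w_of_pow (by linarith [D.ξ_le_one]) hf).1
  have hm := h.norm_solution_sq_le D.c_pos D.κ_pos D.summable (by positivity) hβ hγ
    (HasSpectralResolution.memL2w_eigenProj (A := A) hf0 a) (eigenProj A a φ₀) (eigenProj A a φ₁) ht
  set β := a ^ (2 : ℝ) - a ^ (2 * ξ) * ∑' j, c j / κ j
  have hβ' : (a ^ (2 : ℝ)) ^ 2 * β⁻¹ ≤ δ⁻¹ * a ^ 2 := by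
    rw [← div_eq_mul_inv, div_le_iff₀ hβ]
    calc (a ^ (2 : ℝ)) ^ 2 = δ⁻¹ * a ^ 2 * (δ * a ^ (2 : ℝ)) := by
          rw [h2]
          field_simp
      _ ≤ _ := by gcongr
  have hE : 0 ≤ Real.exp (γ * t) / γ := by positivity
  set I := ∫ s in (0 : ℝ)..t, Real.exp (-γ * s) * ‖eigenProj A a (f s)‖ ^ 2 with hI
  set J := ∫ s in (0 : ℝ)..t,
    Real.exp (-γ * s) * ‖eigenProj A a (powApply A (2 - ξ) (f s))‖ ^ 2 with hJ
  have hI0 : 0 ≤ I := intervalIntegral.integral_nonneg ht fun _ _ => by positivity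
  have hIJ : a ^ 2 * I ≤ (a₀ ^ (1 - (2 - ξ))) ^ 2 * J := by
    rw [hI, hJ, ← intervalIntegral.integral_const_mul, ← intervalIntegral.integral_const_mul,
      intervalIntegral.integral_of_le ht, intervalIntegral.integral_of_le ht]
    refine integral_mono_ae
      (((HasSpectralResolution.memL2w_eigenProj hf0 a).integrableOn_exp_mul_norm_sq
        hγ.le t).const_mul _)
      (((HasSpectralResolution.memL2w_eigenProj hf.2 a).integrableOn_exp_mul_norm_sq
        hγ.le t).const_mul _) ?_
    filter_upwards [ae_mono (Measure.restrict_mono Ioc_subset_Ioi_self le_rfl) hf.1] with s hs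
    have h3 := R.norm_rpow_smul_le (α := 1) (β := 2 - ξ) (by linarith [D.ξ_le_one]) a (f s)
    rw [← R.eigenProj_powApply hs, norm_smul, Real.rpow_one, Real.norm_of_nonneg ha0.le] at h3
    have h4 : (a * ‖eigenProj A a (f s)‖) ^ 2 ≤
      (a₀ ^ (1 - (2 - ξ)) * ‖eigenProj A a (powApply A (2 - ξ) (f s))‖) ^ 2 := by gcongr
    calc a ^ 2 * (Real.exp (-γ * s) * ‖eigenProj A a (f s)‖ ^ 2)
        = Real.exp (-γ * s) * (a * ‖eigenProj A a (f s)‖) ^ 2 := by ring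
      _ ≤ Real.exp (-γ * s) *
          (a₀ ^ (1 - (2 - ξ)) * ‖eigenProj A a (powApply A (2 - ξ) (f s))‖) ^ 2 := by gcongr
      _ = _ := by ring
  rw [norm_smul, norm_smul, norm_smul, mul_pow, mul_pow, mul_pow, Real.rpow_one,
    Real.norm_eq_abs, Real.norm_eq_abs, sq_abs, sq_abs]
  have hp : 0 ≤ (a ^ (2 : ℝ)) ^ 2 := sq_nonneg _
  have k1 := mul_le_mul_of_nonneg_left hm hp
  have k2 := mul_le_mul_of_nonneg_right hβ' (sq_nonneg ‖eigenProj A a φ₁‖)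
  have k3 := mul_le_mul_of_nonneg_right hβ' (mul_nonneg hE hI0)
  have k4 := mul_le_mul_of_nonneg_left hIJ (mul_nonneg (inv_nonneg.2 hδ.le) hE)
  nlinarith

theorem Admissible.sum_mode_bound (D : Admissible A c κ ξ a₀ δ) {γ : ℝ} (hγ : 0 < γ) {f : ℝ → H}
    (hf : MemL2wPow A (2 - ξ) γ f) {φ₀ φ₁ : H} (hφ₀ : φ₀ ∈ powDomain A 2)
    (hφ₁ : φ₁ ∈ powDomain A 1) {t : ℝ} (ht : 0 ≤ t) (s : Finset ℝ) :
    ∑ a ∈ s, 3 * (‖a ^ (2 : ℝ) • eigenProj A a φ₀‖ ^ 2 +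
      δ⁻¹ * ‖a ^ (1 : ℝ) • eigenProj A a φ₁‖ ^ 2 +
        δ⁻¹ * (a₀ ^ (1 - (2 - ξ))) ^ 2 * (Real.exp (γ * t) / γ * ∫ s in (0 : ℝ)..t,
          Real.exp (-γ * s) * ‖eigenProj A a (powApply A (2 - ξ) (f s))‖ ^ 2)) ≤
      energyBound A ξ a₀ δ γ f φ₀ φ₁ t := by
  have R := D.res
  have hδ := inv_nonneg.2 D.δ_pos.le
  simp only [← Finset.mul_sum, Finset.sum_add_distrib, energyBound]
  have h0 := sum_le_hasSum s (fun _ _ => sq_nonneg _) (R.hasSum_powApply_sq hφ₀)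
  have h1 := sum_le_hasSum s (fun _ _ => sq_nonneg _) (R.hasSum_powApply_sq hφ₁)
  have hint (a : ℝ) := (HasSpectralResolution.memL2w_eigenProj (A := A) hf.2
    a).integrableOn_exp_mul_norm_sq hγ.le t
  have h2 : ∑ a ∈ s, ∫ s in (0 : ℝ)..t,
      Real.exp (-γ * s) * ‖eigenProj A a (powApply A (2 - ξ) (f s))‖ ^ 2 ≤
      ∫ s in (0 : ℝ)..t, Real.exp (-γ * s) * ‖powApply A (2 - ξ) (f s)‖ ^ 2 := by
    simp only [intervalIntegral.integral_of_le ht]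
    rw [← integral_finsetSum s fun a _ => hint a]
    refine integral_mono (integrable_finsetSum s fun a _ => hint a)
      (hf.2.integrableOn_exp_mul_norm_sq hγ.le t) fun r => ?_
    simp only [← Finset.mul_sum]
    exact mul_le_mul_of_nonneg_left (R.sum_sq_le s _) (Real.exp_nonneg _)
  gcongr

variable {H : Type*} [NormedAddCommGroup H] [InnerProductSpace ℂ H] [CompleteSpace H]
  {A : H →ₗ.[ℂ] H} {c κ : ℕ → ℝ} {ξ a₀ δ : ℝ}

/-- A Riesz–Fischer argument: bounded partial sums of the weighted squares give weighted
summability, and for β ≥ 0 also the unweighted summability needed to form the vector. -/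
theorem HasSpectralResolution.exists_of_coefficients (R : HasSpectralResolution A a₀) {B : ℝ}
    {y : ℝ → H} (hy : ∀ a, eigenProj A a (y a) = y a) {β : ℝ} (hβ : 0 ≤ β)
    (hB : ∀ s : Finset ℝ, ∑ a ∈ s, ‖a ^ β • y a‖ ^ 2 ≤ B) :
    (∀ a, eigenProj A a (∑' a, y a) = y a) ∧ (∑' a, y a) ∈ powDomain A β ∧
      ‖powApply A β (∑' a, y a)‖ ^ 2 ≤ B := by
  have hs : Summable fun a => ‖a ^ β • y a‖ ^ 2 :=
    summable_of_sum_le (fun _ => sq_nonneg _) hB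
  have hs' : Summable y := by
    rw [R.summable y hy]
    refine Summable.of_nonneg_of_le (fun _ => sq_nonneg _) (fun a => ?_)
      (hs.mul_left ((a₀ ^ (0 - β)) ^ 2))
    have h1 := R.norm_rpow_smul_le hβ a (y a)
    rw [hy a, Real.rpow_zero, one_smul] at h1
    rw [← mul_pow]
    gcongr
  have hp := R.eigenProj_tsum hy hs'
  have hmem : (∑' a, y a) ∈ powDomain A β := by
    rw [R.mem_powDomain_iff]
    simpa only [hp] using hs
  refine ⟨hp, hmem, ?_⟩
  have h2 := R.hasSum_powApply_sq hmem
  simp only [hp] at h2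
  rw [← h2.tsum_eq]
  exact hs.tsum_le_of_sum_le hB

theorem eigenProj_vconv {p : ℝ → ℝ} {g : ℝ → H} {t : ℝ}
    (h : IntervalIntegrable (fun s => p (t - s) • g s) volume 0 t) (a : ℝ) :
    eigenProj A a (vconv p g t) = vconv p (fun s => eigenProj A a (g s)) t := by
  rw [vconv, ← ContinuousLinearMap.intervalIntegral_comp_comm _ h]
  refine intervalIntegral.integral_congr fun s _ => ?_
  exact map_real_smul (eigenProj A a) (eigenProj A a).continuous _ _

/-- The candidate u(t) sums the variation-of-constants formulas over the spectrum. Its equation is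
recorded in integrated form and modewise, which avoids differentiating the series. -/
theorem Admissible.exists_modes (D : Admissible A c κ ξ a₀ δ) {γ : ℝ} (hγ : 0 < γ) {f : ℝ → H}
    (hf : MemL2wPow A (2 - ξ) γ f) {φ₀ φ₁ : H} (hφ₀ : φ₀ ∈ powDomain A 2)
    (hφ₁ : φ₁ ∈ powDomain A 1) : ∃ u : ℝ → H,
      (∀ t, 0 ≤ t → u t ∈ powDomain A 2 ∧
        ‖powApply A 2 (u t)‖ ^ 2 ≤ energyBound A ξ a₀ δ γ f φ₀ φ₁ t) ∧
      ∀ a, ContinuousOn (fun t => eigenProj A a (u t)) (Ici 0) ∧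
        ∃ y : ℝ → H, ContinuousOn y (Ici 0) ∧
          (∀ t, 0 ≤ t → eigenProj A a (u t) = eigenProj A a φ₀ + ∫ s in (0 : ℝ)..t, y s) ∧
          ∀ t, 0 ≤ t → y t = eigenProj A a φ₁ + ∫ s in (0 : ℝ)..t,
            (eigenProj A a (f s) - a ^ (2 : ℝ) • eigenProj A a (u s) +
              a ^ (2 * ξ) • vconv (kernel c κ) (fun r => eigenProj A a (u r)) s) := by
  have R := D.res
  have hK := halfLineIntegrable_kernel D.c_pos D.κ_pos D.summable
  have hf0 := (R.memL2w_of_pow (by linarith [D.ξ_le_one]) hf).1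
  have hfa (a : ℝ) : HalfLineIntegrable fun s => eigenProj A a (f s) :=
    (HasSpectralResolution.memL2w_eigenProj hf0 a).halfLineIntegrable
  -- A choice is needed for every real `a`; where the projection vanishes the zero functions do, as
  -- all components are zero there.
  have hres : ∀ a : ℝ, ∃ S C Z : ℝ → ℝ, eigenProj A a ≠ 0 →
      IsResolvent (kernel c κ) (a ^ (2 : ℝ)) (a ^ (2 * ξ)) S C Z := by
    intro a
    by_cases ha : eigenProj A a = 0
    · exact ⟨0, 0, 0, fun h => absurd ha h⟩
    · have ha0 : 0 < a := R.pos.trans_le (R.le_of_ne_zero a ha)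
      obtain ⟨S, C, Z, h⟩ := exists_isResolvent
        (integrableOn_kernel D.c_pos D.κ_pos D.summable).1
        (show 0 ≤ a ^ (2 : ℝ) by positivity) (show 0 ≤ a ^ (2 * ξ) by positivity)
      exact ⟨S, C, Z, fun _ => h⟩
  choose S C Z hSCZ using hres
  set x : ℝ → ℝ → H := fun t a => C a t • eigenProj A a φ₀ + S a t • eigenProj A a φ₁ +
    vconv (S a) (fun s => eigenProj A a (f s)) t with hx
  have hx0 {a : ℝ} (ha : eigenProj A a = 0) (t : ℝ) : x t a = 0 := by
    simp [hx, ha, vconv]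
  have hxa (t : ℝ) (ht : 0 ≤ t) (a : ℝ) : eigenProj A a (x t a) = x t a := by
    by_cases ha : eigenProj A a = 0
    · rw [hx0 ha, map_zero]
    simp only [hx, map_add]
    rw [R.eigenProj_smul_eigenProj, R.eigenProj_smul_eigenProj, eigenProj_vconv
      (intervalIntegrable_vconv_left (hSCZ a ha).continuous_S (hfa a) ht)]
    simp only [R.idem]
  have hsum (t : ℝ) (ht : 0 ≤ t) (s : Finset ℝ) : ∑ a ∈ s, ‖a ^ (2 : ℝ) • x t a‖ ^ 2 ≤
      energyBound A ξ a₀ δ γ f φ₀ φ₁ t := by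
    refine le_trans (Finset.sum_le_sum fun a _ => ?_) (D.sum_mode_bound hγ hf hφ₀ hφ₁ ht s)
    by_cases ha : eigenProj A a = 0
    · rw [hx0 ha]
      simp [ha]
    · exact D.mode_bound hγ hf φ₀ φ₁ ha (hSCZ a ha) ht
  have hmain (t : ℝ) (ht : 0 ≤ t) := R.exists_of_coefficients (hxa t ht) zero_le_two (hsum t ht)
  refine ⟨fun t => ∑' a, x t a, fun t ht => (hmain t ht).2, fun a => ?_⟩
  by_cases ha : eigenProj A a = 0
  · simp only [ha, zero_apply]
    refine ⟨continuousOn_const, fun _ => 0, continuousOn_const, fun t _ => by simp,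
      fun t _ => by simp [vconv]⟩
  obtain ⟨h1, h2, h3, h4⟩ := (hSCZ a ha).solution_eq hK (hfa a) (p := eigenProj A a φ₀)
    (q := eigenProj A a φ₁) (x := fun t => x t a) (y := fun t => Z a t • eigenProj A a φ₀ +
      C a t • eigenProj A a φ₁ + vconv (C a) (fun s => eigenProj A a (f s)) t)
    (fun t _ => rfl) (fun t _ => rfl)
  refine ⟨h1.congr fun t ht => (hmain t ht).1 a, _, h2, fun t ht => ?_, fun t ht => ?_⟩
  · rw [(hmain t ht).1 a]
    exact h3 t ht
  · rw [h4 t ht]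
    congr 1
    refine intervalIntegral.integral_congr fun s hs => ?_
    rw [uIcc_of_le ht] at hs
    simp only
    rw [(hmain s hs.1).1 a]
    congr 2
    exact vconv_congr_right hs.1 fun r hr _ => ((hmain r hr.le).1 a).symm

/-- The constant terms integrate to 1/(2γ). The forcing term becomes the convolution of e^(-γr) with
e^(-2γs)‖A^(2-ξ)f(s)‖²; its integral gives one factor 1/γ, next to the 1/γ already in `energyBound`.
-/
theorem energyBound_integral {γ : ℝ} (hγ : 0 < γ) {f : ℝ → H}
    (hf : MemL2wPow A (2 - ξ) γ f) (φ₀ φ₁ : H) :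
    IntegrableOn (fun t => Real.exp (-2 * γ * t) * energyBound A ξ a₀ δ γ f φ₀ φ₁ t) (Ioi 0) ∧
      ∫ t in Ioi (0 : ℝ), Real.exp (-2 * γ * t) * energyBound A ξ a₀ δ γ f φ₀ φ₁ t =
        3 * ((2 * γ)⁻¹ * (‖powApply A 2 φ₀‖ ^ 2 + δ⁻¹ * ‖powApply A 1 φ₁‖ ^ 2) +
          δ⁻¹ * (a₀ ^ (1 - (2 - ξ))) ^ 2 * γ⁻¹ ^ 2 *
            normL2w γ (fun t => powApply A (2 - ξ) (f t)) ^ 2) := by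
  set G : ℝ → H := fun t => powApply A (2 - ξ) (f t) with hG
  set M := 3 * (‖powApply A 2 φ₀‖ ^ 2 + δ⁻¹ * ‖powApply A 1 φ₁‖ ^ 2) with hM
  set N := 3 * (δ⁻¹ * (a₀ ^ (1 - (2 - ξ))) ^ 2 * γ⁻¹) with hN
  have hq := integrableOn_exp_mul_Ioi (neg_lt_zero.2 hγ) 0
  have hq2 := integrableOn_exp_mul_Ioi (neg_lt_zero.2 (show 0 < 2 * γ by positivity)) 0
  obtain ⟨hi, he⟩ := vconv_integrableOn_and_integral hq (memL2w_iff.1 hf.2).2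
  have hpt (t : ℝ) : Real.exp (-2 * γ * t) * energyBound A ξ a₀ δ γ f φ₀ φ₁ t =
      M * Real.exp (-(2 * γ) * t) + N * vconv (fun r => Real.exp (-γ * r))
        (fun s => Real.exp (-2 * γ * s) * ‖G s‖ ^ 2) t := by
    have h1 := exp_mul_vconv_exp γ (fun _ => 1) (fun s => Real.exp (-γ * s) * ‖G s‖ ^ 2) t
    simp only [mul_one, ← mul_assoc, ← Real.exp_add, vconv_one] at h1
    have h2 (s : ℝ) : -γ * s + -γ * s = -2 * γ * s := by ring
    simp only [h2] at h1
    have e1 : Real.exp (-2 * γ * t) = Real.exp (-γ * t) * Real.exp (-γ * t) := by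
      rw [← Real.exp_add]
      ring_nf
    have e2 : Real.exp (-(2 * γ) * t) = Real.exp (-2 * γ * t) := by ring_nf
    have e3 : Real.exp (-γ * t) * Real.exp (γ * t) = 1 := by
      rw [← Real.exp_add]
      simp
    rw [h1, e2, energyBound, e1]
    simp only [hM, hN]
    set I := ∫ s in (0 : ℝ)..t, Real.exp (-γ * s) * ‖G s‖ ^ 2
    linear_combination (3 * δ⁻¹ * (a₀ ^ (1 - (2 - ξ))) ^ 2 * γ⁻¹ * Real.exp (-γ * t) * I) * e3
  simp only [hpt]
  refine ⟨(hq2.const_mul M).add (hi.const_mul N), ?_⟩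
  rw [integral_add (hq2.const_mul M) (hi.const_mul N), integral_const_mul, integral_const_mul, he,
    integral_exp_neg_Ioi hγ, integral_exp_neg_Ioi (show 0 < 2 * γ by positivity), normL2w_sq]
  simp only [hM, hN]
  ring

section Sums

variable {H : Type*} [NormedAddCommGroup H] [InnerProductSpace ℂ H]

theorem MemL2w.sub_add {γ : ℝ} {f g h : ℝ → H} (hf : MemL2w γ f) (hg : MemL2w γ g)
    (hh : MemL2w γ h) : MemL2w γ (fun t => f t - g t + h t) ∧
      normL2w γ (fun t => f t - g t + h t) ^ 2 ≤
        3 * (normL2w γ f ^ 2 + normL2w γ g ^ 2 + normL2w γ h ^ 2) := by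
  have h1 : MemL2w γ (fun t => f t - g t + h t) := by
    have := (MemLp.sub hf hg).add hh
    refine this.ae_eq (ae_of_all _ fun t => ?_)
    simp only [Pi.add_apply, Pi.sub_apply, smul_add, smul_sub]
  refine ⟨h1, ?_⟩
  have hfi := (memL2w_iff.1 hf).2
  have hgi := (memL2w_iff.1 hg).2
  have hhi := (memL2w_iff.1 hh).2
  have hfgi : IntegrableOn (fun t => Real.exp (-2 * γ * t) * ‖f t‖ ^ 2 +
    Real.exp (-2 * γ * t) * ‖g t‖ ^ 2) (Ioi 0) := hfi.add hgi
  rw [normL2w_sq, normL2w_sq, normL2w_sq, normL2w_sq, ← integral_add hfi hgi,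
    ← integral_add hfgi hhi, ← integral_const_mul]
  refine integral_mono (memL2w_iff.1 h1).2 ((hfgi.add hhi).const_mul 3) fun t => ?_
  have h2 := norm_add_three_sq_le (f t) (-g t) (h t)
  rw [norm_neg, ← sub_eq_add_neg] at h2
  have h3 := mul_le_mul_of_nonneg_left h2 (Real.exp_nonneg (-2 * γ * t))
  beta_reduce
  linarith

end Sums

/-! ### Assembling the strong solution -/

variable {H : Type*} [NormedAddCommGroup H] [InnerProductSpace ℂ H] [CompleteSpace H]
  {A : H →ₗ.[ℂ] H} {c κ : ℕ → ℝ} {ξ a₀ δ : ℝ}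

theorem normW2_sq {γ : ℝ} {u u₂ : ℝ → H} (hu : MemL2w γ fun t => powApply A 2 (u t))
    (hu₂ : MemL2w γ u₂) : normW2 A γ u u₂ ^ 2 =
      normL2w γ u₂ ^ 2 + normL2w γ (fun t => powApply A 2 (u t)) ^ 2 := by
  rw [normW2, Real.sq_sqrt (integral_nonneg fun _ => by positivity), normL2w_sq, normL2w_sq,
    ← integral_add (memL2w_iff.1 hu₂).2 (memL2w_iff.1 hu).2]
  simp only [mul_add]

theorem continuousOn_energyBound {γ : ℝ} (hγ : 0 < γ) {f : ℝ → H}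
    (hf : MemL2wPow A (2 - ξ) γ f) (φ₀ φ₁ : H) :
    ContinuousOn (energyBound A ξ a₀ δ γ f φ₀ φ₁) (Ici 0) := by
  have h1 : HalfLineIntegrable
      fun s => Real.exp (-γ * s) * ‖powApply A (2 - ξ) (f s)‖ ^ 2 := fun T hT =>
    (intervalIntegrable_iff_integrableOn_Ioc_of_le hT).2
      (hf.2.integrableOn_exp_mul_norm_sq hγ.le T)
  have h2 := h1.continuousOn_primitive
  unfold energyBound
  fun_prop

theorem HasSpectralResolution.aestronglyMeasurable_of_continuousOn
    (R : HasSpectralResolution A a₀) {g : ℝ → H}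
    (h : ∀ a, ContinuousOn (fun t => eigenProj A a (g t)) (Ici 0)) :
    AEStronglyMeasurable g (volume.restrict (Ioi 0)) :=
  R.aestronglyMeasurable fun a =>
    ((h a).mono Ioi_subset_Ici_self).aestronglyMeasurable measurableSet_Ioi

/-- A strong solution together with its bound in terms of the data. -/
theorem Admissible.exists_isStrongSolution_sq (D : Admissible A c κ ξ a₀ δ) {γ : ℝ} (hγ : 0 < γ)
    {f : ℝ → H} (hf : MemL2wPow A (2 - ξ) γ f) {φ₀ φ₁ : H} (hφ₀ : φ₀ ∈ powDomain A 2)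
    (hφ₁ : φ₁ ∈ powDomain A 1) : ∃ u u₁ u₂ : ℝ → H,
      IsStrongSolution A (kernel c κ) ξ γ f φ₀ φ₁ u u₁ u₂ ∧
      normW2 A γ u u₂ ^ 2 ≤ 3 * normL2w γ f ^ 2 +
        (4 + 3 * (∑' j, c j / κ j) ^ 2 * (a₀ ^ (2 * ξ - 2)) ^ 2) *
          ∫ t in Ioi (0 : ℝ), Real.exp (-2 * γ * t) * energyBound A ξ a₀ δ γ f φ₀ φ₁ t := by
  have R := D.res
  have hξ : 2 * ξ ≤ 2 := by linarith [D.ξ_le_one]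
  obtain ⟨hKi, hKint⟩ := integrableOn_kernel D.c_pos D.κ_pos D.summable
  have hK0 := kernel_nonneg (κ := κ) D.c_pos
  have hK := halfLineIntegrable_kernel D.c_pos D.κ_pos D.summable
  have hf0 := (R.memL2w_of_pow (by linarith [D.ξ_le_one]) hf).1
  obtain ⟨u, hu, hmode⟩ := D.exists_modes hγ hf hφ₀ hφ₁
  set U : ℝ → H := fun t => powApply A 2 (u t) with hU
  set W : ℝ → H := fun t => powApply A (2 * ξ) (u t) with hW
  have hPU (a t : ℝ) (ht : 0 ≤ t) : eigenProj A a (U t) = a ^ (2 : ℝ) • eigenProj A a (u t) :=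
    R.eigenProj_powApply (hu t ht).1 a
  have hPW (a t : ℝ) (ht : 0 ≤ t) : eigenProj A a (W t) = a ^ (2 * ξ) • eigenProj A a (u t) :=
    R.eigenProj_powApply (R.powDomain_mono hξ (hu t ht).1) a
  have hUm : AEStronglyMeasurable U (volume.restrict (Ioi 0)) :=
    R.aestronglyMeasurable_of_continuousOn fun a =>
      ((hmode a).1.const_smul (a ^ (2 : ℝ))).congr fun t ht => hPU a t ht
  have hWm : AEStronglyMeasurable W (volume.restrict (Ioi 0)) :=
    R.aestronglyMeasurable_of_continuousOn fun a =>
      ((hmode a).1.const_smul (a ^ (2 * ξ))).congr fun t ht => hPW a t ht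
  obtain ⟨hΦi, -⟩ := energyBound_integral (a₀ := a₀) (δ := δ) hγ hf φ₀ φ₁
  have hUpt : ∀ t ∈ Ioi (0 : ℝ), Real.exp (-2 * γ * t) * ‖U t‖ ^ 2 ≤
      Real.exp (-2 * γ * t) * energyBound A ξ a₀ δ γ f φ₀ φ₁ t := fun t ht =>
    mul_le_mul_of_nonneg_left (hu t (le_of_lt ht)).2 (Real.exp_nonneg _)
  have hUi : IntegrableOn (fun t => Real.exp (-2 * γ * t) * ‖U t‖ ^ 2) (Ioi 0) := by
    refine hΦi.mono' ((by fun_prop : Continuous fun t =>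
      Real.exp (-2 * γ * t)).aestronglyMeasurable.mul (hUm.norm.pow 2)) ?_
    refine (ae_restrict_iff' measurableSet_Ioi).2 (ae_of_all _ fun t ht => ?_)
    rw [Real.norm_of_nonneg (by positivity)]
    exact hUpt t ht
  have hUL : MemL2w γ U := memL2w_iff.2 ⟨hUm, hUi⟩
  have hUN : normL2w γ U ^ 2 ≤
      ∫ t in Ioi (0 : ℝ), Real.exp (-2 * γ * t) * energyBound A ξ a₀ δ γ f φ₀ φ₁ t := by
    rw [normL2w_sq]
    exact setIntegral_mono_on hUi hΦi measurableSet_Ioi hUpt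
  have hWU (t : ℝ) (ht : 0 ≤ t) : ‖W t‖ ≤ a₀ ^ (2 * ξ - 2) * ‖U t‖ :=
    R.norm_powApply_le hξ (hu t ht).1
  obtain ⟨hWL, hWN⟩ := hUL.of_norm_le hWm ((ae_restrict_iff' measurableSet_Ioi).2
    (ae_of_all _ fun t ht => hWU t (le_of_lt ht)))
  -- No continuity of `W` in norm is available at this point; the continuous majorant `energyBound`
  -- supplies local boundedness.
  have hWb (t : ℝ) (ht : 0 ≤ t) : ∃ M, ∀ s ∈ Ioc 0 t, ‖W s‖ ≤ M := by
    obtain ⟨M, hM0, hM⟩ := exists_bound_Icc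
      (continuousOn_energyBound (a₀ := a₀) (δ := δ) hγ hf φ₀ φ₁) t
    refine ⟨a₀ ^ (2 * ξ - 2) * √M, fun s hs => (hWU s hs.1.le).trans ?_⟩
    have := R.pos
    gcongr
    refine Real.le_sqrt_of_sq_le ((hu s hs.1.le).2.trans ?_)
    exact (le_abs_self _).trans (hM s ⟨hs.1.le, hs.2⟩)
  have hKW (t : ℝ) (ht : 0 ≤ t) :
      IntervalIntegrable (fun s => kernel c κ (t - s) • W s) volume 0 t := by
    obtain ⟨M, hM⟩ := hWb t ht
    rw [intervalIntegrable_iff_integrableOn_Ioc_of_le ht]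
    exact Integrable.smul_bdd (𝕜 := ℝ)
      ((intervalIntegrable_iff_integrableOn_Ioc_of_le ht).1 (hK.comp_sub_left ht)) M
      (hWm.mono_measure (Measure.restrict_mono Ioc_subset_Ioi_self le_rfl))
      ((ae_restrict_iff' measurableSet_Ioc).2 (ae_of_all _ hM))
  have hPKW (a t : ℝ) (ht : 0 ≤ t) : eigenProj A a (vconv (kernel c κ) W t) =
      a ^ (2 * ξ) • vconv (kernel c κ) (fun r => eigenProj A a (u r)) t := by
    rw [eigenProj_vconv (hKW t ht), vconv_congr_right ht fun s hs _ => hPW a s hs.le]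
    simp only [vconv, smul_comm _ (a ^ (2 * ξ)), intervalIntegral.integral_smul]
  have hKWm : AEStronglyMeasurable (vconv (kernel c κ) W) (volume.restrict (Ioi 0)) :=
    R.aestronglyMeasurable_of_continuousOn fun a =>
      ((continuousOn_vconv_right hK (hmode a).1).const_smul (a ^ (2 * ξ))).congr
        fun t ht => hPKW a t ht
  obtain ⟨hKWL, hKWN⟩ := memL2w_vconv hK0 hKi hγ.le hWL hWb hKWm
  -- The second derivative is defined by the equation and the first as its primitive. It remains to
  -- see that `u` is the primitive of `u₁`, and this is checked on each eigenspace.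
  set u₂ : ℝ → H := fun t => f t - U t + vconv (kernel c κ) W t with hu₂
  obtain ⟨hu₂L, hu₂N⟩ := hf0.sub_add hUL hKWL
  have hu₂H := hu₂L.halfLineIntegrable
  set u₁ : ℝ → H := fun t => φ₁ + ∫ s in (0 : ℝ)..t, u₂ s with hu₁
  have hu₁c : ContinuousOn u₁ (Ici 0) := continuousOn_const.add hu₂H.continuousOn_primitive
  have hu₁H := HalfLineIntegrable.of_continuousOn hu₁c
  have hu_eq (t : ℝ) (ht : 0 ≤ t) : u t = φ₀ + ∫ s in (0 : ℝ)..t, u₁ s := by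
    refine R.ext fun a => ?_
    obtain ⟨-, y, -, hy1, hy2⟩ := hmode a
    rw [map_add, hy1 t ht, ← ContinuousLinearMap.intervalIntegral_comp_comm _ (hu₁H t ht)]
    congr 1
    refine intervalIntegral.integral_congr fun s hs => ?_
    rw [uIcc_of_le ht] at hs
    simp only [hu₁]
    rw [map_add, hy2 s hs.1, ← ContinuousLinearMap.intervalIntegral_comp_comm _ (hu₂H s hs.1)]
    congr 1
    refine intervalIntegral.integral_congr fun r hr => ?_
    rw [uIcc_of_le hs.1] at hr
    simp only [map_add, map_sub]
    rw [hPU a r hr.1, hPKW a r hr.1]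
  refine ⟨u, u₁, u₂, ⟨⟨?_, ?_, hu₂L, ?_, hUL⟩, ?_, ?_, ?_⟩, ?_⟩
  · exact isWeakDeriv_of_primitive hu₁H fun t ht => hu_eq t ht.le
  · exact isWeakDeriv_of_primitive hu₂H fun t _ => rfl
  · exact (ae_restrict_iff' measurableSet_Ioi).2 (ae_of_all _ fun t ht => (hu t (le_of_lt ht)).1)
  · refine (ae_restrict_iff' measurableSet_Ioi).2 (ae_of_all _ fun t ht => ⟨hKW t (le_of_lt ht), ?_⟩)
    have h1 : ∫ s in (0 : ℝ)..t, kernel c κ (t - s) • powApply A (2 * ξ) (u s) =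
      vconv (kernel c κ) W t := rfl
    rw [h1]
    simp only [hu₂, hU]
    abel
  · exact hasInitialValue_of_primitive hu₁H fun t ht => hu_eq t ht.le
  · exact hasInitialValue_of_primitive hu₂H fun t _ => rfl
  · rw [normW2_sq hUL hu₂L]
    rw [hKint] at hKWN
    have h1 : normL2w γ (vconv (kernel c κ) W) ^ 2 ≤
        (∑' j, c j / κ j) ^ 2 * (a₀ ^ (2 * ξ - 2)) ^ 2 * normL2w γ U ^ 2 := by
      refine hKWN.trans ?_
      rw [mul_assoc]
      gcongr
    -- The 4 is the 3 with which A²u enters the bound for `u₂`, plus 1 for its own place in the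
    -- norm.
    have h2 := mul_le_mul_of_nonneg_left hUN
      (show 0 ≤ 4 + 3 * (∑' j, c j / κ j) ^ 2 * (a₀ ^ (2 * ξ - 2)) ^ 2 by positivity)
    linarith

theorem Admissible.exists_isStrongSolution (D : Admissible A c κ ξ a₀ δ) {γ : ℝ} (hγ : 0 < γ) :
    ∃ d : ℝ, 0 < d ∧ ∀ (f : ℝ → H) (φ₀ φ₁ : H), MemL2wPow A (2 - ξ) γ f →
      φ₀ ∈ powDomain A 2 → φ₁ ∈ powDomain A 1 → ∃ u u₁ u₂ : ℝ → H,
        IsStrongSolution A (kernel c κ) ξ γ f φ₀ φ₁ u u₁ u₂ ∧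
        normW2 A γ u u₂ ≤ d * (normL2w γ (fun t => powApply A (2 - ξ) (f t)) +
          ‖powApply A 2 φ₀‖ + ‖powApply A 1 φ₁‖) := by
  have R := D.res
  have hδ := inv_nonneg.2 D.δ_pos.le
  set B := 4 + 3 * (∑' j, c j / κ j) ^ 2 * (a₀ ^ (2 * ξ - 2)) ^ 2 with hB
  set c₁ := 3 * (a₀ ^ (-(2 - ξ))) ^ 2 +
    B * (3 * (δ⁻¹ * (a₀ ^ (1 - (2 - ξ))) ^ 2 * γ⁻¹ ^ 2)) with hc₁
  set c₂ := B * (3 * (2 * γ)⁻¹) with hc₂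
  set c₃ := B * (3 * ((2 * γ)⁻¹ * δ⁻¹)) with hc₃
  have hB0 : 0 < B := by positivity
  have h₁ : 0 ≤ c₁ := by positivity
  have h₂ : 0 < c₂ := by positivity
  have h₃ : 0 ≤ c₃ := by positivity
  -- From c₁x² + c₂y² + c₃z² ≤ (c₁ + c₂ + c₃)(x + y + z)² for nonnegative x, y, z.
  refine ⟨√(c₁ + c₂ + c₃), Real.sqrt_pos.2 (by positivity), fun f φ₀ φ₁ hf hφ₀ hφ₁ => ?_⟩
  obtain ⟨u, u₁, u₂, hsol, hle⟩ := D.exists_isStrongSolution_sq hγ hf hφ₀ hφ₁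
  refine ⟨u, u₁, u₂, hsol, ?_⟩
  have hf0 := (R.memL2w_of_pow (by linarith [D.ξ_le_one]) hf).2
  rw [(energyBound_integral hγ hf φ₀ φ₁).2] at hle
  set x := normL2w γ fun t => powApply A (2 - ξ) (f t)
  set y := ‖powApply A 2 φ₀‖
  set z := ‖powApply A 1 φ₁‖
  have hx : 0 ≤ x := Real.sqrt_nonneg _
  have hy : 0 ≤ y := norm_nonneg _
  have hz : 0 ≤ z := norm_nonneg _
  have h4 : normW2 A γ u u₂ ^ 2 ≤ c₁ * x ^ 2 + c₂ * y ^ 2 + c₃ * z ^ 2 := by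
    refine hle.trans ?_
    rw [hc₁, hc₂, hc₃]
    linarith
  refine le_of_sq_le_sq ?_ (by positivity)
  rw [mul_pow, Real.sq_sqrt (by positivity)]
  have h5 : x ^ 2 ≤ (x + y + z) ^ 2 := by gcongr; linarith
  have h6 : y ^ 2 ≤ (x + y + z) ^ 2 := by gcongr; linarith
  have h7 : z ^ 2 ≤ (x + y + z) ^ 2 := by gcongr; linarith
  calc _ ≤ _ := h4
    _ ≤ c₁ * (x + y + z) ^ 2 + c₂ * (x + y + z) ^ 2 + c₃ * (x + y + z) ^ 2 := by gcongr
    _ = _ := by ring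

/-! ### Uniqueness -/

theorem norm_intervalIntegral_le_exp {E : Type*} [NormedAddCommGroup E] [NormedSpace ℝ E]
    {μ B t : ℝ} (hμ : 0 < μ) (hB : 0 ≤ B) {g : ℝ → E} (ht : 0 ≤ t)
    (hg : ∀ s ∈ Ioc 0 t, ‖g s‖ ≤ B * Real.exp (μ * s)) :
    ‖∫ s in (0 : ℝ)..t, g s‖ ≤ B / μ * Real.exp (μ * t) := by
  have hc : Continuous fun s => B * Real.exp (μ * s) := by fun_prop
  refine (intervalIntegral.norm_integral_le_of_norm_le ht (ae_of_all _ hg)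
    (hc.intervalIntegrable _ _)).trans ?_
  rw [intervalIntegral.integral_const_mul, intervalIntegral.integral_comp_mul_left _ hμ.ne',
    integral_exp, mul_zero, Real.exp_zero, smul_eq_mul, div_mul_eq_mul_div, mul_div_assoc,
    inv_mul_eq_div]
  gcongr
  linarith

/-- Let M be the maximum of e^(-μt)‖z(t)‖ on [0, T]. The right-hand side costs a factor l = |α| +
|b|k, with k = ∫K, and each of the two integrations gains 1/μ. Hence M ≤ (l/μ²)M, and μ = l + 1
makes l/μ² < 1, so M = 0. -/
theorem eq_zero_of_volterra {E : Type*} [NormedAddCommGroup E] [NormedSpace ℝ E] {K : ℝ → ℝ}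
    (hK0 : ∀ t, 0 ≤ K t) (hK : IntegrableOn K (Ioi 0)) {α b : ℝ} {z η : ℝ → E}
    (hzc : ContinuousOn z (Ici 0)) (hz : ∀ t, 0 ≤ t → z t = ∫ s in (0 : ℝ)..t, η s)
    (hη : ∀ t, 0 ≤ t → η t = ∫ s in (0 : ℝ)..t, (-α • z s + b • vconv K z s)) {T : ℝ}
    (hT : 0 ≤ T) : z T = 0 := by
  set k := ∫ t in Ioi (0 : ℝ), K t with hk
  have hk0 : 0 ≤ k := integral_nonneg fun t => hK0 t
  have hKH : HalfLineIntegrable K := fun T hT =>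
    (intervalIntegrable_iff_integrableOn_Ioc_of_le hT).2 (hK.mono_set Ioc_subset_Ioi_self)
  set l := |α| + |b| * k with hl
  have hl0 : 0 ≤ l := by positivity
  set μ := l + 1 with hμ
  have hμ0 : 0 < μ := by positivity
  obtain ⟨t₀, ht₀, hmax⟩ := isCompact_Icc.exists_isMaxOn (nonempty_Icc.2 hT)
    (f := fun t => Real.exp (-μ * t) * ‖z t‖)
    ((by fun_prop : Continuous fun t => Real.exp (-μ * t)).continuousOn.mul
      (hzc.norm.mono fun _ h => (mem_Icc.1 h).1 : ContinuousOn (fun t => ‖z t‖) (Icc 0 T)))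
  set M := Real.exp (-μ * t₀) * ‖z t₀‖ with hM
  have hM0 : 0 ≤ M := by positivity
  have e (t : ℝ) : Real.exp (-μ * t) * Real.exp (μ * t) = 1 := by
    rw [← Real.exp_add]
    simp
  have hzM : ∀ t ∈ Icc 0 T, ‖z t‖ ≤ M * Real.exp (μ * t) := by
    intro t ht
    have h1 : Real.exp (-μ * t) * ‖z t‖ ≤ M := hmax ht
    calc ‖z t‖ = (Real.exp (-μ * t) * ‖z t‖) * Real.exp (μ * t) := by
          linear_combination (-‖z t‖) * e t
      _ ≤ _ := by gcongr
  have hKz : ∀ t ∈ Icc 0 T, ‖vconv K z t‖ ≤ k * M * Real.exp (μ * t) := by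
    intro t ht
    have h1 : ‖vconv K z t‖ ≤ ∫ s in (0 : ℝ)..t, K (t - s) * (M * Real.exp (μ * t)) := by
      refine intervalIntegral.norm_integral_le_of_norm_le ht.1 (ae_of_all _ fun s hs => ?_)
        ((hKH.comp_sub_left ht.1).mul_const _)
      rw [norm_smul, Real.norm_of_nonneg (hK0 _)]
      refine mul_le_mul_of_nonneg_left ((hzM s ⟨hs.1.le, hs.2.trans ht.2⟩).trans ?_) (hK0 _)
      have := hs.2
      gcongr
    have h2 : ∫ s in (0 : ℝ)..t, K (t - s) ≤ k := by
      rw [intervalIntegral.integral_comp_sub_left, sub_self, sub_zero,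
        intervalIntegral.integral_of_le ht.1]
      exact setIntegral_mono_set hK (ae_of_all _ hK0) Ioc_subset_Ioi_self.eventuallyLE
    rw [intervalIntegral.integral_mul_const] at h1
    refine h1.trans ?_
    rw [mul_assoc k]
    gcongr
  have hηM : ∀ t ∈ Icc 0 T, ‖η t‖ ≤ l * M / μ * Real.exp (μ * t) := by
    intro t ht
    rw [hη t ht.1]
    refine norm_intervalIntegral_le_exp hμ0 (by positivity) ht.1 fun s hs => ?_
    have hs' : s ∈ Icc 0 T := ⟨hs.1.le, hs.2.trans ht.2⟩
    refine (norm_add_le _ _).trans ?_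
    rw [norm_smul, norm_smul, norm_neg, Real.norm_eq_abs, Real.norm_eq_abs]
    have h1 := mul_le_mul_of_nonneg_left (hzM s hs') (abs_nonneg α)
    have h2 := mul_le_mul_of_nonneg_left (hKz s hs') (abs_nonneg b)
    rw [hl]
    linarith
  have hz0 : ‖z t₀‖ ≤ l * M / μ / μ * Real.exp (μ * t₀) := by
    rw [hz t₀ ht₀.1]
    exact norm_intervalIntegral_le_exp hμ0 (by positivity) ht₀.1 fun s hs =>
      hηM s ⟨hs.1.le, hs.2.trans ht₀.2⟩
  have hMM : M ≤ l * M / μ / μ := by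
    calc M ≤ Real.exp (-μ * t₀) * (l * M / μ / μ * Real.exp (μ * t₀)) := by
          rw [hM]
          gcongr
      _ = _ := by linear_combination (l * M / μ / μ) * e t₀
  have hM_zero : M = 0 := by
    rw [div_div, le_div_iff₀ (by positivity)] at hMM
    have h1 : l < μ * μ := by nlinarith
    nlinarith
  have := hzM T ⟨hT, le_rfl⟩
  rw [hM_zero, zero_mul] at this
  exact norm_le_zero_iff.1 this

variable {H : Type*} [NormedAddCommGroup H] [InnerProductSpace ℂ H] [CompleteSpace H]
  {A : H →ₗ.[ℂ] H} {c κ : ℕ → ℝ} {ξ a₀ δ : ℝ}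

theorem HalfLineIntegrable.congr_ae {E : Type*} [NormedAddCommGroup E] {g h : ℝ → E}
    (hg : HalfLineIntegrable g) (hgh : ∀ᵐ t ∂(volume.restrict (Ioi (0 : ℝ))), g t = h t) :
    HalfLineIntegrable h := fun T hT => by
  rw [intervalIntegrable_iff_integrableOn_Ioc_of_le hT]
  exact (hg.integrableOn_Ioc hT).congr
    (ae_mono (Measure.restrict_mono Ioc_subset_Ioi_self le_rfl) hgh)

/-- Every strong solution has a continuous representative whose spectral components solve the
corresponding scalar equations. -/
theorem Admissible.exists_rep_of_isStrongSolution (D : Admissible A c κ ξ a₀ δ) {γ : ℝ}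
    {f : ℝ → H} {φ₀ φ₁ : H} {v v₁ v₂ : ℝ → H}
    (h : IsStrongSolution A (kernel c κ) ξ γ f φ₀ φ₁ v v₁ v₂) :
    ∃ w : ℝ → H, (∀ᵐ t ∂(volume.restrict (Ioi (0 : ℝ))), v t = w t) ∧
      ∀ a, ContinuousOn (fun t => eigenProj A a (w t)) (Ici 0) ∧
        ∃ y : ℝ → H, ContinuousOn y (Ici 0) ∧
          (∀ t, 0 ≤ t → eigenProj A a (w t) = eigenProj A a φ₀ + ∫ s in (0 : ℝ)..t, y s) ∧
          ∀ t, 0 ≤ t → y t = eigenProj A a φ₁ + ∫ s in (0 : ℝ)..t,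
            (eigenProj A a (f s) - a ^ (2 : ℝ) • eigenProj A a (w s) +
              a ^ (2 * ξ) • vconv (kernel c κ) (fun r => eigenProj A a (w r)) s) := by
  have R := D.res
  have hξ : 2 * ξ ≤ 2 := by linarith [D.ξ_le_one]
  have hv₂ := h.memW2.memL2_deriv_two.halfLineIntegrable
  have hv₁ := h.memW2.weakDeriv_two.ae_eq_primitive hv₂ h.initial_one
  have hw₁ : ContinuousOn (fun t => φ₁ + ∫ s in (0 : ℝ)..t, v₂ s) (Ici 0) :=
    continuousOn_const.add hv₂.continuousOn_primitive
  have hw₁H := HalfLineIntegrable.of_continuousOn hw₁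
  have hv₁H : HalfLineIntegrable v₁ := hw₁H.congr_ae (hv₁.mono fun _ => Eq.symm)
  have hv := h.memW2.weakDeriv_one.ae_eq_primitive hv₁H h.initial_zero
  set w : ℝ → H := fun t => φ₀ + ∫ s in (0 : ℝ)..t, v₁ s with hw
  have hwc : ContinuousOn w (Ici 0) := continuousOn_const.add hv₁H.continuousOn_primitive
  refine ⟨w, hv, fun a => ⟨(eigenProj A a).continuous.comp_continuousOn hwc,
    fun t => eigenProj A a (φ₁ + ∫ s in (0 : ℝ)..t, v₂ s),
    (eigenProj A a).continuous.comp_continuousOn hw₁, fun t ht => ?_, fun t ht => ?_⟩⟩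
  · rw [hw, map_add, ← ContinuousLinearMap.intervalIntegral_comp_comm _ (hv₁H t ht)]
    congr 1
    refine intervalIntegral.integral_congr_ae ?_
    filter_upwards [(ae_restrict_iff' measurableSet_Ioi).1 hv₁] with s hs hst
    rw [uIoc_of_le ht] at hst
    rw [hs hst.1]
  · beta_reduce
    rw [map_add, ← ContinuousLinearMap.intervalIntegral_comp_comm _ (hv₂ t ht)]
    congr 1
    refine intervalIntegral.integral_congr_ae ?_
    filter_upwards [(ae_restrict_iff' measurableSet_Ioi).1 h.equation,
      (ae_restrict_iff' measurableSet_Ioi).1 h.memW2.memL2_pow_two.1,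
      (ae_restrict_iff' measurableSet_Ioi).1 hv] with s hs1 hs2 hs3 hst
    rw [uIoc_of_le ht] at hst
    obtain ⟨hi, heq⟩ := hs1 hst.1
    have h1 : v₂ s = f s - powApply A 2 (v s) +
        vconv (kernel c κ) (fun r => powApply A (2 * ξ) (v r)) s := by
      rw [← heq, vconv]
      abel
    rw [h1, map_add, map_sub, R.eigenProj_powApply (hs2 hst.1), hs3 hst.1, eigenProj_vconv hi]
    congr 1
    have h2 : ∀ᵐ r ∂(volume.restrict (Ioi (0 : ℝ))), eigenProj A a (powApply A (2 * ξ) (v r)) =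
        a ^ (2 * ξ) • eigenProj A a (w r) := by
      filter_upwards [h.memW2.memL2_pow_two.1, hv] with r hr1 hr2
      rw [R.eigenProj_powApply (R.powDomain_mono hξ hr1), hr2]
    rw [vconv_congr_ae hst.1.le h2]
    simp only [vconv, smul_comm _ (a ^ (2 * ξ)), intervalIntegral.integral_smul]

/-- In each eigenspace the forcing and the initial data cancel in the difference, leaving a
homogeneous Volterra equation. The projections separate points. -/
theorem Admissible.isStrongSolution_unique (D : Admissible A c κ ξ a₀ δ) {γ : ℝ}
    {f : ℝ → H} (hf : MemL2w γ f) {φ₀ φ₁ : H} {u u₁ u₂ v v₁ v₂ : ℝ → H}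
    (hu : IsStrongSolution A (kernel c κ) ξ γ f φ₀ φ₁ u u₁ u₂)
    (hv : IsStrongSolution A (kernel c κ) ξ γ f φ₀ φ₁ v v₁ v₂) :
    v =ᵐ[volume.restrict (Ioi 0)] u := by
  have hKi := (integrableOn_kernel D.c_pos D.κ_pos D.summable).1
  have hK := halfLineIntegrable_kernel D.c_pos D.κ_pos D.summable
  obtain ⟨w, hw, hwm⟩ := D.exists_rep_of_isStrongSolution hu
  obtain ⟨w', hw', hwm'⟩ := D.exists_rep_of_isStrongSolution hv
  filter_upwards [hw, hw', ae_restrict_mem measurableSet_Ioi] with t h1 h2 ht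
  rw [h1, h2]
  refine D.res.ext fun a => ?_
  obtain ⟨hc, y, hyc, hy1, hy2⟩ := hwm a
  obtain ⟨hc', y', hyc', hy1', hy2'⟩ := hwm' a
  set x := fun t => eigenProj A a (w t)
  set x' := fun t => eigenProj A a (w' t)
  have hfa := (HasSpectralResolution.memL2w_eigenProj (A := A) hf a).halfLineIntegrable
  have hint {x : ℝ → H} (hx : ContinuousOn x (Ici 0)) :
      HalfLineIntegrable fun s => eigenProj A a (f s) - a ^ (2 : ℝ) • x s +
        a ^ (2 * ξ) • vconv (kernel c κ) x s :=
    (hfa.sub ((HalfLineIntegrable.of_continuousOn hx).const_smul _)).add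
      ((HalfLineIntegrable.of_continuousOn (continuousOn_vconv_right hK hx)).const_smul _)
  rw [← sub_eq_zero]
  refine eq_zero_of_volterra (kernel_nonneg D.c_pos) hKi (α := a ^ (2 : ℝ)) (b := a ^ (2 * ξ))
    (z := fun t => x' t - x t) (η := fun t => y' t - y t) (hc'.sub hc) (fun t ht => ?_)
    (fun t ht => ?_) (le_of_lt ht)
  · rw [intervalIntegral.integral_sub (HalfLineIntegrable.of_continuousOn hyc' t ht)
      (HalfLineIntegrable.of_continuousOn hyc t ht)]
    simp only [x, x']
    rw [hy1 t ht, hy1' t ht]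
    abel
  · rw [hy2 t ht, hy2' t ht, add_sub_add_left_eq_sub,
      ← intervalIntegral.integral_sub (hint hc' t ht) (hint hc t ht)]
    refine intervalIntegral.integral_congr fun s hs => ?_
    rw [uIcc_of_le ht] at hs
    have h3 : vconv (kernel c κ) (fun t => x' t - x t) s =
        vconv (kernel c κ) x' s - vconv (kernel c κ) x s := by
      simp only [vconv, smul_sub]
      exact intervalIntegral.integral_sub (intervalIntegrable_vconv_right hK hc' hs.1)
        (intervalIntegrable_vconv_right hK hc hs.1)
    simp only [h3]
    module

/-! ### Spectral gap and conclusion -/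

theorem exists_admissible [TopologicalSpace.SeparableSpace H] (hA : IsSelfAdjoint A)
    (hApos : IsPositive A) (hAinv : HasCompactInverse A) (hc : ∀ j, 0 < c j) (hκ : ∀ j, 0 < κ j)
    (hsum : Summable fun j => c j / κ j) (hξ1 : ξ ≤ 1)
    (hspec : ∀ a : ℝ, eigenspace A a ≠ ⊥ → ∑' j, c j / κ j < a ^ (2 * (1 - ξ))) :
    ∃ a₀ δ, Admissible A c κ ξ a₀ δ := by
  have hne {a : ℝ} (ha : eigenProj A a ≠ 0) : eigenspace A a ≠ ⊥ := fun h => ha (by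
    ext x
    exact eigenProj_eq_zero h hAinv x)
  by_cases hex : ∃ a, eigenspace A a ≠ ⊥
  · obtain ⟨a, ha⟩ := hex
    obtain ⟨x, -, hx⟩ := Submodule.exists_mem_ne_zero_of_ne_bot ha
    have : Nontrivial H := nontrivial_of_ne x 0 hx
    obtain ⟨a₀, ha₀, hle⟩ := exists_least_eigenvalue hA hApos hAinv
    have hpos := eigenvalue_pos hApos ha₀
    set k := ∑' j, c j / κ j with hk
    have hk0 : 0 ≤ k := tsum_nonneg fun j => (div_pos (hc j) (hκ j)).le
    set m := a₀ ^ (2 * (1 - ξ)) with hm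
    have hm0 : 0 < m := Real.rpow_pos_of_pos hpos _
    -- With m = a₀^(2(1-ξ)), the hypothesis at the least eigenvalue gives k < m. As ξ ≤ 1,
    -- a^(2(1-ξ)) ≥ m for every eigenvalue a, so the same δ = 1 - k/m works for all of them.
    refine ⟨a₀, 1 - k / m, hasSpectralResolution hA hAinv hpos hle, hc, hκ, hsum, hξ1,
      sub_pos.2 ((div_lt_one hm0).2 (hspec a₀ ha₀)), fun a ha => ?_⟩
    have hae := hle a (hne ha)
    have ha0 : 0 < a := hpos.trans_le hae
    have h1 : a ^ (2 : ℝ) = a ^ (2 * ξ) * a ^ (2 * (1 - ξ)) := by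
      rw [← Real.rpow_add ha0]
      ring_nf
    have h2 : m ≤ a ^ (2 * (1 - ξ)) :=
      Real.rpow_le_rpow hpos.le hae (by linarith)
    have h3 : a ^ (2 * ξ) * k ≤ k / m * a ^ (2 : ℝ) := by
      calc a ^ (2 * ξ) * k = k / m * (a ^ (2 * ξ) * m) := by field_simp
        _ ≤ _ := by
          rw [h1]
          gcongr
    linarith
  -- Without eigenvalues all projections vanish, so any positive constants serve.
  · push Not at hex
    exact ⟨1, 1, hasSpectralResolution hA hAinv one_pos fun a ha => absurd (hex a) ha, hc, hκ, hsum,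
      hξ1, one_pos, fun a ha => absurd (hex a) (hne ha)⟩

end HypVolterra

theorem mainTheorem1 {H : Type*} [NormedAddCommGroup H] [InnerProductSpace ℂ H] [CompleteSpace H]
    [TopologicalSpace.SeparableSpace H]
    (A : H →ₗ.[ℂ] H) (hA : IsSelfAdjoint A) (hApos : IsPositive A) (hAinv : HasCompactInverse A)
    (c κ : ℕ → ℝ) (hc : ∀ j, 0 < c j) (hκ : ∀ j, 0 < κ j) (hκmono : StrictMono κ)
    (hκtop : Tendsto κ atTop atTop)
    (hsum : Summable fun j => c j / κ j) (hlt : ∑' j, c j / κ j < 1)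
    (ξ : ℝ) (hξ0 : 0 ≤ ξ) (hξ1 : ξ ≤ 1)
    (hspec : ∀ a : ℝ, eigenspace A a ≠ ⊥ → ∑' j, c j / κ j < a ^ (2 * (1 - ξ)))
    (γ₀ : ℝ) (hγ₀ : 0 ≤ γ₀) :
    (Summable c →
      ∀ γ : ℝ, γ₀ < γ → ∃ d : ℝ, 0 < d ∧
        ∀ (f : ℝ → H) (φ₀ φ₁ : H), MemL2wPow A (2 - ξ) γ₀ f →
          φ₀ ∈ powDomain A 2 → φ₁ ∈ powDomain A 1 →
          ∃ u u₁ u₂ : ℝ → H,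
            IsStrongSolution A (kernel c κ) ξ γ f φ₀ φ₁ u u₁ u₂ ∧
            (∀ v v₁ v₂ : ℝ → H, IsStrongSolution A (kernel c κ) ξ γ f φ₀ φ₁ v v₁ v₂ →
              v =ᵐ[volume.restrict (Ioi 0)] u) ∧
            normW2 A γ u u₂ ≤
              d * (normL2w γ (fun t => powApply A (2 - ξ) (f t)) +
                ‖powApply A 2 φ₀‖ + ‖powApply A 1 φ₁‖)) ∧
    (¬ Summable c → 0 < ξ →
      ∀ γ : ℝ, γ₀ < γ → ∃ d : ℝ, 0 < d ∧
        ∀ (f : ℝ → H) (φ₀ φ₁ : H), MemL2wPow A (2 - ξ) γ₀ f →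
          φ₀ ∈ powDomain A (2 + ξ) → φ₁ ∈ powDomain A (1 + ξ) →
          ∃ u u₁ u₂ : ℝ → H,
            IsStrongSolution A (kernel c κ) ξ γ f φ₀ φ₁ u u₁ u₂ ∧
            (∀ v v₁ v₂ : ℝ → H, IsStrongSolution A (kernel c κ) ξ γ f φ₀ φ₁ v v₁ v₂ →
              v =ᵐ[volume.restrict (Ioi 0)] u) ∧
            normW2 A γ u u₂ ≤
              d * (normL2w γ (fun t => powApply A (2 - ξ) (f t)) +
                ‖powApply A (2 + ξ) φ₀‖ + ‖powApply A (1 + ξ) φ₁‖)) := by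
  obtain ⟨a₀, δ, D⟩ := exists_admissible hA hApos hAinv hc hκ hsum hξ1 hspec
  have R := D.res
  have hpos := R.pos
  have main : ∀ γ : ℝ, γ₀ < γ → ∃ d : ℝ, 0 < d ∧
      ∀ (f : ℝ → H) (φ₀ φ₁ : H), MemL2wPow A (2 - ξ) γ₀ f →
        φ₀ ∈ powDomain A 2 → φ₁ ∈ powDomain A 1 →
        ∃ u u₁ u₂ : ℝ → H,
          IsStrongSolution A (kernel c κ) ξ γ f φ₀ φ₁ u u₁ u₂ ∧
          (∀ v v₁ v₂ : ℝ → H, IsStrongSolution A (kernel c κ) ξ γ f φ₀ φ₁ v v₁ v₂ →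
            v =ᵐ[volume.restrict (Ioi 0)] u) ∧
          normW2 A γ u u₂ ≤
            d * (normL2w γ (fun t => powApply A (2 - ξ) (f t)) +
              ‖powApply A 2 φ₀‖ + ‖powApply A 1 φ₁‖) := by
    intro γ hγ
    obtain ⟨d, hd, hsol⟩ := D.exists_isStrongSolution (hγ₀.trans_lt hγ)
    refine ⟨d, hd, fun f φ₀ φ₁ hf hφ₀ hφ₁ => ?_⟩
    have hf' : MemL2wPow A (2 - ξ) γ f := ⟨hf.1, hf.2.mono hγ.le⟩
    obtain ⟨u, u₁, u₂, hu, hle⟩ := hsol f φ₀ φ₁ hf' hφ₀ hφ₁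
    exact ⟨u, u₁, u₂, hu, fun v v₁ v₂ hv =>
      D.isStrongSolution_unique (R.memL2w_of_pow (by linarith) hf').1 hu hv, hle⟩
  refine ⟨fun _ => main, fun _ _ γ hγ => ?_⟩
  obtain ⟨d, hd, hsol⟩ := main γ hγ
  -- The summand `a₀ ^ (-ξ)` pays for raising the exponents 2 and 1 by ξ; the summand 1 keeps the
  -- term in f.
  refine ⟨d * (1 + a₀ ^ (-ξ)), by positivity, fun f φ₀ φ₁ hf hφ₀ hφ₁ => ?_⟩
  obtain ⟨u, u₁, u₂, hu, huniq, hle⟩ := hsol f φ₀ φ₁ hf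
    (R.powDomain_mono (by linarith) hφ₀) (R.powDomain_mono (by linarith) hφ₁)
  refine ⟨u, u₁, u₂, hu, huniq, hle.trans ?_⟩
  have h0 := R.norm_powApply_le (α := 2) (by linarith) hφ₀
  have h1 := R.norm_powApply_le (α := 1) (by linarith) hφ₁
  rw [show (2 : ℝ) - (2 + ξ) = -ξ by ring] at h0
  rw [show (1 : ℝ) - (1 + ξ) = -ξ by ring] at h1
  have hx : 0 ≤ normL2w γ (fun t => powApply A (2 - ξ) (f t)) := Real.sqrt_nonneg _
  have hr : 0 < a₀ ^ (-ξ) := by positivity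
  rw [mul_assoc]
  refine mul_le_mul_of_nonneg_left ?_ hd.le
  have h2 := norm_nonneg (powApply A (2 + ξ) φ₀)
  have h3 := norm_nonneg (powApply A (1 + ξ) φ₁)
  have h4 := mul_nonneg hr.le hx
  linarith
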